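/- **Setting.** In online matching on the line, an input of size $n$ consists of servers $s_1\le\dots\le s_n$ in $\mathbb R$, known in advance, and requests $r_1,\dots,r_n\in\mathbb R$ arriving one by one; each request has to be matched on arrival to an unmatched server, at a cost equal to their distance. A (possibly randomized) online algorithm $\mathrm A$ is $c(n)$-competitive with additive constant $\alpha$ if on every input of every size $n$ it produces a matching whose (expected) cost is at most $c(n)\cdot\mathrm{OPT}+\alpha$. An algorithm with advice may moreover read bits, one after the other, from an infinite tape; it is $c(n)$-competitive with additive constant $\alpha$ if for every input there is a tape content for which this bound holds. **Algorithm $\mathrm{LR}$** serves $r$ by an unmatched server equal to $r$ if there is one; by the least (greatest) unmatched server if all unmatched servers are greater (less) than $r$; otherwise it reads a bit and takes the greatest unmatched server below $r$ (bit 0) or the least one above $r$ (bit 1). **Algorithm $\mathrm{DIVIDE}_k$** ($1\le k\le n$), with a subroutine $\mathrm A$, for inputs with $s_1=1$, $s_n=N-1$, $N\in\mathbb Z^+$ and integer requests. Split the servers, in order, into $S_1,\dots,S_k$, where the first $n\bmod k$ of them have $\lceil n/k\rceil$ servers and the others $\lfloor n/k\rfloor$. Let $p_i=\frac12(\max S_i+\min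 S_{i+1})$, $B_1=(-\infty,p_1]$, $B_i=(p_{i-1},p_i]$ for $1<i<k$, $B_k=(p_{k-1},\infty)$ (and $B_1=\mathbb R$ if $k=1$). The position of a request $r$ is $\bar r=\max(0,\min(r,N))$. The algorithm first reads * for $i=2,\dots,k$ a word $q_{i,L}$ and then for $i=1,\dots,k-1$ a word $q_{i,R}$, of $\lfloor\log_2N\rfloor+1$ bits each; block $i$ *exits left* if $i\ge2$ and $q_{i,L}\ne0$, and *exits right* if $i\le k-1$ and $q_{i,R}$ is not the all-1 word; * for $i=1,\dots,k-1$, if block $i$ exits right, numbers $d_{i,R},m_{i,R}$ of $\lfloor\log_2n\rfloor+1$ bits each; then for $i=k,\dots,2$, if block $i$ exits left, numbers $d_{i,L},m_{i,L}$ of the same length. (Intended meaning, for an optimal matching that is monotone: $q_{i,L}$ is the position of the rightmost request of $B_i$ matched into some $S_j$, $j<i$, and $m_{i,L}$ the number of such requests; $q_{i,R}$ is the position of the leftmost request of $B_i$ matched into some $S_j$, $j>i$, and $m_{i,R}$ the number of such requests; $d_{i,R}$ is the number of requests of $B_i$ at $q_{i,R}$ matched into $S_i$, and $d_{i,L}$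 the number of requests of $B_i$ at $q_{i,L}$ not matched to the left outside.) It marks servers: for $i=1,\dots,k-1$ the $m_{i,R}$ consecutive servers starting with the first server of $S_{i+1}\cup\dots\cup S_k$ not yet marked in this procedure; independently, for $i=k,\dots,2$ the $m_{i,L}$ consecutive servers going down from the last server of $S_1\cup\dots\cup S_{i-1}$ not yet marked in this second procedure. A request $r\in B_j$ is then treated by the first rule that applies, where $u$ and $v$ are the numbers of earlier requests of $B_j$ at the position $\bar r$ that were left unmarked and marked right, respectively, and where "$\bar r=q_{j,R}$", "$\bar r=q_{j,L}$" include that block $j$ exits right, left: 1. $\bar r=q_{j,R}$ and $u<d_{j,R}$: unmarked; 2. $\bar r=q_{j,L}$, not $\bar r=q_{j,R}$, and $u<d_{j,L}$: unmarked; 3. block $j$ exits right, $\bar r>q_{j,R}$, and fewer than $m_{j,R}$ earlier requests of $B_j$ were marked right: marked right; 4. $\bar r=q_{j,R}$, and if also $\bar r=q_{j,L}$ then $u+v<d_{j,L}$: marked right; 5. block $j$ exits left, $\bar r<q_{j,L}$, and fewer than $m_{j,L}$ earlier requests of $B_j$ were marked left: marked left; 6. $\bar r=q_{j,L}$: marked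 left; 7. otherwise: unmarked. An unmarked request of $B_j$ is served by $\mathrm A$, run on the unmarked servers of $S_j$ and the unmarked requests of $B_j$. A marked request is served by $\mathrm{LR}$, run on the marked servers and requests, with the advice bit 1 if it is marked right and 0 if it is marked left. **Statement.** For every constant $b\in\mathbb R$ there is a constant $C$, depending only on $b$, such that the following holds for every nondecreasing $c:\mathbb N\to\mathbb R$, every (possibly randomized) online algorithm $\mathrm A$ without advice that is $c(n)$-competitive with an additive constant $\alpha$, and every integer $k\ge1$. On the inputs as above with $n\ge k$ and $N=n^b$, the algorithm $\mathrm{DIVIDE}_k$ with subroutine $\mathrm A$ is $c(\lceil n/k\rceil)$-competitive with additive constant $k\alpha$, and it reads at most $C\,k\log n$ bits of advice (whatever the content of the tape). -/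

import Mathlib

open MeasureTheory

noncomputable section

namespace LineMatching

/-! ### Online matching on the line -/

/-- An input: servers `s_1 ≤ … ≤ s_n` on the real line and a sequence of `n` requests, in the order
of their arrival. -/
structure Input where
  servers : List ℝ
  requests : List ℝ
  sorted : servers.SortedLE
  length_eq : requests.length = servers.length

/-- The size `n` of the input. -/
def Input.size (I : Input) : ℕ := I.servers.length

/-- A list of server indices (counted from `0`), the `i`-th of which is the server of the `i`-th
request, is a matching when every server is used exactly once. -/
def Input.IsMatching (I : Input) (σ : List ℕ) : Prop :=
  σ.Perm (List.range I.size)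

/-- The total distance between the requests and the servers assigned to them. -/
def Input.cost (I : Input) (σ : List ℕ) : ℝ :=
  (List.zipWith (fun r j => |r - I.servers.getD j 0|) I.requests σ).sum

/-- The optimal cost (an infimum over a finite nonempty set). -/
def Input.opt (I : Input) : ℝ :=
  sInf {x : ℝ | ∃ σ : List ℕ, I.IsMatching σ ∧ I.cost σ = x}

/-- A deterministic online algorithm without advice: the index of the server for the current
request is computed from the servers, the earlier requests (in order of arrival) and the current
request. -/
structure OnlineAlgorithm where
  serve : (servers past : List ℝ) → (current : ℝ) → ℕ

/-- The answers to `requests`, when the requests `past` have already been served. -/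
def OnlineAlgorithm.answersFrom (A : OnlineAlgorithm) (servers : List ℝ) :
    (past requests : List ℝ) → List ℕ
  | _, [] => []
  | past, r :: rs => A.serve servers past r :: A.answersFrom servers (past ++ [r]) rs

/-- The answers of the algorithm on an input. -/
def OnlineAlgorithm.answers (A : OnlineAlgorithm) (I : Input) : List ℕ :=
  A.answersFrom I.servers [] I.requests

/-- A randomized online algorithm is a family of deterministic ones, indexed by the points of a
probability space (a deterministic algorithm is the case of a one-point space). It is
`c(n)`-competitive with additive constant `α` when it always produces a matching, and its expected
cost is at most `c(n) * opt + α` on every input of size `n`, for every `n`. -/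
def IsCompetitive {Ω : Type*} [MeasurableSpace Ω] (μ : Measure Ω) (A : Ω → OnlineAlgorithm)
    (c : ℕ → ℝ) (α : ℝ) : Prop :=
  ∀ I : Input,
    (∀ ω, I.IsMatching ((A ω).answers I)) ∧
    Integrable (fun ω => I.cost ((A ω).answers I)) μ ∧
    ∫ ω, I.cost ((A ω).answers I) ∂μ ≤ c I.size * I.opt + α

/-! ### Advice tapes -/

/-- A computation that reads bits one after the other from an advice tape. -/
inductive BitReader (β : Type) : Type
  | done : β → BitReader β
  | read : (Bool → BitReader β) → BitReader β

namespace BitReader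

def bind {β γ : Type} : BitReader β → (β → BitReader γ) → BitReader γ
  | done b, f => f b
  | read g, f => read (fun t => (g t).bind f)

instance : Monad BitReader where
  pure := done
  bind := bind

/-- The result of the computation on an infinite tape, with the number of bits that it has read. -/
def run {β : Type} : BitReader β → (ℕ → Bool) → β × ℕ
  | done b, _ => (b, 0)
  | read g, tape =>
    let result := (g (tape 0)).run (fun i => tape (i + 1))
    (result.1, result.2 + 1)

/-- Read a binary word of `w` bits (most significant bit first), to be appended to the binary
number `acc`. -/
def wordFrom (acc : ℕ) : ℕ → BitReader ℕ
  | 0 => done acc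
  | w + 1 => read (fun t => wordFrom (2 * acc + t.toNat) w)

/-- Read a binary word of `w` bits. -/
def word (w : ℕ) : BitReader ℕ := wordFrom 0 w

/-- Perform `f i` for the indices `i` in the list, in this order; the result at other indices is
`default`. -/
def table {β : Type} [Inhabited β] (f : ℕ → BitReader β) : List ℕ → BitReader (ℕ → β)
  | [] => done (fun _ => default)
  | i :: is => do
    let b ← f i
    let g ← table f is
    return Function.update g i b

end BitReader

/-- An online algorithm with advice in the tape model. It may read the tape before the first request
(knowing the servers) and whenever it serves a request. -/
structure AdviceAlgorithm where
  State : Type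
  start : (servers : List ℝ) → BitReader State
  serve : State → (request : ℝ) → BitReader (State × ℕ)

namespace AdviceAlgorithm

def serveAll (D : AdviceAlgorithm) : D.State → List ℝ → BitReader (List ℕ)
  | _, [] => return []
  | st, r :: rs => do
    let x ← D.serve st r
    let js ← D.serveAll x.1 rs
    return x.2 :: js

def play (D : AdviceAlgorithm) (I : Input) : BitReader (List ℕ) := do
  let st ← D.start I.servers
  D.serveAll st I.requests

/-- The answers of the algorithm on an input with a given advice tape. -/
def answers (D : AdviceAlgorithm) (I : Input) (tape : ℕ → Bool) : List ℕ :=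
  ((D.play I).run tape).1

/-- The number of advice bits that the algorithm reads on an input with a given advice tape. -/
def bitsRead (D : AdviceAlgorithm) (I : Input) (tape : ℕ → Bool) : ℕ :=
  ((D.play I).run tape).2

end AdviceAlgorithm

/-- A (randomized) online algorithm with advice is `c(n)`-competitive with additive constant `α` on
a class of inputs when for every input of the class there is an advice tape (chosen independently of
the random choices) with which it always produces a matching, of expected cost at most
`c(n) * opt + α`. -/
def IsCompetitiveWithAdvice {Ω : Type*} [MeasurableSpace Ω] (μ : Measure Ω)
    (D : Ω → AdviceAlgorithm) (inputs : Set Input) (c : ℕ → ℝ) (α : ℝ) : Prop :=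
  ∀ I ∈ inputs, ∃ tape : ℕ → Bool,
    (∀ ω, I.IsMatching ((D ω).answers I tape)) ∧
    Integrable (fun ω => I.cost ((D ω).answers I tape)) μ ∧
    ∫ ω, I.cost ((D ω).answers I tape) ∂μ ≤ c I.size * I.opt + α

/-! ### Algorithm LR -/

structure LRState where
  servers : List ℝ
  used : List ℕ

/-- The indices of the unmatched servers, in increasing order. -/
def LRState.free (st : LRState) : List ℕ :=
  (List.range st.servers.length).filter (fun j => j ∉ st.used)

/-- The server that LR chooses for the request `r`: an unmatched server at `r` if there is one; the
least (greatest) unmatched server if all are greater (less) than `r`; otherwise a bit is read, which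
decides between the greatest unmatched server below `r` (bit 0) and the least one above `r`
(bit 1). The value `0` when no server is unmatched is irrelevant. -/
def LRState.choose (st : LRState) (r : ℝ) : BitReader ℕ :=
  match st.free.find? (fun j => st.servers.getD j 0 = r) with
  | some j => return j
  | none =>
    match st.free.reverse.find? (fun j => st.servers.getD j 0 < r),
        st.free.find? (fun j => r < st.servers.getD j 0) with
    | none, some j => return j
    | some j, none => return j
    | some i, some j => .read (fun t => .done (if t then j else i))
    | none, none => return 0

/-- Algorithm LR; the servers are given in nondecreasing order. -/
def LR : AdviceAlgorithm where
  State := LRState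
  start servers := return ⟨servers, []⟩
  serve st r := do
    let j ← st.choose r
    return (⟨st.servers, j :: st.used⟩, j)

/-! ### Algorithm DIVIDE

Blocks are numbered `1, …, k`; servers are counted from `0`. -/

/-- The number of servers in `S_1 ∪ … ∪ S_i`, so that `S_i` consists of the servers with index in
`[blockEnd n k (i - 1), blockEnd n k i)`: the first `n % k` blocks have `⌈n/k⌉` servers each and the
other ones `⌊n/k⌋`. -/
def blockEnd (n k i : ℕ) : ℕ :=
  min i (n % k) * (n ⌈/⌉ k) + (i - n % k) * (n / k)

/-- The point `p_i = (max S_i + min S_{i+1}) / 2`, for `1 ≤ i ≤ k - 1`. -/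
def cutPoint (servers : List ℝ) (k i : ℕ) : ℝ :=
  (servers.getD (blockEnd servers.length k i - 1) 0 +
    servers.getD (blockEnd servers.length k i) 0) / 2

/-- The index `j` with `r ∈ B_j`, where `B_1 = (-∞, p_1]`, `B_j = (p_{j-1}, p_j]` and
`B_k = (p_{k-1}, ∞)`. As `p_1 ≤ … ≤ p_{k-1}`, it is one more than the number of cut points less
than `r`. -/
def blockOf (servers : List ℝ) (k : ℕ) (r : ℝ) : ℕ :=
  ((Finset.Icc 1 (k - 1)).filter (fun i => cutPoint servers k i < r)).card + 1

/-- The number `N` with `s_n = N - 1`. -/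
def rangeN (servers : List ℝ) : ℕ := ⌊servers.getLastD 0⌋₊ + 1

/-- Number of bits of the binary numbers in `{0, …, m}` for `m ≥ 1`. -/
def width (m : ℕ) : ℕ := Nat.log 2 m + 1

/-- The position of a request, where all positions `≤ 0` are identified with `0` and all positions
`≥ N` with `N` (all servers lie strictly between `0` and `N`). -/
def position (servers : List ℝ) (r : ℝ) : ℝ := max 0 (min r (rangeN servers))

/-- The words that are read from the advice tape. The values `qL j` (`2 ≤ j ≤ k`) and `qR j`
(`1 ≤ j ≤ k - 1`) describe the positions of the rightmost request of `B_j` to be served in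
`S_1 ∪ … ∪ S_{j-1}`, and of the leftmost request of `B_j` to be served in `S_{j+1} ∪ … ∪ S_k`;
`mL j` and `mR j` are the numbers of these requests; `dL j` and `dR j` are numbers of other requests
at `qL j` and `qR j`. -/
structure Words where
  qL : ℕ → ℕ
  qR : ℕ → ℕ
  dR : ℕ → ℕ
  mR : ℕ → ℕ
  dL : ℕ → ℕ
  mL : ℕ → ℕ

/-- The word `qR j` says that some request of block `j` has to be served on the right outside the
block: it is not the all-1 word. -/
def IsExitRight (servers : List ℝ) (k : ℕ) (qR : ℕ → ℕ) (j : ℕ) : Prop :=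
  j < k ∧ qR j ≠ 2 ^ width (rangeN servers) - 1

/-- The word `qL j` says that some request of block `j` has to be served on the left outside the
block: it is not `0`. -/
def IsExitLeft (qL : ℕ → ℕ) (j : ℕ) : Prop := 1 < j ∧ qL j ≠ 0

instance (servers : List ℝ) (k : ℕ) (qR : ℕ → ℕ) (j : ℕ) :
    Decidable (IsExitRight servers k qR j) := by unfold IsExitRight; infer_instance

instance (qL : ℕ → ℕ) (j : ℕ) : Decidable (IsExitLeft qL j) := by
  unfold IsExitLeft; infer_instance

/-- Two words with values in `{0, …, n}`. -/
def readPair (n : ℕ) : BitReader (ℕ × ℕ) := do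
  let d ← BitReader.word (width n)
  let m ← BitReader.word (width n)
  return (d, m)

/-- The reading of the advice: the words `qL 2, …, qL k`, the words `qR 1, …, qR (k-1)`, then
`dR i, mR i` for `i = 1, …, k - 1`, and `dL i, mL i` for `i = k, …, 2` (in the last two cases only
if the block has requests to be served outside on the respective side). -/
def readWords (k : ℕ) (servers : List ℝ) : BitReader Words := do
  let n := servers.length
  let w := width (rangeN servers)
  let qL ← BitReader.table (fun _ => BitReader.word w) (List.range' 2 (k - 1))
  let qR ← BitReader.table (fun _ => BitReader.word w) (List.range' 1 (k - 1))
  let right ← BitReader.table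
    (fun i => if IsExitRight servers k qR i then readPair n else return (0, 0))
    (List.range' 1 (k - 1))
  let left ← BitReader.table
    (fun i => if IsExitLeft qL i then readPair n else return (0, 0))
    (List.range' 2 (k - 1)).reverse
  return {
    qL := qL
    qR := qR
    dR := fun i => (right i).1
    mR := fun i => (right i).2
    dL := fun i => (left i).1
    mL := fun i => (left i).2 }

/-- First marking procedure: for `i = 1, …, k - 1`, mark the server of least index in
`S_{i+1} ∪ … ∪ S_k` that is not marked yet, and the following ones, `mR i` servers in all. -/
def markRight (n k : ℕ) (mR : ℕ → ℕ) : Finset ℕ :=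
  (List.range' 1 (k - 1)).foldl (fun M i =>
    let unmarked := Finset.Ico (blockEnd n k i) n \ M
    if h : unmarked.Nonempty then
      M ∪ Finset.Ico (unmarked.min' h) (unmarked.min' h + mR i)
    else M) ∅

/-- Second marking procedure: for `i = k, …, 2`, mark the server of greatest index in
`S_1 ∪ … ∪ S_{i-1}` that is not marked yet, and the preceding ones, `mL i` servers in all. -/
def markLeft (n k : ℕ) (mL : ℕ → ℕ) : Finset ℕ :=
  (List.range' 2 (k - 1)).reverse.foldl (fun M i =>
    let unmarked := Finset.range (blockEnd n k (i - 1)) \ M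
    if h : unmarked.Nonempty then
      M ∪ Finset.Ico (unmarked.max' h + 1 - mL i) (unmarked.max' h + 1)
    else M) ∅

/-- A request is unmarked, or marked with the bit 0 (`left`) or 1 (`right`) for LR. -/
inductive Label
  | unmarked
  | left
  | right
  deriving DecidableEq

structure DivideState where
  servers : List ℝ
  words : Words
  /-- The requests served so far, in order of arrival. -/
  history : List (ℝ × Label)
  lr : LR.State

namespace DivideState

variable (k : ℕ) (st : DivideState)

/-- The indices of the marked servers, in increasing order. -/
def marked : List ℕ :=
  let n := st.servers.length
  (List.range n).filter
    (fun a => a ∈ markRight n k st.words.mR ∪ markLeft n k st.words.mL)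

/-- The indices of the unmarked servers of `S_j`, in increasing order. -/
def unmarkedIn (j : ℕ) : List ℕ :=
  let n := st.servers.length
  (List.range n).filter
    (fun a => blockEnd n k (j - 1) ≤ a ∧ a < blockEnd n k j ∧ a ∉ st.marked k)

/-- The earlier requests in `B_j` with label `t`, in order of arrival. -/
def pastIn (j : ℕ) (t : Label) : List ℝ :=
  (st.history.filter (fun x => blockOf st.servers k x.1 = j ∧ x.2 = t)).map Prod.fst

/-- The number of earlier requests in `B_j` with label `t` and position `x`. -/
def countAt (j : ℕ) (t : Label) (x : ℝ) : ℕ :=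
  ((st.pastIn k j t).filter (fun y => position st.servers y = x)).length

/-- The label of the current request `r`, in block `j`. -/
def classify (r : ℝ) : Label :=
  let j := blockOf st.servers k r
  let x := position st.servers r
  let exitR := IsExitRight st.servers k st.words.qR j
  let exitL := IsExitLeft st.words.qL j
  let atR := exitR ∧ x = st.words.qR j
  let atL := exitL ∧ x = st.words.qL j
  let u := st.countAt k j .unmarked x
  let v := st.countAt k j .right x
  if atR ∧ u < st.words.dR j then .unmarked
  else if atL ∧ ¬ atR ∧ u < st.words.dL j then .unmarked
  else if exitR ∧ st.words.qR j < x ∧ (st.pastIn k j .right).length < st.words.mR j then .right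
  else if atR ∧ (atL → u + v < st.words.dL j) then .right
  else if exitL ∧ x < st.words.qL j ∧ (st.pastIn k j .left).length < st.words.mL j then .left
  else if atL then .left
  else .unmarked

end DivideState

/-- Algorithm `DIVIDE_k` with the subroutine `A`. An unmarked request in `B_j` is served by `A`, run
on the unmarked servers of `S_j` and the unmarked requests in `B_j`. A marked request is served by
LR, run on the marked servers and the marked requests, with an auxiliary advice tape on which the
only unread bit is the one that belongs to the label of the request (it is deleted if LR does not
read it). -/
def divide (k : ℕ) (A : OnlineAlgorithm) : AdviceAlgorithm where
  State := DivideState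
  start servers := do
    let words ← readWords k servers
    let st : DivideState := ⟨servers, words, [], ⟨[], []⟩⟩
    let markedServers := (st.marked k).map (fun a => servers.getD a 0)
    return { st with lr := ((LR.start markedServers).run (fun _ => false)).1 }
  serve st r :=
    let label := st.classify k r
    let history := st.history ++ [(r, label)]
    if label = .unmarked then
      let j := blockOf st.servers k r
      let own := st.unmarkedIn k j
      let a := A.serve (own.map (fun a => st.servers.getD a 0)) (st.pastIn k j .unmarked) r
      return ({ st with history := history }, own.getD a 0)
    else
      let x := ((LR.serve st.lr r).run (fun _ => decide (label = .right))).1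
      return ({ st with history := history, lr := x.1 }, (st.marked k).getD x.2 0)

/-- The inputs of `DIVIDE_k` for a given `N`: `s_1 = 1`, `s_n = N - 1`, all requests are integers,
and there are at least `k` servers. -/
def IsDivideInput (k N : ℕ) (I : Input) : Prop :=
  0 < N ∧ k ≤ I.size ∧ I.servers.head? = some 1 ∧ I.servers.getLast? = some ((N : ℝ) - 1) ∧
    ∀ r ∈ I.requests, ∃ z : ℤ, r = z

end LineMatching

end

noncomputable section

namespace LineMatching

/-! All servers lie in `[1, N - 1]`. Clipping a request to its position in `[0, N]` therefore
changes its distance to every server by the same amount (`abs_sub_server`) and alters neither its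
block nor the choices of LR. Every cost is thus a fixed deviation plus a cost between positions.
Sort the positions and let `P t` be the one of rank `t`. Matching rank `t` with server `t` is
optimal, by uncrossing (`sum_zipWith_sorted_le`, `monotone_cost_le_opt`).

The advice describes this monotone matching (`rankWords`). Rank `t` is called left, unmarked or
right according to whether server `t` lies before, in or after the block of `P t`. Within one block
the labels occur in the order left, unmarked, right along the ranks. So a position determines its
label except at the two thresholds `qL` and `qR`, where several labels may share one position and
the counts `dL`, `dR` decide. The rules of DIVIDE amount to giving out, at each position, first the
unmarked, then the right, then the left labels of the target (`labels_arith`,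
`GoodRanks.classify_eq`). At the end the labelled positions are those of the monotone matching, up
to order (`GoodRanks.labelsFrom_inOrder`). The marking procedures recover exactly the servers of
left and right ranks (`GoodRanks.markRight_eq`, `GoodRanks.markLeft_eq`).

Requests and servers now split into the same classes: class `0` for the marked ones, class `j` for
the unmarked ones of block `j`. The monotone matching respects this splitting
(`GoodServers.class_perm`). A class `j ≥ 1` has at most `⌈n/k⌉` servers, all in `S_j`. There the
subroutine pays at most `c ⌈n/k⌉` times the share of the class in the optimum, plus `α`.

On class `0`, LR pays no more than the share of the class (`lrAnswers_optimal`). By induction over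
the arrivals, the sorted remaining requests paired in order with the free servers keep the
directions given by the labels. Deleting the current request and the server chosen by LR, and
shifting the pairs in between, preserves this and frees at least the price that LR pays. A left
request may take a server at its own point, so a later right request at that point would spoil the
invariant; hence right labels come before left ones at each position. Since `c ⌈n/k⌉ ≥ 1`
(`IsCompetitive.one_le`), summing over all classes gives the bound with additive constant `k * α`.
-/

/-! ### Sums over lists and uncrossing. -/

/-- Stated for a commutative monoid so that it splits both real costs and, through singletons in
`Multiset ℕ`, the collection of servers used. -/
theorem sum_map_eq_sum_filter {γ M : Type*} [AddCommMonoid M] (cls : γ → ℕ) (f : γ → M) (K : ℕ)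
    (Z : List γ) (hZ : ∀ z ∈ Z, cls z < K) :
    (Z.map f).sum = ∑ c ∈ Finset.range K, ((Z.filter (fun z => cls z = c)).map f).sum := by
  induction Z with
  | nil => simp
  | cons z Z ih =>
    have hz : cls z < K := hZ z (by simp)
    rw [List.map_cons, List.sum_cons, ih (fun y hy => hZ y (by simp [hy]))]
    have : ∀ c ∈ Finset.range K, (((z :: Z).filter (fun z => cls z = c)).map f).sum
        = (if cls z = c then f z else 0) + ((Z.filter (fun z => cls z = c)).map f).sum := by
      intro c _
      by_cases h : cls z = c <;> simp [h]
    rw [Finset.sum_congr rfl this, Finset.sum_add_distrib, Finset.sum_ite_eq]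
    simp [hz]

theorem sum_map_singleton_list {γ : Type*} (Z : List γ) (g : γ → ℕ) :
    (Z.map (fun z => ({g z} : Multiset ℕ))).sum = (Z.map g : Multiset ℕ) := by
  induction Z with
  | nil => simp
  | cons z Z ih => simp [ih]

/-- Pairing two sorted lists in order minimizes the total distance. -/
theorem sum_zipWith_sorted_le (P : List ℝ) : ∀ (F : List ℝ) (Z : List (ℝ × ℝ)),
    P.Pairwise (· ≤ ·) → F.Pairwise (· ≤ ·) → (Z.map Prod.fst).Perm P → (Z.map Prod.snd).Perm F →
    (List.zipWith (fun p s => |p - s|) P F).sum ≤ (Z.map (fun z => |z.1 - z.2|)).sum := by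
  induction P with
  | nil =>
    intro F Z _ _ h1 _
    have : Z = [] := by simpa using h1
    simp [this]
  | cons p P ih =>
    intro F Z hP hF h1 h2
    obtain _ | ⟨f, F⟩ := F
    · have : Z = [] := by simpa using h2
      simp [this] at h1
    rw [List.pairwise_cons] at hP hF
    have hp : p ∈ Z.map Prod.fst := h1.mem_iff.2 (by simp)
    obtain ⟨⟨p', g⟩, hz, rfl⟩ := List.mem_map.1 hp
    obtain ⟨Z1, hZ1⟩ : ∃ Z1, Z.Perm ((p', g) :: Z1) := ⟨_, List.perm_cons_erase hz⟩
    have h1' : (Z1.map Prod.fst).Perm P := by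
      have := (hZ1.map Prod.fst).symm.trans h1
      simpa using this
    have h2' : (g :: Z1.map Prod.snd).Perm (f :: F) := by
      have := (hZ1.map Prod.snd).symm.trans h2
      simpa using this
    rw [(hZ1.map _).sum_eq]
    by_cases hgf : g = f
    · subst hgf
      have h3 := ih F Z1 hP.2 hF.2 h1' ((List.perm_cons g).1 h2')
      simpa using h3
    have hf : f ∈ Z1.map Prod.snd := by
      have : f ∈ g :: Z1.map Prod.snd := h2'.mem_iff.2 (by simp)
      rcases List.mem_cons.1 this with h | h
      · exact absurd h.symm hgf
      · exact h
    obtain ⟨⟨q, f'⟩, hz2, rfl⟩ := List.mem_map.1 hf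
    obtain ⟨Z2, hZ2⟩ : ∃ Z2, Z1.Perm ((q, f') :: Z2) := ⟨_, List.perm_cons_erase hz2⟩
    have hq : q ∈ P := h1'.mem_iff.1 (List.mem_map.2 ⟨_, hz2, rfl⟩)
    have hg : g ∈ F := by
      have : g ∈ f' :: F := h2'.mem_iff.1 (by simp)
      rcases List.mem_cons.1 this with h | h
      · exact absurd h hgf
      · exact h
    -- Uncross: the least point takes the least server, and the former partner `q` of that server
    -- takes `g`. By `hle` this does not increase the cost.
    have h3 := ih F ((q, g) :: Z2) hP.2 hF.2
      (by have := (hZ2.map Prod.fst).symm.trans h1'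
          simpa using this)
      (by have h4 := ((hZ2.map Prod.snd).cons g).symm.trans h2'
          have h5 := (List.Perm.swap _ _ _).trans h4
          simpa using h5)
    rw [List.map_cons, List.sum_cons, (hZ2.map _).sum_eq]
    simp only [List.zipWith_cons_cons, List.map_cons, List.sum_cons] at h3 ⊢
    have hle : |p' - f'| + |q - g| ≤ |p' - g| + |q - f'| := by
      have a := hP.1 q hq
      have b := hF.1 g hg
      simp only at a b
      rcases le_total p' f' with c1 | c1 <;> rcases le_total q g with c2 | c2 <;>
        rcases le_total p' g with c3 | c3 <;> rcases le_total q f' with c4 | c4 <;>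
        simp only [abs_of_nonneg, abs_of_nonpos, sub_nonneg, sub_nonpos, c1, c2, c3, c4] <;>
        linarith
    linarith

/-- A permutation of the image of a list lifts to the list. -/
theorem exists_perm_map_eq {γ δ : Type*} (g : γ → δ) (A : List δ) (B : List γ)
    (h : A.Perm (B.map g)) : ∃ A' : List γ, A'.Perm B ∧ A'.map g = A := by
  have h2 : List.Forall₂ (fun x z => x = g z) (B.map g) B := by
    rw [List.forall₂_map_left_iff]
    exact List.forall₂_same.2 (fun _ _ => rfl)
  obtain ⟨A', hA, hp⟩ := List.perm_comp_forall₂ h h2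
  refine ⟨A', hp, ?_⟩
  clear hp h h2
  induction hA with
  | nil => rfl
  | cons h _ ih => simp [h, ih]

/-! ### Optimality of LR with correct advice -/

/-- The bit `true` is the label of a request to be served at its place or on its right. -/
def Directed (sv : ℕ → ℝ) (q : ℝ × Bool) (a : ℕ) : Prop := q.2 = true ↔ q.1 ≤ sv a

def pairCost (sv : ℕ → ℝ) (P : List (ℝ × Bool)) (F : List ℕ) : ℝ :=
  (List.zipWith (fun q a => |q.1 - sv a|) P F).sum

@[simp] theorem pairCost_cons (sv : ℕ → ℝ) (q : ℝ × Bool) (P : List (ℝ × Bool)) (a : ℕ)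
    (F : List ℕ) : pairCost sv (q :: P) (a :: F) = |q.1 - sv a| + pairCost sv P F := by
  simp [pairCost]

theorem exists_mem_of_forall₂ {γ δ : Type*} {R : γ → δ → Prop} {P : List γ} {F : List δ}
    (h : List.Forall₂ R P F) {q : γ} (hq : q ∈ P) : ∃ a ∈ F, R q a := by
  induction h with
  | nil => simp at hq
  | cons h _ ih =>
    rcases List.mem_cons.1 hq with rfl | hq
    · exact ⟨_, by simp, h⟩
    · obtain ⟨a, ha, hr⟩ := ih hq
      exact ⟨a, by simp [ha], hr⟩

/-- All of `B` and `q` lie to the left of `f` and the servers after it. When `q` takes `f`, every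
request of `B` moves on to the next server; the distances telescope and every partner stays on the
right. -/
theorem shift_right (sv : ℕ → ℝ) (q : ℝ × Bool) (P₂ : List (ℝ × Bool)) :
    ∀ (B : List (ℝ × Bool)) (f : ℕ) (F : List ℕ),
    List.Forall₂ (Directed sv) (B ++ q :: P₂) (f :: F) →
    (f :: F).Pairwise (fun a a' => sv a ≤ sv a') → (∀ b ∈ B, b.1 ≤ q.1) → q.1 ≤ sv f →
    List.Forall₂ (Directed sv) (B ++ P₂) F ∧
      pairCost sv (B ++ P₂) F + |q.1 - sv f| ≤ pairCost sv (B ++ q :: P₂) (f :: F) := by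
  intro B
  induction B with
  | nil =>
    intro f F h _ _ _
    rw [List.nil_append, List.forall₂_cons] at h
    refine ⟨h.2, ?_⟩
    simp [add_comm]
  | cons b B ih =>
    intro f F h hF hB hq
    rw [List.cons_append, List.forall₂_cons] at h
    obtain _ | ⟨g, F⟩ := F
    · have := h.2.length_eq
      simp at this
    rw [List.pairwise_cons] at hF
    have hfg := hF.1 g (by simp)
    have hb := hB b (by simp)
    obtain ⟨h1, h2⟩ := ih g F h.2 hF.2 (fun x hx => hB x (by simp [hx])) (hq.trans hfg)
    refine ⟨?_, ?_⟩
    · rw [List.cons_append, List.forall₂_cons]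
      refine ⟨?_, h1⟩
      have := h.1
      unfold Directed at this ⊢
      exact ⟨fun _ => by linarith, fun _ => this.2 (by linarith)⟩
    · simp only [List.cons_append, pairCost_cons]
      rw [abs_of_nonpos (by linarith : q.1 - sv g ≤ 0)] at h2
      rw [abs_of_nonpos (by linarith : q.1 - sv f ≤ 0), abs_of_nonpos (by linarith : b.1 - sv g ≤ 0),
        abs_of_nonpos (by linarith : b.1 - sv f ≤ 0)]
      linarith

/-- The partner of `q` is at or to the right of `q`, hence not in `G₁`. So the servers of `G₁` are
all paired with requests of `P₁`; after this common prefix, `shift_right` applies. -/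
theorem directed_step_right (sv : ℕ → ℝ) (q : ℝ × Bool) (hq : q.2 = true) (P₂ : List (ℝ × Bool))
    (u : ℕ) (G₂ : List ℕ) (hu : q.1 ≤ sv u) : ∀ (P₁ : List (ℝ × Bool)) (G₁ : List ℕ),
    List.Forall₂ (Directed sv) (P₁ ++ q :: P₂) (G₁ ++ u :: G₂) →
    (G₁ ++ u :: G₂).Pairwise (fun a a' => sv a ≤ sv a') → (∀ b ∈ P₁, b.1 ≤ q.1) →
    (∀ a ∈ G₁, sv a < q.1) →
    List.Forall₂ (Directed sv) (P₁ ++ P₂) (G₁ ++ G₂) ∧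
      pairCost sv (P₁ ++ P₂) (G₁ ++ G₂) + |q.1 - sv u|
        ≤ pairCost sv (P₁ ++ q :: P₂) (G₁ ++ u :: G₂) := by
  intro P₁ G₁
  induction G₁ generalizing P₁ with
  | nil =>
    intro h hF hP _
    exact shift_right sv q P₂ P₁ u G₂ h hF hP hu
  | cons g G ih =>
    intro h hF hP hG
    obtain _ | ⟨p, P₁⟩ := P₁
    · rw [List.nil_append, List.cons_append, List.forall₂_cons] at h
      have h1 := h.1.1 hq
      have h2 := hG g (by simp)
      linarith
    · rw [List.cons_append, List.cons_append, List.forall₂_cons] at h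
      rw [List.cons_append, List.pairwise_cons] at hF
      obtain ⟨h1, h2⟩ := ih P₁ h.2 hF.2 (fun x hx => hP x (by simp [hx]))
        (fun x hx => hG x (by simp [hx]))
      simp only [List.cons_append, pairCost_cons, List.forall₂_cons]
      exact ⟨⟨h.1, h1⟩, by linarith⟩

/-- Here `u` is given to the first request, and the requests that used the servers between its old
partner and `u` each move one server back. Not quite a mirror image of `shift_right`: a server at
the request itself counts as lying to the right, so requests at `r` need the separate hypothesis
that they are labelled left. -/
theorem shift_left (sv : ℕ → ℝ) (r : ℝ) (u : ℕ) (G₂ : List ℕ) (hur : sv u ≤ r) :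
    ∀ (B : List ℕ) (q : ℝ × Bool) (P : List (ℝ × Bool)),
    List.Forall₂ (Directed sv) (q :: P) (B ++ u :: G₂) →
    (B ++ u :: G₂).Pairwise (fun a a' => sv a ≤ sv a') → (∀ b ∈ q :: P, r ≤ b.1) →
    (∀ b ∈ P, b.1 = r → b.2 = false) →
    List.Forall₂ (Directed sv) P (B ++ G₂) ∧
      pairCost sv P (B ++ G₂) + |q.1 - sv u| ≤ pairCost sv (q :: P) (B ++ u :: G₂) := by
  intro B
  induction B with
  | nil =>
    intro q P h _ _ _
    rw [List.nil_append, List.forall₂_cons] at h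
    exact ⟨h.2, by simp [add_comm]⟩
  | cons f B ih =>
    intro q P h hF hP ho
    rw [List.cons_append, List.forall₂_cons] at h
    obtain _ | ⟨p, P⟩ := P
    · have := h.2.length_eq
      simp at this
    rw [List.cons_append, List.pairwise_cons] at hF
    obtain ⟨h1, h2⟩ := ih p P h.2 hF.2 (fun x hx => hP x (List.mem_cons_of_mem _ hx))
      (fun x hx => ho x (List.mem_cons_of_mem _ hx))
    have hfu : sv f ≤ sv u := hF.1 u (by simp)
    have hp := hP p (by simp)
    have hq := hP q (by simp)
    simp only [List.cons_append, pairCost_cons, List.forall₂_cons]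
    refine ⟨⟨?_, h1⟩, ?_⟩
    · -- `p` was served at a place at most `sv u`
      have hg : ∃ g, Directed sv p g ∧ sv g ≤ sv u ∧ sv f ≤ sv g := by
        obtain _ | ⟨g, B⟩ := B
        · exact ⟨u, (List.forall₂_cons.1 h.2).1, le_rfl, hfu⟩
        · refine ⟨g, (List.forall₂_cons.1 h.2).1, ?_, hF.1 g (by simp)⟩
          have := hF.2
          rw [List.cons_append, List.pairwise_cons] at this
          exact this.1 u (by simp)
      obtain ⟨g, hg, hgu, hfg⟩ := hg
      -- A right label would squeeze `p.1 ≤ sv g ≤ sv u ≤ r ≤ p.1`, and requests of `P` at `r` are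
      -- labelled left.
      have hpf : p.2 = false := by
        by_contra hc
        have hc : p.2 = true := by simpa using hc
        have := hg.1 hc
        have := ho p (by simp) (by linarith)
        simp_all
      have hlt : ¬ p.1 ≤ sv g := fun hc => by
        have := hg.2 hc
        simp_all
      unfold Directed
      simp only [hpf, Bool.false_eq_true, false_iff, not_le]
      linarith [not_le.1 hlt]
    · rw [abs_of_nonneg (by linarith : 0 ≤ p.1 - sv u)] at h2
      rw [abs_of_nonneg (by linarith : 0 ≤ q.1 - sv f), abs_of_nonneg (by linarith : 0 ≤ q.1 - sv u),
        abs_of_nonneg (by linarith : 0 ≤ p.1 - sv f)]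
      linarith

/-- The partner of `q` is strictly to the left of `q`, hence not in `G₂`. So `G₁` cannot run out
before `P₁`, and after the common prefix `shift_left` applies. -/
theorem directed_step_left (sv : ℕ → ℝ) (q : ℝ × Bool) (hq : q.2 = false) (P₂ : List (ℝ × Bool))
    (u : ℕ) (G₂ : List ℕ) (hu : sv u ≤ q.1) (hP₂ : ∀ b ∈ P₂, q.1 ≤ b.1)
    (ho : ∀ b ∈ P₂, b.1 = q.1 → b.2 = false) (hG₂ : ∀ a ∈ G₂, q.1 ≤ sv a) :
    ∀ (P₁ : List (ℝ × Bool)) (G₁ : List ℕ),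
    List.Forall₂ (Directed sv) (P₁ ++ q :: P₂) (G₁ ++ u :: G₂) →
    (G₁ ++ u :: G₂).Pairwise (fun a a' => sv a ≤ sv a') →
    List.Forall₂ (Directed sv) (P₁ ++ P₂) (G₁ ++ G₂) ∧
      pairCost sv (P₁ ++ P₂) (G₁ ++ G₂) + |q.1 - sv u|
        ≤ pairCost sv (P₁ ++ q :: P₂) (G₁ ++ u :: G₂) := by
  intro P₁
  induction P₁ with
  | nil =>
    intro G₁ h hF
    exact shift_left sv q.1 u G₂ hu G₁ q P₂ h hF (by simpa using hP₂) ho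
  | cons p P₁ ih =>
    intro G₁ h hF
    obtain _ | ⟨g, G₁⟩ := G₁
    · exfalso
      rw [List.nil_append, List.cons_append, List.forall₂_cons] at h
      obtain ⟨a, ha, h4⟩ := exists_mem_of_forall₂ h.2 (show q ∈ P₁ ++ q :: P₂ by simp)
      have := h4.2 (hG₂ a ha)
      simp_all
    · rw [List.cons_append, List.cons_append, List.forall₂_cons] at h
      rw [List.cons_append, List.pairwise_cons] at hF
      obtain ⟨h1, h2⟩ := ih G₁ h.2 hF.2
      simp only [List.cons_append, pairCost_cons, List.forall₂_cons]
      exact ⟨⟨h.1, h1⟩, by linarith⟩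

namespace LRState

/-- The server chosen by LR when the next advice bit is `bit`. -/
def pick (st : LRState) (r : ℝ) (bit : Bool) : ℕ := ((st.choose r).run (fun _ => bit)).1

theorem pick_eq (st : LRState) (r : ℝ) (bit : Bool) : st.pick r bit =
    match st.free.find? (fun j => st.servers.getD j 0 = r) with
    | some j => j
    | none =>
      match st.free.reverse.find? (fun j => st.servers.getD j 0 < r),
          st.free.find? (fun j => r < st.servers.getD j 0) with
      | none, some j => j
      | some j, none => j
      | some i, some j => if bit then j else i
      | none, none => 0 := by
  unfold pick choose
  generalize st.free.find? (fun j => st.servers.getD j 0 = r) = x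
  generalize st.free.reverse.find? (fun j => st.servers.getD j 0 < r) = y
  generalize st.free.find? (fun j => r < st.servers.getD j 0) = z
  cases x <;> cases y <;> cases z <;> rfl

/-- As long as a free server at or to the right of `r` exists, each branch of LR ends at the first
such server: a server at `r` precedes the others, and otherwise a move to the left is ruled out by
the bit. -/
theorem pick_right (st : LRState) (r : ℝ)
    (hs : st.free.Pairwise (fun a a' => st.servers.getD a 0 ≤ st.servers.getD a' 0))
    (h : ∃ a ∈ st.free, r ≤ st.servers.getD a 0) :
    ∃ G₁ G₂, st.free = G₁ ++ st.pick r true :: G₂ ∧ (∀ a ∈ G₁, st.servers.getD a 0 < r) ∧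
      r ≤ st.servers.getD (st.pick r true) 0 := by
  rw [pick_eq]
  split
  · rename_i j hj
    rw [List.find?_eq_some_iff_append] at hj
    obtain ⟨h1, G₁, G₂, h2, h3⟩ := hj
    have h1 : st.servers.getD j 0 = r := by simpa using h1
    refine ⟨G₁, G₂, h2, ?_, h1.ge⟩
    intro a ha
    have h4 := h3 a ha
    rw [h2, List.pairwise_append] at hs
    have := hs.2.2 a ha j (by simp)
    simp only [Bool.not_eq_true', decide_eq_false_iff_not] at h4
    exact lt_of_le_of_ne (this.trans h1.le) h4
  · rename_i hn
    rw [List.find?_eq_none] at hn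
    have hn' : ∀ a ∈ st.free, st.servers.getD a 0 ≠ r := fun a ha => by simpa using hn a ha
    obtain ⟨a, ha, har⟩ := h
    have har' := lt_of_le_of_ne har (hn' a ha).symm
    have key : ∀ j, st.free.find? (fun j => r < st.servers.getD j 0) = some j →
        ∃ G₁ G₂, st.free = G₁ ++ j :: G₂ ∧ (∀ a ∈ G₁, st.servers.getD a 0 < r) ∧
        r ≤ st.servers.getD j 0 := by
      intro j hj
      rw [List.find?_eq_some_iff_append] at hj
      obtain ⟨h1, G₁, G₂, h2, h3⟩ := hj
      refine ⟨G₁, G₂, h2, ?_, le_of_lt (by simpa using h1)⟩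
      intro a ha
      have h4 := h3 a ha
      simp only [Bool.not_eq_true', decide_eq_false_iff_not, not_lt] at h4
      exact lt_of_le_of_ne h4 (hn' a (by rw [h2]; simp [ha]))
    split
    · exact key _ (by assumption)
    · rename_i h5
      rw [List.find?_eq_none] at h5
      exact absurd har' (by simpa using h5 a ha)
    · exact key _ (by assumption)
    · rename_i h5
      rw [List.find?_eq_none] at h5
      exact absurd har' (by simpa using h5 a ha)

/-- Bit 0 does not enforce a strict move to the left, because a free server at `r` has priority.
Hence the weak inequality for the chosen server. -/
theorem pick_left (st : LRState) (r : ℝ)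
    (hs : st.free.Pairwise (fun a a' => st.servers.getD a 0 ≤ st.servers.getD a' 0))
    (h : ∃ a ∈ st.free, st.servers.getD a 0 < r) :
    ∃ G₁ G₂, st.free = G₁ ++ st.pick r false :: G₂ ∧ (∀ a ∈ G₂, r ≤ st.servers.getD a 0) ∧
      st.servers.getD (st.pick r false) 0 ≤ r := by
  rw [pick_eq]
  split
  · rename_i j hj
    rw [List.find?_eq_some_iff_append] at hj
    obtain ⟨h1, G₁, G₂, h2, h3⟩ := hj
    have h1 : st.servers.getD j 0 = r := by simpa using h1
    refine ⟨G₁, G₂, h2, ?_, h1.le⟩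
    intro a ha
    rw [h2, List.pairwise_append, List.pairwise_cons] at hs
    exact h1.ge.trans (hs.2.1.1 a ha)
  · obtain ⟨a, ha, har⟩ := h
    have key : ∀ j, st.free.reverse.find? (fun j => st.servers.getD j 0 < r) = some j →
        ∃ G₁ G₂, st.free = G₁ ++ j :: G₂ ∧ (∀ a ∈ G₂, r ≤ st.servers.getD a 0) ∧
        st.servers.getD j 0 ≤ r := by
      intro j hj
      rw [List.find?_eq_some_iff_append] at hj
      obtain ⟨h1, G₁, G₂, h2, h3⟩ := hj
      refine ⟨G₂.reverse, G₁.reverse, ?_, ?_, le_of_lt (by simpa using h1)⟩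
      · have := congrArg List.reverse h2
        simpa using this
      intro a ha
      have h4 := h3 a (by simpa using ha)
      simpa using h4
    split
    · rename_i h5 _
      rw [List.find?_eq_none] at h5
      exact absurd har (by simpa using h5 a (by simpa using ha))
    · exact key _ (by assumption)
    · exact key _ (by assumption)
    · rename_i h5 _
      rw [List.find?_eq_none] at h5
      exact absurd har (by simpa using h5 a (by simpa using ha))

/-- The choice of LR does not change when a request is replaced by its projection to an interval
that contains all servers in its interior. -/
theorem pick_congr (st : LRState) (r r' : ℝ) (bit : Bool)
    (h : ∀ a ∈ st.free, (st.servers.getD a 0 = r ↔ st.servers.getD a 0 = r') ∧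
      (st.servers.getD a 0 < r ↔ st.servers.getD a 0 < r')) :
    st.pick r bit = st.pick r' bit := by
  have h1 : st.free.find? (fun j => st.servers.getD j 0 = r)
      = st.free.find? (fun j => st.servers.getD j 0 = r') := by
    apply List.find?_congr
    intro a ha
    simp only [(h a ha).1]
  have h2 : st.free.reverse.find? (fun j => st.servers.getD j 0 < r)
      = st.free.reverse.find? (fun j => st.servers.getD j 0 < r') := by
    apply List.find?_congr
    intro a ha
    simp only [(h a (by simpa using ha)).2]
  have h3 : st.free.find? (fun j => r < st.servers.getD j 0)
      = st.free.find? (fun j => r' < st.servers.getD j 0) := by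
    apply List.find?_congr
    intro a ha
    have := h a ha
    have e : r < st.servers.getD a 0 ↔ r' < st.servers.getD a 0 := by
      rw [← not_le, ← not_le, le_iff_lt_or_eq, le_iff_lt_or_eq, this.1, this.2]
    simp only [e]
  rw [pick_eq, pick_eq, h1, h2, h3]

theorem free_cons (st : LRState) (j : ℕ) :
    free ⟨st.servers, j :: st.used⟩ = st.free.erase j := by
  have hn : st.free.Nodup := List.nodup_range.filter _
  rw [hn.erase_eq_filter]
  unfold free
  rw [List.filter_filter]
  apply List.filter_congr
  intro a _
  by_cases h : a = j <;> simp [h]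

end LRState

/-- The answers of LR when each request comes with the bit that is next on the tape. -/
def lrAnswers (servers : List ℝ) : List ℕ → List (ℝ × Bool) → List ℕ
  | _, [] => []
  | used, q :: qs =>
    let j := LRState.pick ⟨servers, used⟩ q.1 q.2
    j :: lrAnswers servers (j :: used) qs

/-- Induction over the arrivals `Q`; `P` is the sorted version of what remains, paired in order with
the free servers. The one-step lemmas remove a request and the server that LR gives it while keeping
the pairing directed. The condition on equal points of `Q` is the tie hypothesis of
`directed_step_left`. -/
theorem lrAnswers_optimal (servers : List ℝ) (hsort : servers.Pairwise (· ≤ ·))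
    (Q : List (ℝ × Bool)) : ∀ (used : List ℕ) (P : List (ℝ × Bool)), P.Perm Q →
    P.Pairwise (fun p p' => p.1 ≤ p'.1) →
    Q.Pairwise (fun q q' => q.2 = false → q'.1 = q.1 → q'.2 = false) →
    List.Forall₂ (Directed (fun a => servers.getD a 0)) P (LRState.free ⟨servers, used⟩) →
    (lrAnswers servers used Q).Perm (LRState.free ⟨servers, used⟩) ∧
    pairCost (fun a => servers.getD a 0) Q (lrAnswers servers used Q)
      ≤ pairCost (fun a => servers.getD a 0) P (LRState.free ⟨servers, used⟩) := by
  induction Q with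
  | nil =>
    intro used P hP _ _ h
    have : P = [] := by simpa using hP
    subst this
    rw [List.forall₂_nil_left_iff] at h
    rw [h]
    simp [lrAnswers]
  | cons q Q ih =>
    intro used P hP hsP hQ h
    set sv := fun a => servers.getD a 0 with hsv
    set F := LRState.free ⟨servers, used⟩ with hF
    have hFs : F.Pairwise (fun a a' => sv a ≤ sv a') := by
      have h1 : F.Pairwise (· < ·) := List.pairwise_lt_range.filter _
      have h2 : ∀ a ∈ F, a < servers.length := by
        intro a ha
        have := List.mem_of_mem_filter ha
        simpa using this
      refine h1.imp_of_mem ?_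
      intro a b ha hb hab
      simp only [hsv, List.getD_eq_getElem _ _ (h2 a ha), List.getD_eq_getElem _ _ (h2 b hb)]
      exact List.pairwise_iff_getElem.1 hsort a b _ _ hab
    have hq : q ∈ P := hP.mem_iff.2 (by simp)
    obtain ⟨P₁, P₂, rfl⟩ := List.append_of_mem hq
    have hPQ : (P₁ ++ P₂).Perm Q := by
      have := List.perm_middle.symm.trans hP
      exact (List.perm_cons q).1 this
    rw [List.pairwise_cons] at hQ
    have ho : ∀ b ∈ P₁ ++ P₂, q.2 = false → b.1 = q.1 → b.2 = false :=
      fun b hb => hQ.1 b (hPQ.mem_iff.1 hb)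
    rw [List.pairwise_append, List.pairwise_cons] at hsP
    obtain ⟨a, ha, hqa⟩ := exists_mem_of_forall₂ h hq
    have step : ∃ G₁ G₂, F = G₁ ++ LRState.pick ⟨servers, used⟩ q.1 q.2 :: G₂ ∧
        List.Forall₂ (Directed sv) (P₁ ++ P₂) (G₁ ++ G₂) ∧
        pairCost sv (P₁ ++ P₂) (G₁ ++ G₂) + |q.1 - sv (LRState.pick ⟨servers, used⟩ q.1 q.2)|
          ≤ pairCost sv (P₁ ++ q :: P₂) F := by
      rcases hb : q.2 with _ | _
      · have h1 : sv a < q.1 := by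
          by_contra hc
          have := hqa.2 (not_lt.1 hc)
          simp_all
        obtain ⟨G₁, G₂, h2, h3, h4⟩ := LRState.pick_left ⟨servers, used⟩ q.1 hFs ⟨a, ha, h1⟩
        refine ⟨G₁, G₂, h2, ?_⟩
        have h2' : F = _ := h2
        rw [h2'] at h hFs ⊢
        exact directed_step_left sv q hb P₂ _ G₂ h4 (fun b hb => hsP.2.1.1 b hb)
          (fun b hb' => ho b (by simp [hb']) hb) h3 P₁ G₁ h hFs
      · obtain ⟨G₁, G₂, h2, h3, h4⟩ :=
          LRState.pick_right ⟨servers, used⟩ q.1 hFs ⟨a, ha, hqa.1 hb⟩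
        refine ⟨G₁, G₂, h2, ?_⟩
        have h2' : F = _ := h2
        rw [h2'] at h hFs ⊢
        exact directed_step_right sv q hb P₂ _ G₂ h4 P₁ G₁ h hFs
          (fun b hb => hsP.2.2 b hb q (by simp)) h3
    obtain ⟨G₁, G₂, hG, h1, h2⟩ := step
    set j := LRState.pick ⟨servers, used⟩ q.1 q.2 with hj
    have hfree : LRState.free ⟨servers, j :: used⟩ = G₁ ++ G₂ := by
      have e := LRState.free_cons ⟨servers, used⟩ j
      have hn : F.Nodup := List.nodup_range.filter _
      rw [e, ← hF, hG]
      rw [hG, List.nodup_middle, List.nodup_cons] at hn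
      rw [List.erase_append_right _ (fun hc => hn.1 (by simp [hc]))]
      simp
    have := ih (j :: used) (P₁ ++ P₂) hPQ
      (by rw [List.pairwise_append]
          exact ⟨hsP.1, hsP.2.1.2, fun x hx y hy => hsP.2.2 x hx y (by simp [hy])⟩)
      hQ.2 (by rw [hfree]; exact h1)
    rw [hfree] at this
    refine ⟨?_, ?_⟩
    · rw [lrAnswers, hG]
      exact (this.1.cons j).trans List.perm_middle.symm
    · rw [lrAnswers]
      simp only [pairCost_cons]
      rw [← hj]
      linarith [this.2]

/-! ### Tapes: how many bits are read, and which words can be written. -/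

namespace BitReader

theorem run_bind {β γ : Type} (m : BitReader β) (f : β → BitReader γ) : ∀ tape : ℕ → Bool,
    (m.bind f).run tape =
      (((f (m.run tape).1).run (fun i => tape (i + (m.run tape).2))).1,
        (m.run tape).2 + ((f (m.run tape).1).run (fun i => tape (i + (m.run tape).2))).2) := by
  induction m with
  | done b => intro tape; simp [bind, run]
  | read g ih =>
    intro tape
    simp only [bind, run]
    rw [ih]
    simp only [Prod.mk.injEq]
    refine ⟨?_, ?_⟩
    · congr 2
    · rw [add_right_comm]
      congr 2

/-- At most `B` bits are read, whatever the tape. -/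
def BitsLE {β : Type} (m : BitReader β) (B : ℕ) : Prop := ∀ tape, (m.run tape).2 ≤ B

theorem BitsLE.pure {β : Type} (b : β) : BitsLE (Pure.pure b : BitReader β) 0 := fun _ => le_rfl

theorem BitsLE.mono {β : Type} {m : BitReader β} {B B' : ℕ} (h : m.BitsLE B) (hB : B ≤ B') :
    m.BitsLE B' := fun tape => (h tape).trans hB

theorem BitsLE.bind {β γ : Type} {m : BitReader β} {f : β → BitReader γ} {B B' : ℕ}
    (h : m.BitsLE B) (h' : ∀ b, (f b).BitsLE B') : BitsLE (m >>= f) (B + B') := by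
  intro tape
  change ((m.bind f).run tape).2 ≤ _
  rw [run_bind]
  exact add_le_add (h tape) (h' _ _)

theorem BitsLE.wordFrom (w : ℕ) : ∀ acc, (BitReader.wordFrom acc w).BitsLE w := by
  induction w with
  | zero => intro acc tape; simp [BitReader.wordFrom, run]
  | succ w ih =>
    intro acc tape
    simp only [BitReader.wordFrom, run]
    exact Nat.succ_le_succ (ih _ _)

theorem BitsLE.table {β : Type} [Inhabited β] {f : ℕ → BitReader β} {B : ℕ}
    (h : ∀ i, (f i).BitsLE B) : ∀ l : List ℕ, (BitReader.table f l).BitsLE (l.length * B)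
  | [] => fun _ => by simp [BitReader.table, run]
  | i :: l => by
    have := (h i).bind (fun b => (BitsLE.table h l).bind
      (fun g => BitsLE.pure (Function.update g i b)))
    refine this.mono ?_
    rw [List.length_cons]
    linarith

/-- Some tape makes the computation return `b`. -/
def Produces {β : Type} (m : BitReader β) (b : β) : Prop :=
  ∃ l : List Bool, ∀ tape : ℕ → Bool, (∀ i < l.length, tape i = l.getD i false) →
    m.run tape = (b, l.length)

theorem Produces.pure {β : Type} (b : β) : Produces (Pure.pure b : BitReader β) b :=
  ⟨[], fun _ _ => rfl⟩

theorem Produces.bind {β γ : Type} {m : BitReader β} {f : β → BitReader γ} {b : β} {c : γ}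
    (h : m.Produces b) (h' : (f b).Produces c) : Produces (m >>= f) c := by
  obtain ⟨l, hl⟩ := h
  obtain ⟨l', hl'⟩ := h'
  refine ⟨l ++ l', fun tape ht => ?_⟩
  change (m.bind f).run tape = _
  have h1 := hl tape (fun i hi => by
    rw [ht i (by rw [List.length_append]; omega), List.getD_append _ _ _ _ hi])
  have h2 := hl' (fun i => tape (i + l.length)) (fun i hi => by
    rw [ht _ (by rw [List.length_append]; omega),
      List.getD_append_right _ _ _ _ (by omega), Nat.add_sub_cancel])
  rw [run_bind, h1]
  simp only [h2, List.length_append]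

theorem Produces.wordFrom (w : ℕ) : ∀ acc v, v < 2 ^ w →
    (BitReader.wordFrom acc w).Produces (acc * 2 ^ w + v) := by
  induction w with
  | zero =>
    intro acc v hv
    have : v = 0 := by simpa using hv
    subst this
    rw [pow_zero, mul_one, add_zero]
    exact Produces.pure acc
  | succ w ih =>
    intro acc v hv
    rw [pow_succ] at hv
    obtain ⟨t, v', hv', e⟩ : ∃ (t : Bool) (v' : ℕ), v' < 2 ^ w ∧ v = t.toNat * 2 ^ w + v' := by
      by_cases h : v < 2 ^ w
      · exact ⟨false, v, h, by simp⟩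
      · exact ⟨true, v - 2 ^ w, by omega, by simp; omega⟩
    obtain ⟨l, hl⟩ := ih (2 * acc + t.toNat) v' hv'
    refine ⟨t :: l, fun tape ht => ?_⟩
    have h0 : tape 0 = t := by simpa using ht 0 (by simp)
    have h1 := hl (fun i => tape (i + 1)) (fun i hi => by
      simpa using ht (i + 1) (by simpa using hi))
    simp only [BitReader.wordFrom, run, h0, h1, List.length_cons, Prod.mk.injEq, and_true]
    rw [e, pow_succ]
    ring

theorem Produces.word {w v : ℕ} (hv : v < 2 ^ w) : (BitReader.word w).Produces v := by
  have := Produces.wordFrom w 0 v hv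
  rwa [zero_mul, zero_add] at this

theorem Produces.table {β : Type} [Inhabited β] {f : ℕ → BitReader β} {g : ℕ → β} :
    ∀ l : List ℕ, (∀ i ∈ l, (f i).Produces (g i)) →
      (BitReader.table f l).Produces (fun i => if i ∈ l then g i else default)
  | [], _ => Produces.pure (fun _ : ℕ => (default : β))
  | i :: l, h => by
    have := (h i (by simp)).bind (f := fun b => BitReader.table f l >>= fun g' =>
      (Pure.pure (Function.update g' i b) : BitReader (ℕ → β)))
      ((Produces.table l (fun j hj => h j (by simp [hj]))).bind (Produces.pure _))
    have e : Function.update (fun i => if i ∈ l then g i else default) i (g i) =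
        (fun j => if j ∈ i :: l then g j else default) := by
      funext j
      by_cases hj : j = i
      · subst hj; simp
      · simp [hj]
    rw [e] at this
    exact this

end BitReader

/-- Two position words for each of `k - 1` indices, and on each side at most `k - 1` pairs of count
words. -/
theorem readWords_bitsLE (k : ℕ) (servers : List ℝ) :
    (readWords k servers).BitsLE
      (2 * (k - 1) * width (rangeN servers) + 4 * (k - 1) * width servers.length) := by
  have hp : (readPair servers.length).BitsLE (2 * width servers.length) := by
    have := (BitReader.BitsLE.wordFrom (width servers.length) 0).bind (fun d =>
      (BitReader.BitsLE.wordFrom (width servers.length) 0).bind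
      (fun m => BitReader.BitsLE.pure (d, m)))
    exact this.mono (by omega)
  have hc : ∀ p : Prop, ∀ [Decidable p], BitReader.BitsLE
      (if p then readPair servers.length else return (0, 0)) (2 * width servers.length) := by
    intro p _
    split
    · exact hp
    · exact (BitReader.BitsLE.pure _).mono (Nat.zero_le _)
  have := (BitReader.BitsLE.table (fun _ => BitReader.BitsLE.wordFrom (width (rangeN servers)) 0)
      (List.range' 2 (k - 1))).bind (fun qL =>
    (BitReader.BitsLE.table (fun _ => BitReader.BitsLE.wordFrom (width (rangeN servers)) 0)
      (List.range' 1 (k - 1))).bind (fun qR =>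
    (BitReader.BitsLE.table (fun i => hc (IsExitRight servers k qR i))
      (List.range' 1 (k - 1))).bind (fun right =>
    (BitReader.BitsLE.table (fun i => hc (IsExitLeft qL i))
      (List.range' 2 (k - 1)).reverse).bind (fun left =>
    BitReader.BitsLE.pure (⟨qL, qR, fun i => (right i).1, fun i => (right i).2,
      fun i => (left i).1, fun i => (left i).2⟩ : Words)))))
  refine BitReader.BitsLE.mono this ?_
  simp only [List.length_range', List.length_reverse]
  apply le_of_eq
  ring

/-- All sensible words can be written on the tape. -/
theorem readWords_produces (k : ℕ) (servers : List ℝ) (W : Words)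
    (hqL : ∀ j, W.qL j < 2 ^ width (rangeN servers))
    (hqR : ∀ j, W.qR j < 2 ^ width (rangeN servers))
    (hdR : ∀ j, W.dR j < 2 ^ width servers.length) (hmR : ∀ j, W.mR j < 2 ^ width servers.length)
    (hdL : ∀ j, W.dL j < 2 ^ width servers.length) (hmL : ∀ j, W.mL j < 2 ^ width servers.length)
    (hL : ∀ j, ¬ IsExitLeft W.qL j → W.dL j = 0 ∧ W.mL j = 0)
    (hR : ∀ j, ¬ IsExitRight servers k W.qR j → W.dR j = 0 ∧ W.mR j = 0) :
    ∃ W' : Words, (readWords k servers).Produces W' ∧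
      (∀ j ∈ Finset.Icc 2 k, W'.qL j = W.qL j ∧ W'.dL j = W.dL j ∧ W'.mL j = W.mL j) ∧
      (∀ j ∈ Finset.Icc 1 (k - 1), W'.qR j = W.qR j ∧ W'.dR j = W.dR j ∧ W'.mR j = W.mR j) := by
  have hp : ∀ d m, d < 2 ^ width servers.length → m < 2 ^ width servers.length →
      (readPair servers.length).Produces (d, m) := fun d m hd hm =>
    (BitReader.Produces.word hd).bind (f := fun d => BitReader.word (width servers.length) >>=
      fun m => (pure (d, m) : BitReader (ℕ × ℕ)))
      ((BitReader.Produces.word hm).bind (BitReader.Produces.pure _))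
  set qL : ℕ → ℕ := fun i => if i ∈ List.range' 2 (k - 1) then W.qL i else default with e1
  set qR : ℕ → ℕ := fun i => if i ∈ List.range' 1 (k - 1) then W.qR i else default with e2
  set right : ℕ → ℕ × ℕ :=
    fun i => if i ∈ List.range' 1 (k - 1) then (W.dR i, W.mR i) else default with e3
  set left : ℕ → ℕ × ℕ :=
    fun i => if i ∈ (List.range' 2 (k - 1)).reverse then (W.dL i, W.mL i) else default with e4
  have h1 : (BitReader.table (fun _ => BitReader.word (width (rangeN servers)))
      (List.range' 2 (k - 1))).Produces qL :=
    BitReader.Produces.table (g := W.qL) _ (fun i _ => BitReader.Produces.word (hqL i))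
  have h2 : (BitReader.table (fun _ => BitReader.word (width (rangeN servers)))
      (List.range' 1 (k - 1))).Produces qR :=
    BitReader.Produces.table (g := W.qR) _ (fun i _ => BitReader.Produces.word (hqR i))
  have h3 : (BitReader.table
      (fun i => if IsExitRight servers k qR i then readPair servers.length else return (0, 0))
      (List.range' 1 (k - 1))).Produces right := by
    refine BitReader.Produces.table (g := fun i => (W.dR i, W.mR i)) _ (fun i hi => ?_)
    have hq : qR i = W.qR i := by simp only [e2, hi, if_true]
    split
    · exact hp _ _ (hdR i) (hmR i)
    · rename_i hx
      -- No pair is on the tape for a block that does not exit; the reader then returns zeros, which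
      -- is what `W` must contain.
      have := hR i (by unfold IsExitRight at hx ⊢; rwa [hq] at hx)
      rw [this.1, this.2]
      exact BitReader.Produces.pure _
  have h4 : (BitReader.table
      (fun i => if IsExitLeft qL i then readPair servers.length else return (0, 0))
      (List.range' 2 (k - 1)).reverse).Produces left := by
    refine BitReader.Produces.table (g := fun i => (W.dL i, W.mL i)) _ (fun i hi => ?_)
    have hq : qL i = W.qL i := by
      rw [List.mem_reverse] at hi
      simp only [e1, hi, if_true]
    split
    · exact hp _ _ (hdL i) (hmL i)
    · rename_i hx
      have := hL i (by unfold IsExitLeft at hx ⊢; rwa [hq] at hx)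
      rw [this.1, this.2]
      exact BitReader.Produces.pure _
  refine ⟨⟨qL, qR, fun i => (right i).1, fun i => (right i).2, fun i => (left i).1,
    fun i => (left i).2⟩, ?_, ?_, ?_⟩
  · unfold readWords
    exact h1.bind (h2.bind (h3.bind (h4.bind (BitReader.Produces.pure _))))
  · intro j hj
    have : j ∈ List.range' 2 (k - 1) := by
      rw [Finset.mem_Icc] at hj
      rw [List.mem_range'_1]
      omega
    have h' := List.mem_reverse.2 this
    simp only [e1, e4, this, h', if_true, and_self]
  · intro j hj
    have : j ∈ List.range' 1 (k - 1) := by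
      rw [Finset.mem_Icc] at hj
      rw [List.mem_range'_1]
      omega
    simp only [e2, e3, this, if_true, and_self]

/-! ### Blocks -/

theorem ceilDiv_eq (n k : ℕ) (hk : 0 < k) :
    n ⌈/⌉ k = n / k + if n % k = 0 then 0 else 1 := by
  rw [Nat.ceilDiv_eq_add_pred_div]
  have h := Nat.div_add_mod n k
  have hm := Nat.mod_lt n hk
  rw [Nat.div_eq_iff hk]
  split_ifs with h0
  · rw [h0] at h
    rw [add_zero, mul_comm]
    omega
  · rw [add_mul, one_mul, mul_comm]
    omega

theorem blockEnd_zero (n k : ℕ) : blockEnd n k 0 = 0 := by simp [blockEnd]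

theorem blockEnd_succ (n k i : ℕ) : blockEnd n k (i + 1) =
    blockEnd n k i + if i < n % k then n ⌈/⌉ k else n / k := by
  unfold blockEnd
  split_ifs with h
  · rw [min_eq_left h, min_eq_left h.le, Nat.sub_eq_zero_of_le h, Nat.sub_eq_zero_of_le h.le]
    ring
  · rw [min_eq_right (by omega), min_eq_right (by omega),
      show i + 1 - n % k = (i - n % k) + 1 by omega]
    ring

theorem blockEnd_self (n k : ℕ) (hk : 0 < k) : blockEnd n k k = n := by
  unfold blockEnd
  have h := Nat.div_add_mod n k
  have hm := Nat.mod_lt n hk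
  rw [min_eq_right hm.le, ceilDiv_eq n k hk]
  split_ifs with h0
  · rw [h0] at h ⊢
    simpa using h
  · rw [mul_add, mul_one, add_right_comm, ← add_mul, Nat.add_sub_cancel' hm.le]
    exact h

theorem blockEnd_mono (n k : ℕ) : Monotone (blockEnd n k) :=
  monotone_nat_of_le_succ (fun i => by rw [blockEnd_succ]; omega)

theorem blockEnd_lt_succ (n k i : ℕ) (hk : 0 < k) (hn : k ≤ n) :
    blockEnd n k i < blockEnd n k (i + 1) := by
  have h : 1 ≤ n / k := (Nat.one_le_div_iff hk).2 hn
  rw [blockEnd_succ, ceilDiv_eq n k hk]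
  split_ifs <;> omega

theorem blockEnd_strictMono (n k : ℕ) (hk : 0 < k) (hn : k ≤ n) : StrictMono (blockEnd n k) :=
  strictMono_nat_of_lt_succ (fun i => blockEnd_lt_succ n k i hk hn)

theorem blockEnd_sub_le (n k i : ℕ) (hk : 0 < k) :
    blockEnd n k i - blockEnd n k (i - 1) ≤ n ⌈/⌉ k := by
  obtain _ | i := i
  · simp
  · rw [Nat.add_sub_cancel, blockEnd_succ, ceilDiv_eq n k hk]
    generalize n / k = m
    split_ifs <;> omega

/-- The standing facts on the servers of an input of `DIVIDE_k`. -/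
structure GoodServers (servers : List ℝ) (k : ℕ) : Prop where
  sorted : servers.Pairwise (· ≤ ·)
  k_pos : 0 < k
  k_le : k ≤ servers.length
  one_le : ∀ a < servers.length, 1 ≤ servers.getD a 0
  le_N : ∀ a < servers.length, servers.getD a 0 ≤ (rangeN servers : ℝ) - 1

section

variable {servers : List ℝ} {k : ℕ} (hs : GoodServers servers k)

include hs

theorem GoodServers.getD_mono {a b : ℕ} (hab : a ≤ b) (hb : b < servers.length) :
    servers.getD a 0 ≤ servers.getD b 0 := by
  rw [List.getD_eq_getElem _ _ (hab.trans_lt hb), List.getD_eq_getElem _ _ hb]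
  rcases hab.eq_or_lt with h | h
  · subst h; exact le_rfl
  · exact List.pairwise_iff_getElem.1 hs.sorted a b _ _ h

theorem GoodServers.blockEnd_lt {i : ℕ} (h : i < k) :
    blockEnd servers.length k i < servers.length := by
  have := blockEnd_strictMono servers.length k hs.k_pos hs.k_le h
  rwa [blockEnd_self _ _ hs.k_pos] at this

theorem GoodServers.blockEnd_pos {i : ℕ} (h : 0 < i) : 0 < blockEnd servers.length k i := by
  have := blockEnd_strictMono servers.length k hs.k_pos hs.k_le h
  rwa [blockEnd_zero] at this

theorem GoodServers.le_cutPoint {i a : ℕ} (hik : i < k)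
    (ha : a < blockEnd servers.length k i) : servers.getD a 0 ≤ cutPoint servers k i := by
  have h1 := hs.getD_mono (show a ≤ blockEnd servers.length k i - 1 by omega)
    (by have := hs.blockEnd_lt hik; omega)
  have h2 := hs.getD_mono (show a ≤ blockEnd servers.length k i by omega) (hs.blockEnd_lt hik)
  unfold cutPoint
  linarith

theorem GoodServers.cutPoint_le {i a : ℕ}
    (ha : blockEnd servers.length k i ≤ a) (han : a < servers.length) :
    cutPoint servers k i ≤ servers.getD a 0 := by
  have h1 := hs.getD_mono (show blockEnd servers.length k i - 1 ≤ a by omega) han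
  have h2 := hs.getD_mono ha han
  unfold cutPoint
  linarith

theorem GoodServers.cutPoint_mono {i j : ℕ} (hij : i ≤ j) (hj : j < k) :
    cutPoint servers k i ≤ cutPoint servers k j := by
  rcases hij.eq_or_lt with rfl | h
  · exact le_rfl
  have h1 := blockEnd_strictMono servers.length k hs.k_pos hs.k_le h
  have h2 := hs.blockEnd_lt hj
  exact (hs.cutPoint_le (show _ ≤ blockEnd servers.length k i from le_rfl) (by omega)).trans
    (hs.le_cutPoint hj h1)

/-- The cut points are nondecreasing, so those below `r` form an initial segment and their number
determines which they are. -/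
theorem GoodServers.cutPoint_lt_iff {r : ℝ} {i : ℕ} (hi : 0 < i) (hik : i < k) :
    cutPoint servers k i < r ↔ i < blockOf servers k r := by
  unfold blockOf
  set S := (Finset.Icc 1 (k - 1)).filter (fun i => cutPoint servers k i < r) with hS
  constructor
  · intro h
    have : Finset.Icc 1 i ⊆ S := by
      intro x hx
      rw [Finset.mem_Icc] at hx
      rw [hS, Finset.mem_filter, Finset.mem_Icc]
      exact ⟨⟨hx.1, by omega⟩, (hs.cutPoint_mono hx.2 hik).trans_lt h⟩
    have := Finset.card_le_card this
    rw [Nat.card_Icc] at this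
    omega
  · intro h
    by_contra hc
    have : S ⊆ Finset.Icc 1 (i - 1) := by
      intro x hx
      rw [hS, Finset.mem_filter, Finset.mem_Icc] at hx
      rw [Finset.mem_Icc]
      refine ⟨hx.1.1, ?_⟩
      by_contra hxi
      exact hc ((hs.cutPoint_mono (by omega : i ≤ x) (by omega)).trans_lt hx.2)
    have := Finset.card_le_card this
    rw [Nat.card_Icc] at this
    omega

/-- Together with the weak inequality of `le_server_of_blockOf`, this turns the side on which a
request leaves its block into the relation `Directed`. Blocks open on the left and closed on the
right give precisely its tie rule. -/
theorem GoodServers.server_lt_of_blockOf {r : ℝ} {a : ℕ}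
    (ha : a < blockEnd servers.length k (blockOf servers k r - 1))
    (hb : blockOf servers k r ≤ k) : servers.getD a 0 < r := by
  have h1 : 0 < blockOf servers k r - 1 := by
    rcases Nat.eq_zero_or_pos (blockOf servers k r - 1) with h | h
    · rw [h, blockEnd_zero] at ha; omega
    · exact h
  exact (hs.le_cutPoint (by omega) ha).trans_lt
    ((hs.cutPoint_lt_iff h1 (by omega)).2 (by omega))

theorem GoodServers.le_server_of_blockOf {r : ℝ} {a : ℕ}
    (ha : blockEnd servers.length k (blockOf servers k r) ≤ a) (han : a < servers.length)
    (hb : blockOf servers k r ≤ k) (hp : 0 < blockOf servers k r) : r ≤ servers.getD a 0 := by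
  have h1 : blockOf servers k r < k := by
    rcases hb.eq_or_lt with h | h
    · rw [h, blockEnd_self _ _ hs.k_pos] at ha; omega
    · exact h
  refine le_trans ?_ (hs.cutPoint_le ha han)
  by_contra hc
  exact absurd ((hs.cutPoint_lt_iff hp h1).1 (not_le.1 hc)) (lt_irrefl _)

end

theorem blockOf_pos (servers : List ℝ) (k : ℕ) (r : ℝ) : 0 < blockOf servers k r := by
  unfold blockOf; omega

theorem blockOf_le (servers : List ℝ) (k : ℕ) (r : ℝ) (hk : 0 < k) : blockOf servers k r ≤ k := by
  unfold blockOf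
  have := Finset.card_filter_le (Finset.Icc 1 (k - 1)) (fun i => cutPoint servers k i < r)
  rw [Nat.card_Icc] at this
  omega

theorem blockOf_mono (servers : List ℝ) (k : ℕ) : Monotone (blockOf servers k) := by
  intro r r' h
  unfold blockOf
  refine Nat.succ_le_succ (Finset.card_le_card ?_)
  intro i hi
  rw [Finset.mem_filter] at hi ⊢
  exact ⟨hi.1, hi.2.trans_le h⟩

theorem GoodServers.one_le_cutPoint {servers : List ℝ} {k : ℕ} (hs : GoodServers servers k) {i : ℕ}
    (hi : 0 < i) (hik : i < k) : 1 ≤ cutPoint servers k i :=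
  (hs.one_le 0 (by have := hs.k_le; have := hs.k_pos; omega)).trans
    (hs.le_cutPoint hik (hs.blockEnd_pos hi))

theorem GoodServers.cutPoint_le_N {servers : List ℝ} {k : ℕ} (hs : GoodServers servers k) {i : ℕ}
    (hik : i < k) : cutPoint servers k i ≤ (rangeN servers : ℝ) - 1 :=
  (hs.cutPoint_le le_rfl (hs.blockEnd_lt hik)).trans (hs.le_N _ (hs.blockEnd_lt hik))

/-! ### Clipping requests to their positions. -/

/-- Every cut point lies between two servers, hence in `[1, N - 1]`, and clipping to `[0, N]`
crosses none of them. -/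
theorem blockOf_position {servers : List ℝ} {k : ℕ} (hs : GoodServers servers k) (r : ℝ) :
    blockOf servers k (position servers r) = blockOf servers k r := by
  unfold blockOf
  congr 2
  apply Finset.filter_congr
  intro i hi
  rw [Finset.mem_Icc] at hi
  have h1 := hs.one_le_cutPoint (i := i) (by omega) (by omega)
  have h2 := hs.cutPoint_le_N (i := i) (by omega)
  unfold position
  simp only [lt_max_iff, lt_min_iff]
  constructor
  · rintro (h | h)
    · linarith
    · exact h.1
  · exact fun h => Or.inr ⟨h, by linarith⟩

/-- The clipped point lies between the request and any server. So the first summand is unavoidable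
and independent of the matching. -/
theorem abs_sub_server {servers : List ℝ} {k : ℕ} (hs : GoodServers servers k) (r : ℝ) {a : ℕ}
    (ha : a < servers.length) : |r - servers.getD a 0| =
      |r - position servers r| + |position servers r - servers.getD a 0| := by
  have h1 := hs.one_le a ha
  have h2 := hs.le_N a ha
  unfold position
  generalize servers.getD a 0 = s at *
  generalize (rangeN servers : ℝ) = N at *
  rcases le_total r 0 with h | h
  · rw [min_eq_left (by linarith), max_eq_left h, abs_of_nonpos (by linarith),
      abs_of_nonpos (by linarith), abs_of_nonpos (by linarith)]
    ring
  · rcases le_total r N with h' | h'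
    · rw [min_eq_left h', max_eq_right h]
      simp
    · rw [min_eq_right h', max_eq_right (by linarith), abs_of_nonneg (by linarith),
        abs_of_nonneg (by linarith), abs_of_nonneg (by linarith)]
      ring

theorem server_eq_position_iff {servers : List ℝ} {k : ℕ} (hs : GoodServers servers k) (r : ℝ)
    {a : ℕ} (ha : a < servers.length) :
    (servers.getD a 0 = r ↔ servers.getD a 0 = position servers r) ∧
      (servers.getD a 0 < r ↔ servers.getD a 0 < position servers r) := by
  have h1 := hs.one_le a ha
  have h2 := hs.le_N a ha
  unfold position
  generalize servers.getD a 0 = s at *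
  generalize (rangeN servers : ℝ) = N at *
  rcases le_total r 0 with h | h
  · rw [min_eq_left (by linarith), max_eq_left h]
    refine ⟨⟨fun _ => ?_, fun _ => ?_⟩, ⟨fun _ => ?_, fun _ => ?_⟩⟩ <;> linarith
  · rcases le_total r N with h' | h'
    · rw [min_eq_left h', max_eq_right h]
      simp
    · rw [min_eq_right h', max_eq_right (by linarith)]
      refine ⟨⟨fun _ => ?_, fun _ => ?_⟩, ⟨fun _ => ?_, fun _ => ?_⟩⟩ <;> linarith

/-- The position of a request as a natural number. -/
def positionNat (servers : List ℝ) (r : ℝ) : ℕ := ⌊position servers r⌋₊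

theorem position_eq_cast (servers : List ℝ) {r : ℝ} (hr : ∃ z : ℤ, r = z) :
    position servers r = positionNat servers r := by
  obtain ⟨z, rfl⟩ := hr
  have : ∃ m : ℕ, position servers (z : ℝ) = m := by
    refine ⟨(max 0 (min z (rangeN servers : ℤ))).toNat, ?_⟩
    unfold position
    have h : ((max 0 (min z (rangeN servers : ℤ))).toNat : ℤ) = max 0 (min z (rangeN servers : ℤ)) :=
      Int.toNat_of_nonneg (le_max_left _ _)
    have h' : (((max 0 (min z (rangeN servers : ℤ))).toNat : ℤ) : ℝ)
        = ((max 0 (min z (rangeN servers : ℤ)) : ℤ) : ℝ) := by rw [h]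
    rw [Int.cast_natCast] at h'
    rw [h']
    push_cast
    rfl
  obtain ⟨m, hm⟩ := this
  unfold positionNat
  rw [hm, Nat.floor_natCast]

theorem positionNat_le (servers : List ℝ) (r : ℝ) : positionNat servers r ≤ rangeN servers := by
  unfold positionNat
  have : position servers r ≤ rangeN servers := by
    unfold position
    exact max_le (Nat.cast_nonneg _) (min_le_right _ _)
  exact Nat.floor_le_of_le this

/-- The block of a position. -/
def blockNat (servers : List ℝ) (k p : ℕ) : ℕ := blockOf servers k (p : ℝ)

theorem blockNat_mono (servers : List ℝ) (k : ℕ) : Monotone (blockNat servers k) :=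
  fun _ _ h => blockOf_mono servers k (Nat.cast_le.2 h)

theorem blockNat_positionNat {servers : List ℝ} {k : ℕ} (hs : GoodServers servers k) {r : ℝ}
    (hr : ∃ z : ℤ, r = z) : blockNat servers k (positionNat servers r) = blockOf servers k r := by
  unfold blockNat
  rw [← position_eq_cast servers hr, blockOf_position hs]

/-- Position `0` belongs to block `1`, which never exits left; this leaves the word `0` free to mean
that there is no exit. -/
theorem blockNat_zero {servers : List ℝ} {k : ℕ} (hs : GoodServers servers k) :
    blockNat servers k 0 = 1 := by
  have h1 := blockOf_pos servers k ((0 : ℕ) : ℝ)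
  have h2 := blockOf_le servers k ((0 : ℕ) : ℝ) hs.k_pos
  unfold blockNat
  by_contra hc
  have h3 := (hs.cutPoint_lt_iff (r := ((0 : ℕ) : ℝ)) (i := 1) (by omega) (by omega)).2 (by omega)
  have := hs.one_le_cutPoint (i := 1) (by omega) (by omega)
  push_cast at h3
  linarith

/-- Positions from `N` on belong to block `k`, which never exits right. The all-1 word is at least
`N`, so it is free to mean that there is no exit. -/
theorem blockNat_rangeN {servers : List ℝ} {k : ℕ} (hs : GoodServers servers k) {p : ℕ}
    (hp : rangeN servers ≤ p) : blockNat servers k p = k := by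
  have h1 := blockOf_pos servers k (p : ℝ)
  have h2 := blockOf_le servers k (p : ℝ) hs.k_pos
  unfold blockNat
  by_contra hc
  have hk : 0 < k - 1 := by omega
  have h3 := hs.cutPoint_le_N (i := k - 1) (by omega)
  have hp' : (rangeN servers : ℝ) ≤ p := Nat.cast_le.2 hp
  have h4 := (hs.cutPoint_lt_iff (r := (p : ℝ)) (i := k - 1) hk (by omega)).1 (by linarith)
  omega

theorem IsDivideInput.goodServers {k N : ℕ} {I : Input} (h : IsDivideInput k N I) (hk : 0 < k) :
    GoodServers I.servers k ∧ rangeN I.servers = N := by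
  obtain ⟨hN, hkn, hhead, hlast, -⟩ := h
  have hsort : I.servers.Pairwise (· ≤ ·) := I.sorted.pairwise
  have hne : I.servers ≠ [] := by
    intro hc
    simp [hc] at hhead
  have hlast' : I.servers.getLastD 0 = (N : ℝ) - 1 := by
    rw [List.getLastD_eq_getLast?, hlast]
    rfl
  have hNr : rangeN I.servers = N := by
    unfold rangeN
    rw [hlast']
    have : ((N : ℝ) - 1) = ((N - 1 : ℕ) : ℝ) := by
      rw [Nat.cast_sub (by omega), Nat.cast_one]
    rw [this, Nat.floor_natCast]
    omega
  have hmono : ∀ a b, a ≤ b → b < I.servers.length → I.servers.getD a 0 ≤ I.servers.getD b 0 := by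
    intro a b hab hb
    rw [List.getD_eq_getElem _ _ (hab.trans_lt hb), List.getD_eq_getElem _ _ hb]
    rcases hab.eq_or_lt with h | h
    · subst h; exact le_rfl
    · exact List.pairwise_iff_getElem.1 hsort a b _ _ h
  have hlen : 0 < I.servers.length := List.length_pos_iff.2 hne
  refine ⟨⟨hsort, hk, hkn, ?_, ?_⟩, hNr⟩
  · intro a ha
    have h1 := hmono 0 a (Nat.zero_le _) ha
    have : I.servers.getD 0 0 = 1 := by
      rw [List.head?_eq_getElem?] at hhead
      rw [List.getD_eq_getElem?_getD, hhead]
      rfl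
    linarith
  · intro a ha
    have h1 := hmono a (I.servers.length - 1) (by omega) (by omega)
    have : I.servers.getD (I.servers.length - 1) 0 = (N : ℝ) - 1 := by
      rw [List.getLast?_eq_getElem?] at hlast
      rw [List.getD_eq_getElem?_getD, hlast]
      rfl
    rw [hNr]
    linarith

/-! ### The monotone matching: the request of rank `t` is served by the server `t` -/

section Ranks

variable (servers : List ℝ) (k : ℕ) (P : ℕ → ℕ)

/-- The block of the request of rank `t`, where `P t` is the position of this request. -/
def rankBlock (t : ℕ) : ℕ := blockNat servers k (P t)

def leftRanks (j : ℕ) : Finset ℕ :=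
  (Finset.range servers.length).filter
    (fun t => rankBlock servers k P t = j ∧ t < blockEnd servers.length k (j - 1))

def rightRanks (j : ℕ) : Finset ℕ :=
  (Finset.range servers.length).filter
    (fun t => rankBlock servers k P t = j ∧ blockEnd servers.length k j ≤ t)

/-- Whether the request of rank `t` is served outside of its block, and on which side. -/
def rankLabel (t : ℕ) : Label :=
  if t < blockEnd servers.length k (rankBlock servers k P t - 1) then .left
  else if blockEnd servers.length k (rankBlock servers k P t) ≤ t then .right
  else .unmarked

/-- The positions and labels of the requests, in the order of their ranks. -/
def rankList : List (ℕ × Label) :=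
  (List.range servers.length).map (fun t => (P t, rankLabel servers k P t))

/-- The advice that describes the monotone matching. -/
def rankWords : Words where
  qL j := (leftRanks servers k P j).sup P
  qR j := if h : (rightRanks servers k P j).Nonempty then
      ((rightRanks servers k P j).image P).min' (h.image P)
    else 2 ^ width (rangeN servers) - 1
  dR j := if h : (rightRanks servers k P j).Nonempty then
      (rankList servers k P).count
        (((rightRanks servers k P j).image P).min' (h.image P), .unmarked)
    else 0
  mR j := (rightRanks servers k P j).card
  dL j := if (leftRanks servers k P j).Nonempty then
      (rankList servers k P).count ((leftRanks servers k P j).sup P, .unmarked) +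
        (rankList servers k P).count ((leftRanks servers k P j).sup P, .right)
    else 0
  mL j := (leftRanks servers k P j).card

end Ranks

structure GoodRanks (servers : List ℝ) (k : ℕ) (P : ℕ → ℕ) : Prop extends
    GoodServers servers k where
  mono : ∀ t t', t ≤ t' → t' < servers.length → P t ≤ P t'

section

variable {servers : List ℝ} {k : ℕ} {P : ℕ → ℕ}

theorem rankBlock_pos (t : ℕ) : 0 < rankBlock servers k P t := blockOf_pos _ _ _

theorem count_rankList_pos {p : ℕ} {l : Label} : 0 < (rankList servers k P).count (p, l) ↔
    ∃ t < servers.length, P t = p ∧ rankLabel servers k P t = l := by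
  rw [List.count_pos_iff]
  unfold rankList
  simp [Prod.ext_iff]

theorem rankLabel_eq_left_iff {t : ℕ} : rankLabel servers k P t = .left ↔
    t < blockEnd servers.length k (rankBlock servers k P t - 1) := by
  unfold rankLabel
  split_ifs <;> simp_all

theorem rankLabel_eq_right_iff {t : ℕ} : rankLabel servers k P t = .right ↔
    blockEnd servers.length k (rankBlock servers k P t) ≤ t := by
  unfold rankLabel
  have := blockEnd_mono servers.length k
    (Nat.sub_le (rankBlock servers k P t) 1)
  split_ifs
  · simp; omega
  · simp_all
  · simp_all

theorem mem_leftRanks {t j : ℕ} : t ∈ leftRanks servers k P j ↔ t < servers.length ∧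
    rankBlock servers k P t = j ∧ rankLabel servers k P t = .left := by
  unfold leftRanks
  rw [Finset.mem_filter, Finset.mem_range, rankLabel_eq_left_iff]
  constructor
  · rintro ⟨h1, h2, h3⟩
    exact ⟨h1, h2, by rwa [h2]⟩
  · rintro ⟨h1, h2, h3⟩
    exact ⟨h1, h2, by rwa [h2] at h3⟩

theorem mem_rightRanks {t j : ℕ} : t ∈ rightRanks servers k P j ↔ t < servers.length ∧
    rankBlock servers k P t = j ∧ rankLabel servers k P t = .right := by
  unfold rightRanks
  rw [Finset.mem_filter, Finset.mem_range, rankLabel_eq_right_iff]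
  constructor
  · rintro ⟨h1, h2, h3⟩
    exact ⟨h1, h2, by rwa [h2]⟩
  · rintro ⟨h1, h2, h3⟩
    exact ⟨h1, h2, by rwa [h2] at h3⟩

theorem card_leftRanks (j : ℕ) : (leftRanks servers k P j).card =
    (rankList servers k P).countP (fun x => blockNat servers k x.1 = j ∧ x.2 = .left) := by
  unfold rankList
  rw [List.countP_map]
  have : leftRanks servers k P j = (Finset.range servers.length).filter
      (fun t => rankBlock servers k P t = j ∧ rankLabel servers k P t = .left) := by
    ext t
    rw [mem_leftRanks, Finset.mem_filter, Finset.mem_range]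
  rw [this, Finset.card_def, Finset.filter_val, Finset.range_val, Multiset.range,
    ← Multiset.countP_eq_card_filter, Multiset.coe_countP]
  rfl

theorem card_rightRanks (j : ℕ) : (rightRanks servers k P j).card =
    (rankList servers k P).countP (fun x => blockNat servers k x.1 = j ∧ x.2 = .right) := by
  unfold rankList
  rw [List.countP_map]
  have : rightRanks servers k P j = (Finset.range servers.length).filter
      (fun t => rankBlock servers k P t = j ∧ rankLabel servers k P t = .right) := by
    ext t
    rw [mem_rightRanks, Finset.mem_filter, Finset.mem_range]
  rw [this, Finset.card_def, Finset.filter_val, Finset.range_val, Multiset.range,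
    ← Multiset.countP_eq_card_filter, Multiset.coe_countP]
  rfl

variable (hP : GoodRanks servers k P)
include hP

theorem GoodRanks.rankBlock_mono {t t' : ℕ} (h : t ≤ t') (ht : t' < servers.length) :
    rankBlock servers k P t ≤ rankBlock servers k P t' :=
  blockNat_mono servers k (hP.mono t t' h ht)

theorem GoodRanks.rankBlock_le (t : ℕ) : rankBlock servers k P t ≤ k :=
  blockOf_le _ _ _ hP.k_pos

/-- The supremum of the empty set is the code `0`. A left rank exists only in blocks `j ≥ 2`, whose
positions are nonzero by `blockNat_zero`. -/
theorem GoodRanks.isExitLeft_iff {j : ℕ} :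
    IsExitLeft (rankWords servers k P).qL j ↔ (leftRanks servers k P j).Nonempty := by
  unfold IsExitLeft
  simp only [rankWords]
  constructor
  · rintro ⟨-, h⟩
    by_contra hc
    rw [Finset.not_nonempty_iff_eq_empty] at hc
    simp [hc] at h
  · rintro ⟨t, ht⟩
    have h1 := mem_leftRanks.1 ht
    have hj : 1 < j := by
      have h2 := rankLabel_eq_left_iff.1 h1.2.2
      rw [h1.2.1] at h2
      by_contra hc
      rw [show j - 1 = 0 by omega, blockEnd_zero] at h2
      omega
    refine ⟨hj, ?_⟩
    have h3 : P t ≤ (leftRanks servers k P j).sup P := Finset.le_sup ht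
    intro hc
    have h4 : P t = 0 := by omega
    have h5 := h1.2.1
    unfold rankBlock at h5
    rw [h4, blockNat_zero hP.toGoodServers] at h5
    omega

/-- A right rank exists only in blocks `j < k`, where positions are less than `N` and so differ from
the all-1 word. -/
theorem GoodRanks.isExitRight_iff {j : ℕ} :
    IsExitRight servers k (rankWords servers k P).qR j ↔ (rightRanks servers k P j).Nonempty := by
  unfold IsExitRight
  simp only [rankWords]
  constructor
  · rintro ⟨-, h⟩
    by_contra hc
    simp [hc] at h
  · intro h
    have key : ∀ t ∈ rightRanks servers k P j, j < k ∧ P t < rangeN servers := by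
      intro t ht
      have h1 := mem_rightRanks.1 ht
      have h2 := rankLabel_eq_right_iff.1 h1.2.2
      have hj : j < k := by
        have h3 := hP.rankBlock_le t
        rw [h1.2.1] at h2 h3
        rcases h3.eq_or_lt with h4 | h4
        · rw [h4, blockEnd_self _ _ hP.k_pos] at h2
          omega
        · exact h4
      refine ⟨hj, ?_⟩
      by_contra hc
      have h5 := h1.2.1
      unfold rankBlock at h5
      rw [blockNat_rangeN hP.toGoodServers (not_lt.1 hc)] at h5
      omega
    obtain ⟨t, ht⟩ := h
    refine ⟨(key t ht).1, ?_⟩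
    rw [dif_pos ⟨t, ht⟩]
    have h6 := Finset.min'_mem _ (Finset.Nonempty.image ⟨t, ht⟩ P)
    obtain ⟨t', ht', h7⟩ := Finset.mem_image.1 h6
    rw [← h7]
    have h8 := (key t' ht').2
    have h9 : rangeN servers < 2 ^ width (rangeN servers) :=
      Nat.lt_pow_succ_log_self (by norm_num) _
    omega

/-- In a block that exits left the labels are `left` below the position `qL`. -/
theorem GoodRanks.left_facts (p j : ℕ) (hj : blockNat servers k p = j) :
    (0 < (rankList servers k P).count (p, .left) →
      (leftRanks servers k P j).Nonempty ∧ p ≤ (rankWords servers k P).qL j) ∧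
    ((leftRanks servers k P j).Nonempty → p = (rankWords servers k P).qL j →
      0 < (rankList servers k P).count (p, .left) ∧
      (rankWords servers k P).dL j = (rankList servers k P).count (p, .unmarked) +
        (rankList servers k P).count (p, .right)) ∧
    ((leftRanks servers k P j).Nonempty → p < (rankWords servers k P).qL j →
      (rankList servers k P).count (p, .unmarked) = 0 ∧
        (rankList servers k P).count (p, .right) = 0) := by
  simp only [rankWords]
  refine ⟨?_, ?_, ?_⟩
  · rw [count_rankList_pos]
    rintro ⟨t, ht, rfl, hl⟩
    have : t ∈ leftRanks servers k P j := mem_leftRanks.2 ⟨ht, hj, hl⟩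
    exact ⟨⟨t, this⟩, Finset.le_sup this⟩
  · intro hne hp
    rw [if_pos hne, ← hp]
    refine ⟨?_, rfl⟩
    obtain ⟨t, ht, h⟩ := Finset.exists_mem_eq_sup _ hne P
    rw [count_rankList_pos]
    have := mem_leftRanks.1 ht
    exact ⟨t, this.1, by rw [hp, h], this.2.2⟩
  · intro hne hp
    obtain ⟨t, ht, h⟩ := Finset.exists_mem_eq_sup _ hne P
    rw [h] at hp
    have h1 := mem_leftRanks.1 ht
    have key : ∀ l, 0 < (rankList servers k P).count (p, l) → l = .left := by
      intro l hl
      obtain ⟨t', ht', rfl, rfl⟩ := count_rankList_pos.1 hl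
      have h2 : t' < t := by
        by_contra hc
        have := hP.mono t t' (not_lt.1 hc) ht'
        omega
      rw [rankLabel_eq_left_iff]
      have h3 := rankLabel_eq_left_iff.1 h1.2.2
      have h4 : rankBlock servers k P t' = rankBlock servers k P t := by
        rw [h1.2.1]; exact hj
      rw [h4]
      omega
    constructor <;> by_contra hc
    · exact absurd (key _ (Nat.pos_of_ne_zero hc)) (by simp)
    · exact absurd (key _ (Nat.pos_of_ne_zero hc)) (by simp)

/-- Ranks of one block are compared with the same threshold `blockEnd`, so every rank of the block
after a right one is right as well. A larger position forces a larger rank. -/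
theorem GoodRanks.right_facts (p j : ℕ) (hj : blockNat servers k p = j) :
    (0 < (rankList servers k P).count (p, .right) →
      (rightRanks servers k P j).Nonempty ∧ (rankWords servers k P).qR j ≤ p) ∧
    ((rightRanks servers k P j).Nonempty → p = (rankWords servers k P).qR j →
      0 < (rankList servers k P).count (p, .right) ∧
      (rankWords servers k P).dR j = (rankList servers k P).count (p, .unmarked)) ∧
    ((rightRanks servers k P j).Nonempty → (rankWords servers k P).qR j < p →
      (rankList servers k P).count (p, .unmarked) = 0 ∧
        (rankList servers k P).count (p, .left) = 0) := by
  simp only [rankWords]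
  refine ⟨?_, ?_, ?_⟩
  · rw [count_rankList_pos]
    rintro ⟨t, ht, rfl, hl⟩
    have : t ∈ rightRanks servers k P j := mem_rightRanks.2 ⟨ht, hj, hl⟩
    refine ⟨⟨t, this⟩, ?_⟩
    rw [dif_pos ⟨t, this⟩]
    exact Finset.min'_le _ _ (Finset.mem_image_of_mem P this)
  · intro hne hp
    rw [dif_pos hne] at hp
    rw [dif_pos hne, ← hp]
    refine ⟨?_, rfl⟩
    obtain ⟨t, ht, h⟩ := Finset.mem_image.1 (Finset.min'_mem _ (hne.image P))
    rw [count_rankList_pos]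
    have := mem_rightRanks.1 ht
    exact ⟨t, this.1, by rw [hp, h], this.2.2⟩
  · intro hne hp
    rw [dif_pos hne] at hp
    obtain ⟨t, ht, h⟩ := Finset.mem_image.1 (Finset.min'_mem _ (hne.image P))
    rw [← h] at hp
    have h1 := mem_rightRanks.1 ht
    have key : ∀ l, 0 < (rankList servers k P).count (p, l) → l = .right := by
      intro l hl
      obtain ⟨t', ht', rfl, rfl⟩ := count_rankList_pos.1 hl
      have h2 : t < t' := by
        by_contra hc
        have := hP.mono t' t (not_lt.1 hc) h1.1
        omega
      rw [rankLabel_eq_right_iff]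
      have h3 := rankLabel_eq_right_iff.1 h1.2.2
      have h4 : rankBlock servers k P t' = rankBlock servers k P t := by
        rw [h1.2.1]; exact hj
      rw [h4]
      omega
    constructor <;> by_contra hc
    · exact absurd (key _ (Nat.pos_of_ne_zero hc)) (by simp)
    · exact absurd (key _ (Nat.pos_of_ne_zero hc)) (by simp)

end

/-! ### The marking procedures -/

/-- Lets the marking procedures be checked without computing endpoints: a set of ranks closed down
to the first unmarked server is an interval fixed by its cardinality. -/
theorem eq_Ico_of_lower (X : Finset ℕ) : ∀ a : ℕ, (∀ t ∈ X, a ≤ t) →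
    (∀ t ∈ X, ∀ t', a ≤ t' → t' ≤ t → t' ∈ X) → X = Finset.Ico a (a + X.card) := by
  intro a ha hX
  have h : ∀ t ∈ X, t < a + X.card := by
    intro t ht
    have : Finset.Icc a t ⊆ X := fun x hx => by
      rw [Finset.mem_Icc] at hx
      exact hX t ht x hx.1 hx.2
    have := Finset.card_le_card this
    rw [Nat.card_Icc] at this
    have := ha t ht
    omega
  apply Finset.eq_of_subset_of_card_le
  · intro t ht
    exact Finset.mem_Ico.2 ⟨ha t ht, h t ht⟩
  · rw [Nat.card_Ico]; omega

theorem eq_Ico_of_upper (X : Finset ℕ) : ∀ b : ℕ, (∀ t ∈ X, t < b) →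
    (∀ t ∈ X, ∀ t', t ≤ t' → t' < b → t' ∈ X) → X = Finset.Ico (b - X.card) b := by
  intro b hb hX
  have h : ∀ t ∈ X, b - X.card ≤ t := by
    intro t ht
    have : Finset.Ico t b ⊆ X := fun x hx => by
      rw [Finset.mem_Ico] at hx
      exact hX t ht x hx.1 hx.2
    have := Finset.card_le_card this
    rw [Nat.card_Ico] at this
    omega
  apply Finset.eq_of_subset_of_card_le
  · intro t ht
    exact Finset.mem_Ico.2 ⟨h t ht, hb t ht⟩
  · rw [Nat.card_Ico]; omega

/-- Invariant: after blocks `1, …, c` the marked servers are the right ranks of these blocks. The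
servers still available in the next round are ranks of block at least `c + 1`. Between the first of
them and a right rank of block `c + 1` there are, by monotonicity, only right ranks of that block,
so the procedure marks exactly these. -/
theorem GoodRanks.markRight_eq {servers : List ℝ} {k : ℕ} {P : ℕ → ℕ}
    (hP : GoodRanks servers k P) (mR : ℕ → ℕ)
    (hm : ∀ j ∈ Finset.Icc 1 (k - 1), mR j = (rightRanks servers k P j).card) :
    markRight servers.length k mR =
      (Finset.range servers.length).filter (fun t => rankLabel servers k P t = .right) := by
  have key : ∀ c, c ≤ k - 1 → (List.range' 1 c).foldl (fun M i =>
      let unmarked := Finset.Ico (blockEnd servers.length k i) servers.length \ M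
      if h : unmarked.Nonempty then
        M ∪ Finset.Ico (unmarked.min' h) (unmarked.min' h + mR i)
      else M) ∅ = (Finset.range servers.length).filter
        (fun t => rankLabel servers k P t = .right ∧ rankBlock servers k P t ≤ c) := by
    intro c
    induction c with
    | zero =>
      intro _
      symm
      simp only [List.range'_zero, List.foldl_nil]
      rw [Finset.filter_eq_empty_iff]
      intro t _ h
      have := rankBlock_pos (servers := servers) (k := k) (P := P) t
      omega
    | succ c ih =>
      intro hc
      rw [List.range'_1_concat, List.foldl_append, ih (by omega)]
      simp only [List.foldl_cons, List.foldl_nil]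
      rw [add_comm 1 c]
      set M := (Finset.range servers.length).filter
        (fun t => rankLabel servers k P t = .right ∧ rankBlock servers k P t ≤ c) with hM
      set U := Finset.Ico (blockEnd servers.length k (c + 1)) servers.length \ M with hU
      have hmemU : ∀ t, t ∈ U ↔ t < servers.length ∧ blockEnd servers.length k (c + 1) ≤ t ∧
          c + 1 ≤ rankBlock servers k P t := by
        intro t
        rw [hU, hM, Finset.mem_sdiff, Finset.mem_Ico, Finset.mem_filter, Finset.mem_range,
          rankLabel_eq_right_iff]
        constructor
        · rintro ⟨⟨h1, h2⟩, h3⟩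
          refine ⟨h2, h1, ?_⟩
          by_contra h4
          refine h3 ⟨h2, ?_, by omega⟩
          exact (blockEnd_mono _ _ (by omega)).trans h1
        · rintro ⟨h1, h2, h3⟩
          exact ⟨⟨h2, h1⟩, fun h4 => by omega⟩
      have hX : ∀ t ∈ rightRanks servers k P (c + 1), t ∈ U := by
        intro t ht
        have h1 := mem_rightRanks.1 ht
        rw [hmemU]
        refine ⟨h1.1, ?_, h1.2.1.ge⟩
        have := rankLabel_eq_right_iff.1 h1.2.2
        rwa [h1.2.1] at this
      have hgoal : (Finset.range servers.length).filter
          (fun t => rankLabel servers k P t = .right ∧ rankBlock servers k P t ≤ c + 1)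
          = M ∪ rightRanks servers k P (c + 1) := by
        ext t
        rw [Finset.mem_union, hM, Finset.mem_filter, Finset.mem_filter, mem_rightRanks,
          Finset.mem_range, Nat.le_succ_iff]
        tauto
      rw [hgoal]
      by_cases hne : U.Nonempty
      · rw [dif_pos hne, hm (c + 1) (by rw [Finset.mem_Icc]; omega)]
        rw [← eq_Ico_of_lower (rightRanks servers k P (c + 1)) (U.min' hne)]
        · intro t ht
          exact Finset.min'_le _ _ (hX t ht)
        · intro t ht t' h1 h2
          have h3 := mem_rightRanks.1 ht
          have h4 := (hmemU _).1 (Finset.min'_mem U hne)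
          have h5 := hP.rankBlock_mono h1 (h2.trans_lt h3.1)
          have h6 := hP.rankBlock_mono h2 h3.1
          have h7 : rankBlock servers k P t' = c + 1 := by omega
          rw [mem_rightRanks, rankLabel_eq_right_iff, h7]
          exact ⟨h2.trans_lt h3.1, rfl, h4.2.1.trans h1⟩
      · rw [dif_neg hne]
        have : rightRanks servers k P (c + 1) = ∅ := by
          rw [Finset.eq_empty_iff_forall_notMem]
          exact fun t ht => hne ⟨t, hX t ht⟩
        rw [this, Finset.union_empty]
  have := key (k - 1) le_rfl
  unfold markRight
  rw [this]
  apply Finset.filter_congr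
  intro t ht
  rw [Finset.mem_range] at ht
  constructor
  · exact fun h => h.1
  · intro h
    refine ⟨h, ?_⟩
    rw [rankLabel_eq_right_iff] at h
    have h2 := hP.rankBlock_le t
    by_contra hc
    -- A request of the last block has no servers to its right outside the block.
    have : rankBlock servers k P t = k := by omega
    rw [this, blockEnd_self _ _ hP.k_pos] at h
    omega

/-- Mirror image of `markRight_eq`. The blocks are processed downwards, so the induction is over the
segment `b, …, k` with `b` decreasing. -/
theorem GoodRanks.markLeft_eq {servers : List ℝ} {k : ℕ} {P : ℕ → ℕ}
    (hP : GoodRanks servers k P) (mL : ℕ → ℕ)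
    (hm : ∀ j ∈ Finset.Icc 2 k, mL j = (leftRanks servers k P j).card) :
    markLeft servers.length k mL =
      (Finset.range servers.length).filter (fun t => rankLabel servers k P t = .left) := by
  have key : ∀ c b, 2 ≤ b → b + c = k + 1 → (List.range' b c).reverse.foldl (fun M i =>
      let unmarked := Finset.range (blockEnd servers.length k (i - 1)) \ M
      if h : unmarked.Nonempty then
        M ∪ Finset.Ico (unmarked.max' h + 1 - mL i) (unmarked.max' h + 1)
      else M) ∅ = (Finset.range servers.length).filter
        (fun t => rankLabel servers k P t = .left ∧ b ≤ rankBlock servers k P t) := by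
    intro c
    induction c with
    | zero =>
      intro b _ hb
      symm
      simp only [List.range'_zero, List.reverse_nil, List.foldl_nil]
      rw [Finset.filter_eq_empty_iff]
      intro t _ h
      have := hP.rankBlock_le t
      omega
    | succ c ih =>
      intro b hb2 hb
      rw [List.range'_succ, List.reverse_cons, List.foldl_append, ih (b + 1) (by omega) (by omega)]
      simp only [List.foldl_cons, List.foldl_nil]
      set M := (Finset.range servers.length).filter
        (fun t => rankLabel servers k P t = .left ∧ b + 1 ≤ rankBlock servers k P t) with hM
      set U := Finset.range (blockEnd servers.length k (b - 1)) \ M with hU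
      have hlt : blockEnd servers.length k (b - 1) < servers.length :=
        hP.toGoodServers.blockEnd_lt (by omega)
      have hmemU : ∀ t, t ∈ U ↔ t < blockEnd servers.length k (b - 1) ∧
          rankBlock servers k P t ≤ b := by
        intro t
        rw [hU, hM, Finset.mem_sdiff, Finset.mem_range, Finset.mem_filter, Finset.mem_range,
          rankLabel_eq_left_iff]
        constructor
        · rintro ⟨h1, h3⟩
          refine ⟨h1, ?_⟩
          by_contra h4
          refine h3 ⟨by omega, ?_, by omega⟩
          exact h1.trans_le (blockEnd_mono _ _ (by omega))
        · rintro ⟨h1, h3⟩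
          exact ⟨h1, fun h4 => by omega⟩
      have hX : ∀ t ∈ leftRanks servers k P b, t ∈ U := by
        intro t ht
        have h1 := mem_leftRanks.1 ht
        rw [hmemU]
        refine ⟨?_, h1.2.1.le⟩
        have := rankLabel_eq_left_iff.1 h1.2.2
        rwa [h1.2.1] at this
      have hgoal : (Finset.range servers.length).filter
          (fun t => rankLabel servers k P t = .left ∧ b ≤ rankBlock servers k P t)
          = M ∪ leftRanks servers k P b := by
        ext t
        rw [Finset.mem_union, hM, Finset.mem_filter, Finset.mem_filter, mem_leftRanks,
          Finset.mem_range, Nat.succ_le_iff, le_iff_lt_or_eq, eq_comm (a := b)]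
        tauto
      rw [hgoal]
      by_cases hne : U.Nonempty
      · rw [dif_pos hne, hm b (by rw [Finset.mem_Icc]; omega)]
        rw [← eq_Ico_of_upper (leftRanks servers k P b) (U.max' hne + 1)]
        · intro t ht
          exact Nat.lt_succ_of_le (Finset.le_max' _ _ (hX t ht))
        · intro t ht t' h1 h2
          have h3 := mem_leftRanks.1 ht
          have h4 := (hmemU _).1 (Finset.max'_mem U hne)
          have h2' : t' ≤ U.max' hne := by omega
          have h5 := hP.rankBlock_mono h1 (by omega)
          have h6 := hP.rankBlock_mono h2' (by omega)
          have h7 : rankBlock servers k P t' = b := by omega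
          rw [mem_leftRanks, rankLabel_eq_left_iff, h7]
          exact ⟨by omega, rfl, by omega⟩
      · rw [dif_neg hne]
        have : leftRanks servers k P b = ∅ := by
          rw [Finset.eq_empty_iff_forall_notMem]
          exact fun t ht => hne ⟨t, hX t ht⟩
        rw [this, Finset.union_empty]
  have hk := hP.k_pos
  have := key (k - 1) 2 le_rfl (by omega)
  unfold markLeft
  rw [this]
  apply Finset.filter_congr
  intro t ht
  constructor
  · exact fun h => h.1
  · intro h
    refine ⟨h, ?_⟩
    rw [rankLabel_eq_left_iff] at h
    by_contra hc
    rw [show rankBlock servers k P t - 1 = 0 by omega, blockEnd_zero] at h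
    omega

/-! ### The labels of the requests -/

/-- The requests with their labels. -/
def labelsFrom (k : ℕ) (servers : List ℝ) (W : Words) :
    List (ℝ × Label) → List ℝ → List (ℝ × Label)
  | _, [] => []
  | h, r :: rs =>
    let x := (r, DivideState.classify k ⟨servers, W, h, ⟨[], []⟩⟩ r)
    x :: labelsFrom k servers W (h ++ [x]) rs

/-- The positions and labels of a list of labelled requests. -/
def positions (servers : List ℝ) (h : List (ℝ × Label)) : List (ℕ × Label) :=
  h.map (fun x => (positionNat servers x.1, x.2))

/-- At each position the labels came in the order unmarked, right, left, and not more often than in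
`T`. -/
def InOrder (T H : List (ℕ × Label)) : Prop := ∀ p,
  H.count (p, .unmarked) ≤ T.count (p, .unmarked) ∧ H.count (p, .right) ≤ T.count (p, .right) ∧
  H.count (p, .left) ≤ T.count (p, .left) ∧
  (0 < H.count (p, .right) → H.count (p, .unmarked) = T.count (p, .unmarked)) ∧
  (0 < H.count (p, .left) → H.count (p, .unmarked) = T.count (p, .unmarked) ∧
    H.count (p, .right) = T.count (p, .right))

theorem count_map_fst (p : ℕ) (H : List (ℕ × Label)) : (H.map Prod.fst).count p =
    H.count (p, .unmarked) + H.count (p, .right) + H.count (p, .left) := by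
  induction H with
  | nil => simp
  | cons x H ih =>
    obtain ⟨q, l⟩ := x
    rw [List.map_cons, List.count_cons, List.count_cons, List.count_cons, List.count_cons, ih]
    by_cases hq : q = p
    · subst hq
      cases l <;> simp <;> omega
    · have : ∀ l', (q, l) ≠ (p, l') := fun l' h => hq (congrArg Prod.fst h)
      simp [hq]

/-- The label that keeps the order. -/
def nextLabel (T H : List (ℕ × Label)) (p : ℕ) : Label :=
  if H.count (p, .unmarked) < T.count (p, .unmarked) then .unmarked
  else if H.count (p, .right) < T.count (p, .right) then .right
  else .left

/-- The hypothesis says that `p` still has room, so if the unmarked and right labels are used up, a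
left one remains. -/
theorem InOrder.append {T H : List (ℕ × Label)} (h : InOrder T H) {p : ℕ}
    (hp : (H.map Prod.fst).count p < (T.map Prod.fst).count p) :
    InOrder T (H ++ [(p, nextLabel T H p)]) := by
  intro q
  simp only [List.count_append]
  by_cases hq : p = q
  · subst hq
    rw [count_map_fst, count_map_fst] at hp
    obtain ⟨h1, h2, h3, h4, h5⟩ := h p
    unfold nextLabel
    split_ifs with c1 c2
    · simp only [List.count_singleton]
      simp
      grind
    · simp only [List.count_singleton]
      simp
      grind
    · simp only [List.count_singleton]
      simp
      grind
  · have : ∀ l l' : Label, List.count (q, l') [(p, l)] = 0 := by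
      intro l l'
      rw [List.count_eq_zero]
      intro hc
      simp only [List.mem_singleton, Prod.mk.injEq] at hc
      exact hq hc.1.symm
    simp only [this, add_zero]
    exact h q

/-- At each position three counts are bounded by their targets; equal sums force equality in each.
-/
theorem InOrder.perm {T H : List (ℕ × Label)} (h : InOrder T H)
    (hp : (H.map Prod.fst).Perm (T.map Prod.fst)) : H.Perm T := by
  rw [List.perm_iff_count]
  rintro ⟨p, l⟩
  have h1 := List.perm_iff_count.1 hp p
  rw [count_map_fst, count_map_fst] at h1
  have := h p
  cases l <;> omega

/-- Yields that while a right (left) label is outstanding at some position, the block has given out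
fewer than `mR` (`mL`) of them, so the caps in rules 3 and 5 do not bind too early. -/
theorem InOrder.subperm_cons {T H : List (ℕ × Label)} (h : InOrder T H) {p : ℕ} {l : Label}
    (hl : H.count (p, l) < T.count (p, l)) : ((p, l) :: H).Subperm T := by
  rw [List.subperm_ext_iff]
  rintro ⟨q, l'⟩ _
  rw [List.count_cons]
  have := h q
  by_cases e : (p, l) = (q, l')
  · rw [← e]
    simp
    omega
  · simp [e]
    cases l' <;> omega

/-- The words agree as far as they are used. -/
structure WordsAgree (k : ℕ) (W' W : Words) : Prop where
  left : ∀ j ∈ Finset.Icc 2 k, W'.qL j = W.qL j ∧ W'.dL j = W.dL j ∧ W'.mL j = W.mL j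
  right : ∀ j ∈ Finset.Icc 1 (k - 1), W'.qR j = W.qR j ∧ W'.dR j = W.dR j ∧ W'.mR j = W.mR j

theorem length_pastIn {servers : List ℝ} {k : ℕ} (hs : GoodServers servers k) (W : Words)
    (lr : LR.State) (h : List (ℝ × Label)) (hh : ∀ x ∈ h, ∃ z : ℤ, x.1 = z) (j : ℕ) (t : Label) :
    (DivideState.pastIn k ⟨servers, W, h, lr⟩ j t).length =
      (positions servers h).countP (fun x => blockNat servers k x.1 = j ∧ x.2 = t) := by
  unfold DivideState.pastIn positions
  rw [List.length_map, ← List.countP_eq_length_filter, List.countP_map]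
  apply List.countP_congr
  intro x hx
  simp only [Function.comp, blockNat_positionNat hs (hh x hx)]

theorem countAt_eq {servers : List ℝ} {k : ℕ} (hs : GoodServers servers k) (W : Words)
    (lr : LR.State) (h : List (ℝ × Label)) (hh : ∀ x ∈ h, ∃ z : ℤ, x.1 = z) (r : ℝ)
    (hr : ∃ z : ℤ, r = z) (t : Label) :
    DivideState.countAt k ⟨servers, W, h, lr⟩ (blockOf servers k r) t (position servers r) =
      (positions servers h).count (positionNat servers r, t) := by
  unfold DivideState.countAt DivideState.pastIn positions
  rw [List.filter_map, List.length_map, List.filter_filter, ← List.countP_eq_length_filter,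
    List.count, List.countP_map]
  apply List.countP_congr
  intro x hx
  simp only [Function.comp]
  rw [position_eq_cast servers (hh x hx), position_eq_cast servers hr,
    ← blockNat_positionNat hs (hh x hx), ← blockNat_positionNat hs hr]
  simp only [Nat.cast_inj, Bool.and_eq_true, decide_eq_true_eq, beq_iff_eq, Prod.mk.injEq]
  constructor
  · rintro ⟨h1, h2, h3⟩
    exact ⟨h1, h3⟩
  · rintro ⟨h1, h3⟩
    exact ⟨h1, by rw [h1], h3⟩

/-- The combinatorial core of the rules. `TU`, `TR`, `TL` are the target counts at position `p`, and
`u`, `v`, `l` the counts so far. Strictly below `qL` only left labels are wanted, strictly above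
`qR` only right ones, so a mixture is possible only at or between the thresholds. There `dR`
releases the unmarked labels at `qR`, and `dL` holds back the left ones at `qL`. -/
theorem labels_arith (p qL qR TU TR TL u v l dR dL mR mL cR cL : ℕ) (eL eR : Prop)
    [Decidable eL] [Decidable eR]
    (l1 : 0 < TL → eL ∧ p ≤ qL) (l2 : eL → p = qL → 0 < TL ∧ dL = TU + TR)
    (l3 : eL → p < qL → TU = 0 ∧ TR = 0)
    (r1 : 0 < TR → eR ∧ qR ≤ p) (r2 : eR → p = qR → 0 < TR ∧ dR = TU)
    (r3 : eR → qR < p → TU = 0 ∧ TL = 0)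
    (i1 : u ≤ TU) (i2 : v ≤ TR) (tot : u + v + l < TU + TR + TL)
    (c1 : eR → v < TR → cR < mR) (c2 : eL → l < TL → cL < mL) :
    (if (eR ∧ p = qR) ∧ u < dR then Label.unmarked
    else if (eL ∧ p = qL) ∧ ¬ (eR ∧ p = qR) ∧ u < dL then .unmarked
    else if eR ∧ qR < p ∧ cR < mR then .right
    else if (eR ∧ p = qR) ∧ ((eL ∧ p = qL) → u + v < dL) then .right
    else if eL ∧ p < qL ∧ cL < mL then .left
    else if (eL ∧ p = qL) then .left
    else .unmarked) =
    (if u < TU then .unmarked else if v < TR then .right else .left) := by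
  by_cases hu : u < TU
  · rw [if_pos hu]
    have n3 : ¬ (eR ∧ qR < p ∧ cR < mR) := fun h => by have := r3 h.1 h.2.1; omega
    have n5 : ¬ (eL ∧ p < qL ∧ cL < mL) := fun h => by have := l3 h.1 h.2.1; omega
    by_cases atR : eR ∧ p = qR
    · have := r2 atR.1 atR.2
      rw [if_pos ⟨atR, by omega⟩]
    · rw [if_neg (fun h => atR h.1)]
      by_cases atL : eL ∧ p = qL
      · have := l2 atL.1 atL.2
        rw [if_pos ⟨atL, atR, by omega⟩]
      · rw [if_neg (fun h => atL h.1), if_neg n3, if_neg (fun h => atR h.1), if_neg n5,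
          if_neg atL]
  rw [if_neg hu]
  have n1 : ¬ ((eR ∧ p = qR) ∧ u < dR) := fun h => by have := r2 h.1.1 h.1.2; omega
  rw [if_neg n1]
  by_cases hv : v < TR
  · obtain ⟨hR, hq⟩ := r1 (by omega)
    rw [if_pos hv]
    -- At `qL` there is a left request, so `qR < p` is impossible. Hence right labels at `qL` force
    -- `p = qR`, which rule 2 excludes; the same argument recurs below for left labels.
    have n2 : ¬ ((eL ∧ p = qL) ∧ ¬ (eR ∧ p = qR) ∧ u < dL) := fun h => by
      have h1 := l2 h.1.1 h.1.2
      have h2 : qR < p := lt_of_le_of_ne hq (fun e => h.2.1 ⟨hR, e.symm⟩)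
      have := r3 hR h2
      omega
    rw [if_neg n2]
    by_cases hp : p = qR
    · rw [if_neg (fun h => by omega), if_pos]
      refine ⟨⟨hR, hp⟩, fun h => ?_⟩
      have := l2 h.1 h.2
      omega
    · rw [if_pos ⟨hR, by omega, c1 hR hv⟩]
  · rw [if_neg hv]
    obtain ⟨hL, hq⟩ := l1 (by omega)
    have n2 : ¬ ((eL ∧ p = qL) ∧ ¬ (eR ∧ p = qR) ∧ u < dL) := fun h => by
      have h1 := l2 h.1.1 h.1.2
      obtain ⟨h2, h3⟩ := r1 (by omega)
      have h4 : qR < p := lt_of_le_of_ne h3 (fun e => h.2.1 ⟨h2, e.symm⟩)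
      have := r3 h2 h4
      omega
    have n3 : ¬ (eR ∧ qR < p ∧ cR < mR) := fun h => by have := r3 h.1 h.2.1; omega
    have n4 : ¬ ((eR ∧ p = qR) ∧ ((eL ∧ p = qL) → u + v < dL)) := fun h => by
      have h1 := r2 h.1.1 h.1.2
      by_cases hp : p = qL
      · have h2 := l2 hL hp
        have := h.2 ⟨hL, hp⟩
        omega
      · have := l3 hL (by omega)
        omega
    rw [if_neg n2, if_neg n3, if_neg n4]
    by_cases hp : p = qL
    · rw [if_neg (fun h => by omega), if_pos ⟨hL, hp⟩]
    · rw [if_pos ⟨hL, by omega, c2 hL (by omega)⟩]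

theorem GoodRanks.classify_eq {servers : List ℝ} {k : ℕ} {P : ℕ → ℕ}
    (hP : GoodRanks servers k P) {W : Words} (hW : WordsAgree k W (rankWords servers k P))
    (lr : LR.State) (h : List (ℝ × Label)) (hh : ∀ x ∈ h, ∃ z : ℤ, x.1 = z) (r : ℝ)
    (hr : ∃ z : ℤ, r = z) (hin : InOrder (rankList servers k P) (positions servers h))
    (hcount : ((positions servers h).map Prod.fst).count (positionNat servers r) <
      ((rankList servers k P).map Prod.fst).count (positionNat servers r)) :
    DivideState.classify k ⟨servers, W, h, lr⟩ r =
      nextLabel (rankList servers k P) (positions servers h) (positionNat servers r) := by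
  set p := positionNat servers r with hp
  set j := blockOf servers k r with hj
  have hjp : blockNat servers k p = j := blockNat_positionNat hP.toGoodServers hr
  have hj0 : 0 < j := blockOf_pos _ _ _
  have hjk : j ≤ k := blockOf_le _ _ _ hP.k_pos
  have eL : IsExitLeft W.qL j ↔ (leftRanks servers k P j).Nonempty := by
    rw [← hP.isExitLeft_iff]
    unfold IsExitLeft
    by_cases h1 : 1 < j
    · rw [(hW.left j (by rw [Finset.mem_Icc]; omega)).1]
    · simp [h1]
  have eR : IsExitRight servers k W.qR j ↔ (rightRanks servers k P j).Nonempty := by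
    rw [← hP.isExitRight_iff]
    unfold IsExitRight
    by_cases h1 : j < k
    · rw [(hW.right j (by rw [Finset.mem_Icc]; omega)).1]
    · simp [h1]
  have wL : IsExitLeft W.qL j → W.qL j = (rankWords servers k P).qL j ∧
      W.dL j = (rankWords servers k P).dL j ∧ W.mL j = (rankWords servers k P).mL j :=
    fun h1 => hW.left j (by rw [Finset.mem_Icc]; exact ⟨h1.1, hjk⟩)
  have wR : IsExitRight servers k W.qR j → W.qR j = (rankWords servers k P).qR j ∧
      W.dR j = (rankWords servers k P).dR j ∧ W.mR j = (rankWords servers k P).mR j :=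
    fun h1 => hW.right j (by rw [Finset.mem_Icc]; have := h1.1; omega)
  obtain ⟨l1, l2, l3⟩ := hP.left_facts p j hjp
  obtain ⟨r1, r2, r3⟩ := hP.right_facts p j hjp
  rw [← eL] at l1 l2 l3
  rw [← eR] at r1 r2 r3
  obtain ⟨i1, i2, -⟩ := hin p
  rw [count_map_fst, count_map_fst] at hcount
  have hpos : position servers r = (p : ℝ) := position_eq_cast servers hr
  unfold DivideState.classify nextLabel
  simp only [← hj]
  rw [← labels_arith p (W.qL j) (W.qR j) _ _ _ _ _ _ (W.dR j) (W.dL j) (W.mR j) (W.mL j)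
    (DivideState.pastIn k ⟨servers, W, h, lr⟩ j .right).length
    (DivideState.pastIn k ⟨servers, W, h, lr⟩ j .left).length
    (IsExitLeft W.qL j) (IsExitRight servers k W.qR j) ?_ ?_ ?_ ?_ ?_ ?_ i1 i2 hcount ?_ ?_]
  · have e1 := countAt_eq hP.toGoodServers W lr h hh r hr .unmarked
    have e2 := countAt_eq hP.toGoodServers W lr h hh r hr .right
    rw [← hj, ← hp] at e1 e2
    rw [e1, e2, hpos]
    simp only [Nat.cast_inj, Nat.cast_lt]
  · intro h1
    obtain ⟨h2, h3⟩ := l1 h1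
    exact ⟨h2, by rwa [(wL h2).1]⟩
  · intro h1
    rw [(wL h1).1, (wL h1).2.1]
    exact l2 h1
  · intro h1
    rw [(wL h1).1]
    exact l3 h1
  · intro h1
    obtain ⟨h2, h3⟩ := r1 h1
    exact ⟨h2, by rwa [(wR h2).1]⟩
  · intro h1
    rw [(wR h1).1, (wR h1).2.1]
    exact r2 h1
  · intro h1
    rw [(wR h1).1]
    exact r3 h1
  · intro h1 h2
    rw [(wR h1).2.2, length_pastIn hP.toGoodServers W lr h hh]
    simp only [rankWords]
    rw [card_rightRanks]
    have := (hin.subperm_cons h2).countP_le (fun x => blockNat servers k x.1 = j ∧ x.2 = .right)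
    rw [List.countP_cons] at this
    simpa [hjp] using this
  · intro h1 h2
    rw [(wL h1).2.2, length_pastIn hP.toGoodServers W lr h hh]
    simp only [rankWords]
    rw [card_leftRanks]
    have := (hin.subperm_cons h2).countP_le (fun x => blockNat servers k x.1 = j ∧ x.2 = .left)
    rw [List.countP_cons] at this
    simpa [hjp] using this

theorem map_fst_labelsFrom (k : ℕ) (servers : List ℝ) (W : Words) (rs : List ℝ) :
    ∀ h, (labelsFrom k servers W h rs).map Prod.fst = rs := by
  induction rs with
  | nil => intro h; rfl
  | cons r rs ih => intro h; simp [labelsFrom, ih]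

/-- The history stays in order because every label is the one of `nextLabel`; the permutation
hypothesis guarantees room at the next position. The last two conclusions provide the tie condition
for LR, the third carrying it across the boundary between history and future. -/
theorem GoodRanks.labelsFrom_inOrder {servers : List ℝ} {k : ℕ} {P : ℕ → ℕ}
    (hP : GoodRanks servers k P) {W : Words} (hW : WordsAgree k W (rankWords servers k P))
    (rs : List ℝ) (hrs : ∀ r ∈ rs, ∃ z : ℤ, r = z) : ∀ h : List (ℝ × Label),
    (∀ x ∈ h, ∃ z : ℤ, x.1 = z) → InOrder (rankList servers k P) (positions servers h) →
    (((positions servers h).map Prod.fst) ++ rs.map (positionNat servers)).Perm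
      ((rankList servers k P).map Prod.fst) →
    InOrder (rankList servers k P) (positions servers (h ++ labelsFrom k servers W h rs)) ∧
    (labelsFrom k servers W h rs).Pairwise (fun x y => x.2 = .left →
      positionNat servers y.1 = positionNat servers x.1 → y.2 = .left) ∧
    (∀ x ∈ h, ∀ y ∈ labelsFrom k servers W h rs, x.2 = .left →
      positionNat servers y.1 = positionNat servers x.1 → y.2 = .left) := by
  induction rs with
  | nil =>
    intro h _ h2 _
    simpa [labelsFrom] using h2
  | cons r rs ih =>
    intro h h1 h2 h3
    set p := positionNat servers r with hp
    have hcount : ((positions servers h).map Prod.fst).count p <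
        ((rankList servers k P).map Prod.fst).count p := by
      rw [← List.perm_iff_count.1 h3 p, List.count_append, List.map_cons, List.count_cons]
      simp only [← hp, beq_self_eq_true, if_true]
      omega
    have hc := hP.classify_eq hW ⟨[], []⟩ h h1 r (hrs r (by simp)) h2 hcount
    set l := nextLabel (rankList servers k P) (positions servers h) p with hl
    have hpos : positions servers (h ++ [(r, l)]) = positions servers h ++ [(p, l)] := by
      simp [positions, hp]
    obtain ⟨a1, a2, a3⟩ := ih (fun x hx => hrs x (by simp [hx])) (h ++ [(r, l)])
      (by intro x hx
          rw [List.mem_append, List.mem_singleton] at hx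
          rcases hx with hx | rfl
          · exact h1 x hx
          · exact hrs r (by simp))
      (by rw [hpos]; exact h2.append hcount)
      (by rw [hpos]; simpa [← hp] using h3)
    rw [labelsFrom, hc]
    refine ⟨by simpa using a1, ?_, ?_⟩
    · rw [List.pairwise_cons]
      exact ⟨fun y hy => a3 (r, l) (by simp) y hy, a2⟩
    · intro x hx y hy hxl hxy
      rcases List.mem_cons.1 hy with rfl | hy
      · have hxp : positionNat servers x.1 = p := hxy.symm
        have hmem : (p, Label.left) ∈ positions servers h := by
          unfold positions
          exact List.mem_map.2 ⟨x, hx, by rw [hxp, hxl]⟩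
        have := h2 p
        have h5 := this.2.2.2.2 (List.count_pos_iff.2 hmem)
        -- A left label has already occurred at `p`, so the unmarked and right labels there are
        -- exhausted.
        simp only [hl, nextLabel]
        rw [if_neg (by omega), if_neg (by omega)]
      · exact a3 x (by simp [hx]) y hy hxl hxy

/-! ### The run of DIVIDE -/

section Run

variable (k : ℕ) (servers : List ℝ) (W : Words)

def markedList : List ℕ := DivideState.marked k ⟨servers, W, [], ⟨[], []⟩⟩

def ownList (j : ℕ) : List ℕ := DivideState.unmarkedIn k ⟨servers, W, [], ⟨[], []⟩⟩ j

/-- The unmarked requests of a block. -/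
def ownRequests (j : ℕ) (h : List (ℝ × Label)) : List ℝ :=
  DivideState.pastIn k ⟨servers, W, h, ⟨[], []⟩⟩ j .unmarked

/-- The servers at given indices. -/
def serversAt (l : List ℕ) : List ℝ := l.map (fun a => servers.getD a 0)

/-- The answers of `DIVIDE` once the words `W` have been read. -/
def divideAnswers (A : OnlineAlgorithm) : List (ℝ × Label) → List ℕ → List ℝ → List ℕ
  | _, _, [] => []
  | h, used, r :: rs =>
    let label := DivideState.classify k ⟨servers, W, h, ⟨[], []⟩⟩ r
    if label = .unmarked then
      let own := ownList k servers W (blockOf servers k r)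
      own.getD (A.serve (serversAt servers own)
          (ownRequests k servers W (blockOf servers k r) h) r) 0 ::
        divideAnswers A (h ++ [(r, label)]) used rs
    else
      let j := LRState.pick ⟨serversAt servers (markedList k servers W), used⟩ r
        (decide (label = .right))
      (markedList k servers W).getD j 0 :: divideAnswers A (h ++ [(r, label)]) (j :: used) rs

end Run

theorem run_LR_serve (st : LRState) (r : ℝ) (b : Bool) :
    ((LR.serve st r).run (fun _ => b)).1 = (⟨st.servers, st.pick r b :: st.used⟩, st.pick r b) := by
  exact congrArg Prod.fst (BitReader.run_bind (st.choose r)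
    (fun j => BitReader.done ((⟨st.servers, j :: st.used⟩ : LRState), j)) (fun _ => b))

/-- The labels supply the bits for LR on an auxiliary tape, so once `W` is known the main tape is
never touched again: the count is `0`. -/
theorem serveAll_divide (k : ℕ) (A : OnlineAlgorithm) (servers : List ℝ) (W : Words) (rs : List ℝ) :
    ∀ (h : List (ℝ × Label)) (used : List ℕ) (tape : ℕ → Bool),
    ((divide k A).serveAll ⟨servers, W, h, ⟨serversAt servers (markedList k servers W), used⟩⟩
      rs).run tape = (divideAnswers k servers W A h used rs, 0) := by
  induction rs with
  | nil => intro h used tape; rfl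
  | cons r rs ih =>
    intro h used tape
    have hc : DivideState.classify k
        ⟨servers, W, h, ⟨serversAt servers (markedList k servers W), used⟩⟩ r =
        DivideState.classify k ⟨servers, W, h, ⟨[], []⟩⟩ r := rfl
    have e : ∀ (st : DivideState), (divide k A).serveAll st (r :: rs) =
        ((divide k A).serve st r).bind (fun x => ((divide k A).serveAll x.1 rs).bind
          (fun js => .done (x.2 :: js))) := fun _ => rfl
    have es : ∀ st : DivideState, (divide k A).serve st r =
        if st.classify k r = .unmarked then
          (BitReader.done (({ st with history := st.history ++ [(r, st.classify k r)] } :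
            DivideState), (st.unmarkedIn k (blockOf st.servers k r)).getD
            (A.serve ((st.unmarkedIn k (blockOf st.servers k r)).map (fun a => st.servers.getD a 0))
              (st.pastIn k (blockOf st.servers k r) .unmarked) r) 0) :
            BitReader (DivideState × ℕ))
        else
          BitReader.done (({ st with
            history := st.history ++ [(r, st.classify k r)]
            lr := (((LR.serve st.lr r).run (fun _ => decide (st.classify k r = .right))).1).1 } :
            DivideState), (st.marked k).getD
              (((LR.serve st.lr r).run (fun _ => decide (st.classify k r = .right))).1).2 0) :=
      fun _ => rfl
    rw [e, es, divideAnswers]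
    simp only [hc]
    split
    · simp only [BitReader.bind]
      rw [BitReader.run_bind, ih]
      rfl
    · simp only [BitReader.bind, run_LR_serve]
      rw [BitReader.run_bind, ih]
      rfl

theorem play_divide (k : ℕ) (A : OnlineAlgorithm) (I : Input) (tape : ℕ → Bool) :
    ((divide k A).play I).run tape =
      (divideAnswers k I.servers ((readWords k I.servers).run tape).1 A [] [] I.requests,
        ((readWords k I.servers).run tape).2) := by
  have e : (divide k A).play I = ((readWords k I.servers).bind (fun W =>
      (BitReader.done (⟨I.servers, W, [], ⟨serversAt I.servers (markedList k I.servers W), []⟩⟩ :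
        DivideState)))).bind (fun st => (divide k A).serveAll st I.requests) := rfl
  rw [e, BitReader.run_bind, BitReader.run_bind]
  simp only [BitReader.run]
  rw [serveAll_divide]
  rfl

theorem bitsRead_divide_le (k : ℕ) (A : OnlineAlgorithm) (I : Input) (tape : ℕ → Bool) :
    (divide k A).bitsRead I tape ≤
      2 * (k - 1) * width (rangeN I.servers) + 4 * (k - 1) * width I.servers.length := by
  unfold AdviceAlgorithm.bitsRead
  rw [play_divide]
  exact readWords_bitsLE k I.servers tape

/-- The labelled requests together with their servers. -/
def divideTriples (k : ℕ) (servers : List ℝ) (W : Words) (A : OnlineAlgorithm)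
    (h : List (ℝ × Label)) (used : List ℕ) (rs : List ℝ) : List ((ℝ × Label) × ℕ) :=
  (labelsFrom k servers W h rs).zip (divideAnswers k servers W A h used rs)

/-- The block of an unmarked request; `0` for a marked request. -/
def requestClass (servers : List ℝ) (k : ℕ) (x : ℝ × Label) : ℕ :=
  if x.2 = .unmarked then blockOf servers k x.1 else 0

theorem ownRequests_eq (k : ℕ) (servers : List ℝ) (W : Words) (j : ℕ) (hj : 0 < j)
    (h : List (ℝ × Label)) : ownRequests k servers W j h =
      (h.filter (fun x => requestClass servers k x = j)).map Prod.fst := by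
  unfold ownRequests DivideState.pastIn requestClass
  congr 1
  apply List.filter_congr
  intro x _
  by_cases hx : x.2 = .unmarked
  · simp [hx]
  · simp [hx, hj.ne]

/-- Extracting one block from the interleaved run leaves an honest run of the subroutine: its past
is exactly `ownRequests`, which changes only when a request of the class arrives. Class `0` is
excluded because it holds the marked requests. -/
theorem divideTriples_filter_own (k : ℕ) (servers : List ℝ) (W : Words) (A : OnlineAlgorithm)
    (j : ℕ) (hj : 0 < j) (rs : List ℝ) : ∀ (h : List (ℝ × Label)) (used : List ℕ),
    (divideTriples k servers W A h used rs).filter (fun z => requestClass servers k z.1 = j) =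
      ((labelsFrom k servers W h rs).filter (fun x => requestClass servers k x = j)).zip
      ((A.answersFrom (serversAt servers (ownList k servers W j)) (ownRequests k servers W j h)
        (((labelsFrom k servers W h rs).filter
          (fun x => requestClass servers k x = j)).map Prod.fst)).map
        (fun a => (ownList k servers W j).getD a 0)) := by
  induction rs with
  | nil => intro h used; rfl
  | cons r rs ih =>
    intro h used
    unfold divideTriples
    rw [labelsFrom, divideAnswers]
    simp only
    set label := DivideState.classify k ⟨servers, W, h, ⟨[], []⟩⟩ r with hl
    have hpast : ownRequests k servers W j (h ++ [(r, label)]) = ownRequests k servers W j h ++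
        if requestClass servers k (r, label) = j then [r] else [] := by
      rw [ownRequests_eq k servers W j hj, ownRequests_eq k servers W j hj, List.filter_append,
        List.map_append]
      by_cases hc : requestClass servers k (r, label) = j <;> simp [hc]
    by_cases hu : label = .unmarked
    · rw [if_pos hu, List.zip_cons_cons]
      have ih' := ih (h ++ [(r, label)]) used
      unfold divideTriples at ih'
      by_cases hc : requestClass servers k (r, label) = j
      · rw [List.filter_cons_of_pos (by simpa using hc), List.filter_cons_of_pos (by simpa using hc),
          ih', hpast, if_pos hc]
        have hb : blockOf servers k r = j := by
          rw [← hc]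
          simp [requestClass, hu]
        simp only [List.map_cons, OnlineAlgorithm.answersFrom, List.zip_cons_cons, hb]
      · rw [List.filter_cons_of_neg (by simpa using hc), List.filter_cons_of_neg (by simpa using hc),
          ih', hpast, if_neg hc, List.append_nil]
    · rw [if_neg hu, List.zip_cons_cons]
      have hc : requestClass servers k (r, label) ≠ j := by
        simp [requestClass, hu, hj.ne]
      rw [List.filter_cons_of_neg (by simpa using hc), List.filter_cons_of_neg (by simpa using hc)]
      have ih' := ih (h ++ [(r, label)]) (LRState.pick
        ⟨serversAt servers (markedList k servers W), used⟩ r (decide (label = .right)) :: used)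
      unfold divideTriples at ih'
      rw [ih', hpast, if_neg hc, List.append_nil]

/-- The list `used` changes only on marked requests, so these see an undisturbed run of LR. -/
theorem divideTriples_filter_marked (k : ℕ) (servers : List ℝ) (W : Words) (A : OnlineAlgorithm)
    (rs : List ℝ) : ∀ (h : List (ℝ × Label)) (used : List ℕ),
    (divideTriples k servers W A h used rs).filter (fun z => requestClass servers k z.1 = 0) =
      ((labelsFrom k servers W h rs).filter (fun x => requestClass servers k x = 0)).zip
      ((lrAnswers (serversAt servers (markedList k servers W)) used
        (((labelsFrom k servers W h rs).filter (fun x => requestClass servers k x = 0)).map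
          (fun x => (x.1, decide (x.2 = .right))))).map
        (fun a => (markedList k servers W).getD a 0)) := by
  induction rs with
  | nil => intro h used; rfl
  | cons r rs ih =>
    intro h used
    unfold divideTriples
    rw [labelsFrom, divideAnswers]
    simp only
    set label := DivideState.classify k ⟨servers, W, h, ⟨[], []⟩⟩ r with hl
    by_cases hu : label = .unmarked
    · rw [if_pos hu, List.zip_cons_cons]
      have ih' := ih (h ++ [(r, label)]) used
      unfold divideTriples at ih'
      have hc : requestClass servers k (r, label) ≠ 0 := by
        simp [requestClass, hu, (blockOf_pos servers k r).ne']
      rw [List.filter_cons_of_neg (by simpa using hc), List.filter_cons_of_neg (by simpa using hc),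
        ih']
    · rw [if_neg hu, List.zip_cons_cons]
      have hc : requestClass servers k (r, label) = 0 := by
        simp [requestClass, hu]
      rw [List.filter_cons_of_pos (by simpa using hc), List.filter_cons_of_pos (by simpa using hc)]
      have ih' := ih (h ++ [(r, label)]) (LRState.pick
        ⟨serversAt servers (markedList k servers W), used⟩ r (decide (label = .right)) :: used)
      unfold divideTriples at ih'
      rw [ih']
      simp only [List.map_cons, lrAnswers, List.zip_cons_cons]

theorem length_divideAnswers (k : ℕ) (servers : List ℝ) (W : Words) (A : OnlineAlgorithm)
    (rs : List ℝ) : ∀ (h : List (ℝ × Label)) (used : List ℕ),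
    (divideAnswers k servers W A h used rs).length = rs.length := by
  induction rs with
  | nil => intro h used; rfl
  | cons r rs ih =>
    intro h used
    rw [divideAnswers]
    simp only
    split <;> simp [ih]

theorem length_lrAnswers (servers : List ℝ) (Q : List (ℝ × Bool)) :
    ∀ used, (lrAnswers servers used Q).length = Q.length := by
  induction Q with
  | nil => intro _; rfl
  | cons q Q ih => intro used; simp [lrAnswers, ih]

theorem lrAnswers_congr (servers : List ℝ) (f : ℝ → ℝ)
    (hf : ∀ r, ∀ a < servers.length, (servers.getD a 0 = r ↔ servers.getD a 0 = f r) ∧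
      (servers.getD a 0 < r ↔ servers.getD a 0 < f r)) (Q : List (ℝ × Bool)) :
    ∀ used, lrAnswers servers used (Q.map (fun q => (f q.1, q.2))) = lrAnswers servers used Q := by
  induction Q with
  | nil => intro _; rfl
  | cons q Q ih =>
    intro used
    have : LRState.pick ⟨servers, used⟩ (f q.1) q.2 = LRState.pick ⟨servers, used⟩ q.1 q.2 := by
      symm
      apply LRState.pick_congr
      intro a ha
      have := List.mem_of_mem_filter ha
      exact hf q.1 a (by simpa using this)
    simp only [List.map_cons, lrAnswers, this, ih]

/-! ### Costs -/

theorem Input.cost_nonneg (I : Input) (σ : List ℕ) : 0 ≤ I.cost σ := by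
  unfold Input.cost
  apply List.sum_nonneg
  intro x hx
  rw [List.mem_iff_getElem] at hx
  obtain ⟨i, hi, rfl⟩ := hx
  rw [List.getElem_zipWith]
  exact abs_nonneg _

theorem Input.opt_nonneg (I : Input) : 0 ≤ I.opt := by
  apply Real.sInf_nonneg
  rintro x ⟨σ, -, rfl⟩
  exact I.cost_nonneg σ

theorem Input.opt_le (I : Input) {σ : List ℕ} (h : I.IsMatching σ) : I.opt ≤ I.cost σ :=
  csInf_le ⟨0, by rintro x ⟨σ, -, rfl⟩; exact I.cost_nonneg σ⟩ ⟨σ, h, rfl⟩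

theorem Input.le_opt (I : Input) {x : ℝ} (h : ∀ σ, I.IsMatching σ → x ≤ I.cost σ) : x ≤ I.opt := by
  apply le_csInf
  · exact ⟨_, List.range I.size, List.Perm.refl _, rfl⟩
  · rintro y ⟨σ, hσ, rfl⟩
    exact h σ hσ

theorem sum_zipWith_replicate (x : ℝ) (m : ℕ) : ∀ (n : ℕ) (σ : List ℕ), σ.length = n →
    (List.zipWith (fun r j => |r - (List.replicate m (0 : ℝ)).getD j 0|)
      (List.replicate n x) σ).sum = n * |x| := by
  intro n
  induction n with
  | zero => intro σ _; simp
  | succ n ih =>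
    intro σ hσ
    obtain _ | ⟨a, σ⟩ := σ
    · simp at hσ
    · have h0 : (List.replicate m (0 : ℝ)).getD a 0 = 0 := by
        rw [List.getD_eq_getElem?_getD, List.getElem?_replicate]
        split <;> rfl
      rw [List.replicate_succ, List.zipWith_cons_cons, List.sum_cons, ih σ (by simpa using hσ), h0]
      push_cast
      rw [sub_zero]
      ring

/-- No online algorithm is better than optimal. -/
theorem IsCompetitive.one_le {Ω : Type*} [MeasurableSpace Ω] {μ : Measure Ω}
    [IsProbabilityMeasure μ] {A : Ω → OnlineAlgorithm} {c : ℕ → ℝ} {α : ℝ}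
    (h : IsCompetitive μ A c α) {m : ℕ} (hm : 0 < m) : 1 ≤ c m := by
  -- With all servers at `0` and all requests at `x`, every matching costs `m * x`, so no algorithm
  -- can do worse or better than the optimum.
  have key : ∀ x : ℝ, 0 ≤ x → m * x ≤ c m * (m * x) + α := by
    intro x hx
    let I : Input := ⟨List.replicate m 0, List.replicate m x, List.sortedLE_replicate m, by simp⟩
    have hsize : I.size = m := by simp [I, Input.size]
    have hcost : ∀ σ, I.IsMatching σ → I.cost σ = m * x := by
      intro σ hσ
      have hl : σ.length = m := by
        rw [hσ.length_eq, List.length_range, hsize]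
      have := sum_zipWith_replicate x m m σ hl
      rwa [abs_of_nonneg hx] at this
    have hopt : I.opt = m * x := le_antisymm
      ((I.opt_le (List.Perm.refl _)).trans (hcost _ (List.Perm.refl _)).le)
      (I.le_opt (fun σ hσ => (hcost σ hσ).ge))
    obtain ⟨h1, -, h3⟩ := h I
    have h4 : (fun ω => I.cost ((A ω).answers I)) = fun _ => (m : ℝ) * x :=
      funext (fun ω => hcost _ (h1 ω))
    rw [h4, hopt, hsize] at h3
    simpa using h3
  by_contra hc
  have hm' : (0 : ℝ) < m := Nat.cast_pos.2 hm
  have hd : 0 < (1 - c m) * m := mul_pos (by linarith [not_le.1 hc]) hm'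
  -- If `c m < 1`, this `x` makes the gap `(1 - c m) * m * x` equal to `|α| + 1`, more than `α`
  -- allows.
  have h1 := key ((|α| + 1) / ((1 - c m) * m)) (by positivity)
  have h2 : (1 - c m) * m * ((|α| + 1) / ((1 - c m) * m)) = |α| + 1 :=
    mul_div_cancel₀ _ hd.ne'
  have h3 := le_abs_self α
  nlinarith

theorem sum_zip_serversAt (servers : List ℝ) (own : List ℕ) :
    ∀ (l : List (ℝ × Label)) (ans : List ℕ), (∀ a ∈ ans, a < own.length) →
    ((l.zip (ans.map (fun a => own.getD a 0))).map (fun z => |z.1.1 - servers.getD z.2 0|)).sum =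
      (List.zipWith (fun r a => |r - (serversAt servers own).getD a 0|) (l.map Prod.fst) ans).sum
  | [], _, _ => by simp
  | _ :: _, [], _ => by simp
  | x :: l, a :: ans, h => by
    have h1 := sum_zip_serversAt servers own l ans (fun b hb => h b (by simp [hb]))
    have ha : a < own.length := h a (by simp)
    simp only [List.map_cons, List.zip_cons_cons, List.zipWith_cons_cons, List.sum_cons]
    rw [h1]
    congr 3
    unfold serversAt
    rw [List.getD_eq_getElem own 0 ha, List.getD_eq_getElem (own.map _) 0 (by simpa using ha),
      List.getElem_map]

/-- The distance to a server splits at the position of the request. -/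
theorem sum_zipWith_split (f : ℝ → ℝ) (sv : ℕ → ℝ) :
    ∀ (l : List ℝ) (ans : List ℕ), l.length = ans.length →
    (∀ r, ∀ a ∈ ans, |r - sv a| = |r - f r| + |f r - sv a|) →
    (List.zipWith (fun r a => |r - sv a|) l ans).sum =
      (l.map (fun r => |r - f r|)).sum + (List.zipWith (fun r a => |r - sv a|) (l.map f) ans).sum
  | [], _, _, _ => by simp
  | _ :: _, [], h, _ => by simp at h
  | r :: l, a :: ans, h, hf => by
    have h1 := sum_zipWith_split f sv l ans (by simpa using h) (fun r b hb => hf r b (by simp [hb]))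
    simp only [List.map_cons, List.zipWith_cons_cons, List.sum_cons]
    rw [h1, hf r a (by simp)]
    ring

theorem map_getD_range (l : List ℕ) :
    (List.range l.length).map (fun i => l.getD i 0) = l := by
  apply List.ext_getElem
  · simp
  · intro i h1 h2
    rw [List.getElem_map, List.getElem_range, List.getD_eq_getElem _ _ h2]

/-! ### The advice -/

/-- The position of the request of rank `t`. -/
def sortedPosition (I : Input) (t : ℕ) : ℕ :=
  ((I.requests.map (positionNat I.servers)).insertionSort (· ≤ ·)).getD t 0

theorem map_sortedPosition (I : Input) : (List.range I.servers.length).map (sortedPosition I) =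
    (I.requests.map (positionNat I.servers)).insertionSort (· ≤ ·) := by
  have h := map_getD_range ((I.requests.map (positionNat I.servers)).insertionSort (· ≤ ·))
  rw [List.length_insertionSort, List.length_map, I.length_eq] at h
  exact h

theorem map_sortedPosition_perm (I : Input) :
    ((List.range I.servers.length).map (sortedPosition I)).Perm
      (I.requests.map (positionNat I.servers)) := by
  rw [map_sortedPosition]
  exact List.perm_insertionSort _ _

theorem sortedPosition_le (I : Input) (t : ℕ) : sortedPosition I t ≤ rangeN I.servers := by
  unfold sortedPosition
  rw [List.getD_eq_getElem?_getD]
  rcases h : ((I.requests.map (positionNat I.servers)).insertionSort (· ≤ ·))[t]? with _ | x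
  · exact Nat.zero_le _
  · have h1 := List.mem_of_getElem? h
    rw [List.mem_insertionSort, List.mem_map] at h1
    obtain ⟨r, -, rfl⟩ := h1
    exact positionNat_le _ _

theorem sortedPosition_mono (I : Input) (t t' : ℕ) (h : t ≤ t') (ht : t' < I.servers.length) :
    sortedPosition I t ≤ sortedPosition I t' := by
  have hl : ((I.requests.map (positionNat I.servers)).insertionSort (· ≤ ·)).length =
      I.servers.length := by
    rw [List.length_insertionSort, List.length_map, I.length_eq]
  unfold sortedPosition
  rw [List.getD_eq_getElem _ _ (by rw [hl]; omega), List.getD_eq_getElem _ _ (by rw [hl]; omega)]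
  rcases h.eq_or_lt with h | h
  · subst h; exact le_rfl
  · exact List.pairwise_iff_getElem.1
      (List.pairwise_insertionSort (· ≤ ·) (I.requests.map (positionNat I.servers))) _ _ _ _ h

theorem map_fst_rankList (servers : List ℝ) (k : ℕ) (P : ℕ → ℕ) :
    (rankList servers k P).map Prod.fst = (List.range servers.length).map P := by
  unfold rankList
  rw [List.map_map]
  rfl

theorem lt_two_pow_width {v m : ℕ} (h : v ≤ m) : v < 2 ^ width m :=
  h.trans_lt (Nat.lt_pow_succ_log_self (by norm_num) _)

/-- All entries fit their word lengths: positions are at most `N` and counts at most `n`. For `dL`,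
a sum of two counts, this uses that both count ranks at the same position. -/
theorem GoodRanks.exists_words {servers : List ℝ} {k : ℕ} {P : ℕ → ℕ}
    (hP : GoodRanks servers k P) (hN : ∀ t, P t ≤ rangeN servers) :
    ∃ W, (readWords k servers).Produces W ∧ WordsAgree k W (rankWords servers k P) := by
  have hlen : ∀ x, (rankList servers k P).count x ≤ servers.length := by
    intro x
    refine (List.count_le_length).trans ?_
    simp [rankList]
  have hlen2 : ∀ p, (rankList servers k P).count (p, .unmarked) +
      (rankList servers k P).count (p, .right) ≤ servers.length := by
    intro p
    have h1 := count_map_fst p (rankList servers k P)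
    have h2 : ((rankList servers k P).map Prod.fst).count p ≤ servers.length := by
      refine (List.count_le_length).trans ?_
      simp [rankList]
    omega
  have hcard : ∀ X : Finset ℕ, X ⊆ Finset.range servers.length → X.card ≤ servers.length := by
    intro X hX
    simpa using Finset.card_le_card hX
  obtain ⟨W, h1, h2, h3⟩ := readWords_produces k servers (rankWords servers k P)
    (fun j => lt_two_pow_width
      (show (leftRanks servers k P j).sup P ≤ _ from Finset.sup_le (fun t _ => hN t)))
    (fun j => by
      simp only [rankWords]
      split
      · rename_i h
        obtain ⟨t, -, ht⟩ := Finset.mem_image.1 (Finset.min'_mem _ (h.image P))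
        rw [← ht]
        exact lt_two_pow_width (hN t)
      · exact Nat.sub_lt (by positivity) one_pos)
    (fun j => by
      simp only [rankWords]
      split
      · exact lt_two_pow_width (hlen _)
      · exact lt_two_pow_width (Nat.zero_le _))
    (fun j => lt_two_pow_width (hcard _ (Finset.filter_subset _ _)))
    (fun j => by
      simp only [rankWords]
      split
      · exact lt_two_pow_width (hlen2 _)
      · exact lt_two_pow_width (Nat.zero_le _))
    (fun j => lt_two_pow_width (hcard _ (Finset.filter_subset _ _)))
    (fun j hj => by
      rw [hP.isExitLeft_iff, Finset.not_nonempty_iff_eq_empty] at hj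
      simp [rankWords, hj])
    (fun j hj => by
      rw [hP.isExitRight_iff, Finset.not_nonempty_iff_eq_empty] at hj
      simp [rankWords, hj])
  exact ⟨W, h1, h2, h3⟩

/-! ### The classes of servers -/

/-- The block of an unmarked server; `0` for a marked server. -/
def serverClass (servers : List ℝ) (k : ℕ) (P : ℕ → ℕ) (t : ℕ) : ℕ :=
  if rankLabel servers k P t = .unmarked then rankBlock servers k P t else 0

section

variable {servers : List ℝ} {k : ℕ} {P : ℕ → ℕ} (hP : GoodRanks servers k P) {W : Words}
  (hW : WordsAgree k W (rankWords servers k P))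

include hP hW

theorem GoodRanks.markedList_eq : markedList k servers W =
    (List.range servers.length).filter (fun t => serverClass servers k P t = 0) := by
  unfold markedList DivideState.marked
  apply List.filter_congr
  intro t ht
  rw [List.mem_range] at ht
  simp only
  rw [hP.markRight_eq W.mR (fun j hj => (hW.right j hj).2.2),
    hP.markLeft_eq W.mL (fun j hj => (hW.left j hj).2.2)]
  simp only [Finset.mem_union, Finset.mem_filter, Finset.mem_range, ht, true_and]
  have := rankBlock_pos (servers := servers) (k := k) (P := P) t
  refine decide_eq_decide.2 ?_
  unfold serverClass
  rcases rankLabel servers k P t <;> (simp; try omega)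

/-- For an unmarked rank the block of the server and the block of the request coincide, so grouping
by either gives the same lists. -/
theorem GoodRanks.ownList_eq {j : ℕ} (hj : 0 < j) : ownList k servers W j =
    (List.range servers.length).filter (fun t => serverClass servers k P t = j) := by
  unfold ownList DivideState.unmarkedIn
  apply List.filter_congr
  intro t ht
  have hm : t ∈ DivideState.marked k ⟨servers, W, [], ⟨[], []⟩⟩ ↔ serverClass servers k P t = 0 := by
    have := hP.markedList_eq hW
    unfold markedList at this
    rw [this, List.mem_filter]
    simp only [ht, true_and, decide_eq_true_eq]
  simp only [hm]
  congr 1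
  rw [eq_iff_iff]
  have hb := rankBlock_pos (servers := servers) (k := k) (P := P) t
  have hl := rankLabel_eq_left_iff (servers := servers) (k := k) (P := P) (t := t)
  have hr := rankLabel_eq_right_iff (servers := servers) (k := k) (P := P) (t := t)
  have hE := blockEnd_mono servers.length k
  unfold serverClass
  by_cases h : rankLabel servers k P t = .unmarked
  · rw [if_pos h]
    have hl' : ¬ t < blockEnd servers.length k (rankBlock servers k P t - 1) := by
      rw [← hl, h]; simp
    have hr' : ¬ blockEnd servers.length k (rankBlock servers k P t) ≤ t := by
      rw [← hr, h]; simp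
    constructor
    · rintro ⟨h1, h2, -⟩
      by_contra hc
      rcases lt_or_gt_of_ne hc with h3 | h3
      · have := hE (show rankBlock servers k P t ≤ j - 1 by omega)
        omega
      · have := hE (show j ≤ rankBlock servers k P t - 1 by omega)
        omega
    · intro h1
      rw [h1] at hl' hr' hb
      rw [h1]
      exact ⟨not_lt.1 hl', not_le.1 hr', by omega⟩
  · rw [if_neg h]
    simp [hj.ne]

omit hW in
theorem GoodRanks.serverClass_le (t : ℕ) : serverClass servers k P t < k + 1 := by
  have := hP.rankBlock_le t
  unfold serverClass
  split <;> omega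

omit hW in
theorem GoodRanks.length_class_le {j : ℕ} (hj : 0 < j) :
    ((List.range servers.length).filter (fun t => serverClass servers k P t = j)).length ≤
      servers.length ⌈/⌉ k := by
  refine le_trans ?_ (blockEnd_sub_le servers.length k j hP.k_pos)
  have hn : ((List.range servers.length).filter (fun t => serverClass servers k P t = j)).Nodup :=
    List.nodup_range.filter _
  rw [← List.toFinset_card_of_nodup hn, ← Nat.card_Ico]
  apply Finset.card_le_card
  intro t ht
  rw [List.mem_toFinset, List.mem_filter] at ht
  have h1 : serverClass servers k P t = j := by simpa using ht.2
  unfold serverClass at h1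
  have hl := rankLabel_eq_left_iff (servers := servers) (k := k) (P := P) (t := t)
  have hr := rankLabel_eq_right_iff (servers := servers) (k := k) (P := P) (t := t)
  split_ifs at h1 with h2
  · rw [h2, h1] at hl hr
    rw [Finset.mem_Ico]
    refine ⟨not_lt.1 (fun h => ?_), not_le.1 (fun h => ?_)⟩
    · exact absurd (hl.2 h) (by simp)
    · exact absurd (hr.2 h) (by simp)
  · omega

end

/-- The positions and labels of the requests of a class are those of the servers of the class. -/
theorem GoodServers.class_perm {servers : List ℝ} {k : ℕ} (hs : GoodServers servers k) {P : ℕ → ℕ}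
    {H : List (ℝ × Label)} (hH : ∀ x ∈ H, ∃ z : ℤ, x.1 = z)
    (h : (positions servers H).Perm (rankList servers k P)) (j : ℕ) :
    (positions servers (H.filter (fun x => requestClass servers k x = j))).Perm
      (((List.range servers.length).filter (fun t => serverClass servers k P t = j)).map
        (fun t => (P t, rankLabel servers k P t))) := by
  have h1 := h.filter
    (fun x => decide ((if x.2 = .unmarked then blockNat servers k x.1 else 0) = j))
  unfold rankList positions at h1
  rw [List.filter_map, List.filter_map] at h1
  have e : H.filter (fun x => decide (requestClass servers k x = j)) = H.filter
      ((fun x : ℕ × Label => decide ((if x.2 = .unmarked then blockNat servers k x.1 else 0) = j)) ∘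
        fun x => (positionNat servers x.1, x.2)) := by
    apply List.filter_congr
    intro x hx
    simp only [Function.comp, blockNat_positionNat hs (hH x hx)]
    rfl
  unfold positions
  rw [e]
  exact h1

/-! ### The parts of the cost of DIVIDE -/

theorem list_getD_le {servers : List ℝ} {k : ℕ} (hs : GoodServers servers k) {l : List ℕ}
    (hl : l.Pairwise (· < ·)) (hn : ∀ t ∈ l, t < servers.length) :
    (serversAt servers l).Pairwise (· ≤ ·) := by
  unfold serversAt
  rw [List.pairwise_map]
  exact hl.imp_of_mem (fun {a b} _ hb hab => hs.getD_mono hab.le (hn b hb))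

theorem sum_map_getD_range (f : ℕ → ℝ) (l : List ℕ) :
    ((List.range l.length).map (fun i => f (l.getD i 0))).sum = (l.map f).sum := by
  conv_rhs => rw [← map_getD_range l]
  rw [List.map_map]
  rfl

theorem serversAt_getD (servers : List ℝ) (l : List ℕ) {i : ℕ} (hi : i < l.length) :
    (serversAt servers l).getD i 0 = servers.getD (l.getD i 0) 0 := by
  unfold serversAt
  rw [List.getD_eq_getElem (l.map _) 0 (by simpa using hi), List.getElem_map,
    List.getD_eq_getElem l 0 hi]

theorem sum_zipWith_of_map_eq (g : ℕ → ℝ) (sv : ℕ → ℝ) : ∀ (σ : List ℕ),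
    (List.zipWith (fun r a => |r - sv a|) (σ.map g) σ).sum = (σ.map (fun i => |g i - sv i|)).sum
  | [] => by simp
  | a :: σ => by simp [sum_zipWith_of_map_eq g sv σ]

section

variable {servers : List ℝ} {k : ℕ} {P : ℕ → ℕ} (hP : GoodRanks servers k P)

include hP

/-- The unmarked requests of a block can be served like in the monotone matching. -/
theorem GoodRanks.exists_matching_own {own : List ℕ} (hown : ∀ t ∈ own, t < servers.length)
    {R : List ℝ} (hR : ∀ r ∈ R, ∃ z : ℤ, r = z)
    (hperm : (R.map (positionNat servers)).Perm (own.map P)) :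
    ∃ σ : List ℕ, σ.Perm (List.range own.length) ∧
      (List.zipWith (fun r a => |r - (serversAt servers own).getD a 0|) R σ).sum =
        (R.map (fun r => |r - position servers r|)).sum +
          (own.map (fun t => |(P t : ℝ) - servers.getD t 0|)).sum := by
  have h1 : own.map P = (List.range own.length).map (fun i => P (own.getD i 0)) := by
    conv_lhs => rw [← map_getD_range own]
    rw [List.map_map]
    rfl
  rw [h1] at hperm
  obtain ⟨σ, hσ, hσR⟩ := exists_perm_map_eq _ _ _ hperm
  refine ⟨σ, hσ, ?_⟩
  have hlt : ∀ a ∈ σ, a < own.length := fun a ha => by simpa using hσ.mem_iff.1 ha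
  have hlen : R.length = σ.length := by
    have := congrArg List.length hσR
    simpa using this.symm
  rw [sum_zipWith_split (position servers) (fun a => (serversAt servers own).getD a 0) R σ hlen]
  · congr 1
    have h2 : R.map (position servers) = σ.map (fun i => ((P (own.getD i 0) : ℕ) : ℝ)) := by
      have h3 : R.map (position servers) = (R.map (positionNat servers)).map (fun p : ℕ => (p : ℝ)) := by
        rw [List.map_map]
        exact List.map_congr_left (fun r hr => position_eq_cast servers (hR r hr))
      rw [h3, ← hσR, List.map_map]
      rfl
    rw [h2, sum_zipWith_of_map_eq, (hσ.map _).sum_eq,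
      ← sum_map_getD_range (fun t => |(P t : ℝ) - servers.getD t 0|) own]
    congr 1
    apply List.map_congr_left
    intro i hi
    rw [serversAt_getD servers own (by simpa using hi)]
  · intro r a ha
    have h2 := hlt a ha
    rw [serversAt_getD servers own h2]
    apply abs_sub_server hP.toGoodServers
    rw [List.getD_eq_getElem own 0 h2]
    exact hown _ (List.getElem_mem _)

/-- LR serves the marked requests like in the monotone matching. -/
theorem GoodRanks.lrAnswers_le {H : List (ℝ × Label)} (hH : ∀ x ∈ H, ∃ z : ℤ, x.1 = z)
    (hperm : (positions servers H).Perm (rankList servers k P))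
    (horder : H.Pairwise (fun x y => x.2 = .left →
      positionNat servers y.1 = positionNat servers x.1 → y.2 = .left))
    {M : List (ℝ × Label)} (hM : M = H.filter (fun x => requestClass servers k x = 0))
    {own : List ℕ}
    (hown : own = (List.range servers.length).filter (fun t => serverClass servers k P t = 0)) :
    (lrAnswers (serversAt servers own) [] (M.map (fun x => (x.1, decide (x.2 = .right))))).Perm
      (List.range own.length) ∧
    (List.zipWith (fun r a => |r - (serversAt servers own).getD a 0|) (M.map Prod.fst)
      (lrAnswers (serversAt servers own) [] (M.map (fun x => (x.1, decide (x.2 = .right)))))).sum ≤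
      (M.map (fun x => |x.1 - position servers x.1|)).sum +
        (own.map (fun t => |(P t : ℝ) - servers.getD t 0|)).sum := by
  have hlt : ∀ t ∈ own, t < servers.length := by
    intro t ht
    rw [hown] at ht
    simpa using List.mem_of_mem_filter ht
  have hmarked : ∀ t ∈ own, rankLabel servers k P t ≠ .unmarked := by
    intro t ht hc
    rw [hown, List.mem_filter] at ht
    have h1 : serverClass servers k P t = 0 := by simpa using ht.2
    have := rankBlock_pos (servers := servers) (k := k) (P := P) t
    rw [serverClass, if_pos hc] at h1
    omega
  have hpw : own.Pairwise (· < ·) := by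
    rw [hown]
    exact List.pairwise_lt_range.filter _
  have hMint : ∀ x ∈ M, ∃ z : ℤ, x.1 = z := by
    intro x hx
    rw [hM] at hx
    exact hH x (List.mem_of_mem_filter hx)
  have hMmarked : ∀ x ∈ M, x.2 ≠ .unmarked := by
    intro x hx hc
    rw [hM, List.mem_filter] at hx
    have h1 : requestClass servers k x = 0 := by simpa using hx.2
    rw [requestClass, if_pos hc] at h1
    have := blockOf_pos servers k x.1
    omega
  have hpermM := hP.toGoodServers.class_perm hH hperm 0
  rw [← hM, ← hown] at hpermM
  set ms := serversAt servers own with hms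
  have hmslen : ms.length = own.length := by simp [hms, serversAt]
  set Q := M.map (fun x => (x.1, decide (x.2 = .right))) with hQ
  -- LR acts on the true requests, but the comparison with the monotone matching takes place between
  -- positions, so requests are replaced by positions first.
  have hcongr := lrAnswers_congr ms (position servers) (fun r a ha => by
    rw [hmslen] at ha
    rw [hms, serversAt_getD servers own ha]
    refine server_eq_position_iff hP.toGoodServers r (hlt _ ?_)
    rw [List.getD_eq_getElem own 0 ha]
    exact List.getElem_mem _) Q []
  set Q' := Q.map (fun q => (position servers q.1, q.2)) with hQ'
  have hfree : LRState.free ⟨ms, []⟩ = List.range own.length := by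
    unfold LRState.free
    simp [hmslen]
  have hopt := lrAnswers_optimal ms (list_getD_le hP.toGoodServers hpw hlt) Q' []
    (own.map (fun t => ((P t : ℝ), decide (rankLabel servers k P t = .right))))
    (by
      have h1 := (hpermM.map (fun x => ((x.1 : ℝ), decide (x.2 = .right)))).symm
      unfold positions at h1
      rw [List.map_map, List.map_map] at h1
      have h2 : Q' = M.map ((fun x : ℕ × Label => ((x.1 : ℝ), decide (x.2 = .right))) ∘
          fun x => (positionNat servers x.1, x.2)) := by
        rw [hQ', hQ, List.map_map]
        apply List.map_congr_left
        intro x hx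
        simp only [Function.comp, position_eq_cast servers (hMint x hx)]
      rw [h2]
      exact h1)
    (by
      rw [List.pairwise_map]
      exact hpw.imp_of_mem (fun {a b} _ hb hab =>
        Nat.cast_le.2 (hP.mono a b hab.le (hlt b hb))))
    (by
      rw [hQ', hQ, List.pairwise_map, List.pairwise_map]
      have hMo := horder.filter (fun x => decide (requestClass servers k x = 0))
      rw [← hM] at hMo
      refine hMo.imp_of_mem ?_
      intro x y hx _ hxy h1 h2
      have h3 : x.2 = .left := by
        have := hMmarked x hx
        have h1 : x.2 ≠ .right := by simpa using h1
        cases h : x.2 <;> simp_all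
      have h4 : positionNat servers y.1 = positionNat servers x.1 := by
        unfold positionNat
        simp only at h2
        rw [h2]
      have := hxy h3 h4
      simp [this])
    (by
      -- A right rank has its server in a later block, at or to the right of its position; a left
      -- rank has it in an earlier block, strictly to the left.
      rw [hfree, List.forall₂_iff_get]
      refine ⟨by simp, ?_⟩
      intro i h1 h2
      have hi : i < own.length := by simpa using h2
      simp only [List.get_eq_getElem, List.getElem_map, List.getElem_range, Directed]
      rw [hms, serversAt_getD servers own hi, List.getD_eq_getElem own 0 hi]
      set t := own[i] with ht
      have htm : t ∈ own := List.getElem_mem _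
      have htn := hlt t htm
      rw [decide_eq_true_eq]
      constructor
      · intro h
        rw [rankLabel_eq_right_iff] at h
        exact hP.toGoodServers.le_server_of_blockOf h htn (blockOf_le _ _ _ hP.k_pos)
          (blockOf_pos _ _ _)
      · intro h
        by_contra hc
        have h3 : rankLabel servers k P t = .left := by
          have := hmarked t htm
          cases h : rankLabel servers k P t <;> simp_all
        rw [rankLabel_eq_left_iff] at h3
        have := hP.toGoodServers.server_lt_of_blockOf h3 (blockOf_le _ _ _ hP.k_pos)
        linarith)
  rw [hfree, hcongr] at hopt
  refine ⟨hopt.1, ?_⟩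
  have hans : ∀ a ∈ lrAnswers ms [] Q, a < own.length := fun a ha => by
    simpa using hopt.1.mem_iff.1 ha
  rw [sum_zipWith_split (position servers) (fun a => ms.getD a 0) (M.map Prod.fst) _
    (by rw [length_lrAnswers, hQ, List.length_map, List.length_map])
    (fun r a ha => by
      have h2 := hans a ha
      rw [hms, serversAt_getD servers own h2]
      apply abs_sub_server hP.toGoodServers
      rw [List.getD_eq_getElem own 0 h2]
      exact hlt _ (List.getElem_mem _))]
  have e1 : (M.map Prod.fst).map (fun r => |r - position servers r|) =
      M.map (fun x => |x.1 - position servers x.1|) := by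
    rw [List.map_map]; rfl
  rw [e1]
  refine add_le_add le_rfl ?_
  have e2 : pairCost (fun a => ms.getD a 0) Q' (lrAnswers ms [] Q) =
      (List.zipWith (fun r a => |r - ms.getD a 0|)
        ((M.map Prod.fst).map (position servers)) (lrAnswers ms [] Q)).sum := by
    unfold pairCost
    rw [hQ', hQ, List.map_map, List.map_map, List.zipWith_map_left, List.zipWith_map_left]
    rfl
  have e3 : pairCost (fun a => ms.getD a 0)
      (own.map (fun t => ((P t : ℝ), decide (rankLabel servers k P t = .right))))
      (List.range own.length) = (own.map (fun t => |(P t : ℝ) - servers.getD t 0|)).sum := by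
    unfold pairCost
    have h1 : own.map (fun t => ((P t : ℝ), decide (rankLabel servers k P t = .right))) =
        (List.range own.length).map (fun i => ((P (own.getD i 0) : ℝ),
          decide (rankLabel servers k P (own.getD i 0) = .right))) := by
      conv_lhs => rw [← map_getD_range own]
      rw [List.map_map]
      rfl
    rw [h1, List.zipWith_map_left,
      ← sum_map_getD_range (fun t => |(P t : ℝ) - servers.getD t 0|) own]
    have h2 := sum_zipWith_of_map_eq (fun i => (P (own.getD i 0) : ℝ)) (fun a => ms.getD a 0)
      (List.range own.length)
    rw [List.zipWith_map_left] at h2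
    rw [h2]
    congr 1
    apply List.map_congr_left
    intro i hi
    rw [hms, serversAt_getD servers own (by simpa using hi)]
  rw [← e2, ← e3]
  exact hopt.2

end

/-- The optimal cost is that of the monotone matching. -/
theorem monotone_cost_le_opt {I : Input} {k : ℕ} (hs : GoodServers I.servers k)
    (hr : ∀ r ∈ I.requests, ∃ z : ℤ, r = z) :
    (I.requests.map (fun r => |r - position I.servers r|)).sum +
      ((List.range I.servers.length).map
        (fun t => |(sortedPosition I t : ℝ) - I.servers.getD t 0|)).sum ≤ I.opt := by
  apply I.le_opt
  intro σ hσ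
  unfold Input.cost
  have hσlen : σ.length = I.servers.length := by
    rw [hσ.length_eq, List.length_range]
    rfl
  have hlt : ∀ a ∈ σ, a < I.servers.length := fun a ha => by
    have := hσ.mem_iff.1 ha
    rwa [List.mem_range] at this
  rw [sum_zipWith_split (position I.servers) (fun a => I.servers.getD a 0) I.requests σ
    (by rw [I.length_eq, hσlen]) (fun r a ha => abs_sub_server hs r (hlt a ha))]
  refine add_le_add le_rfl ?_
  have h1 := sum_zipWith_sorted_le
    ((List.range I.servers.length).map (fun t => (sortedPosition I t : ℝ)))
    ((List.range I.servers.length).map (fun t => I.servers.getD t 0))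
    ((I.requests.map (position I.servers)).zip (σ.map (fun a => I.servers.getD a 0)))
    (by
      rw [List.pairwise_map]
      refine List.pairwise_lt_range.imp_of_mem (fun {a b} _ hb hab => ?_)
      exact Nat.cast_le.2 (sortedPosition_mono I a b hab.le (by simpa using hb)))
    (by
      rw [List.pairwise_map]
      refine List.pairwise_lt_range.imp_of_mem (fun {a b} _ hb hab => ?_)
      exact hs.getD_mono hab.le (by simpa using hb))
    (by
      rw [List.map_fst_zip (by simp [I.length_eq, hσlen])]
      have h2 := ((map_sortedPosition_perm I).map (fun p : ℕ => (p : ℝ))).symm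
      rw [List.map_map, List.map_map] at h2
      have h3 : I.requests.map (position I.servers) =
          I.requests.map ((fun p : ℕ => (p : ℝ)) ∘ positionNat I.servers) :=
        List.map_congr_left (fun r h => position_eq_cast _ (hr r h))
      rw [h3]
      exact h2)
    (by
      rw [List.map_snd_zip (by simp [I.length_eq, hσlen])]
      exact hσ.map _)
  have e1 : ((List.range I.servers.length).map
      (fun t => |(sortedPosition I t : ℝ) - I.servers.getD t 0|)) = List.zipWith
      (fun p s => |p - s|) ((List.range I.servers.length).map (fun t => (sortedPosition I t : ℝ)))
      ((List.range I.servers.length).map (fun t => I.servers.getD t 0)) := by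
    rw [List.zipWith_map_left, List.zipWith_map_right, List.zipWith_self]
  have e2 : (((I.requests.map (position I.servers)).zip (σ.map (fun a => I.servers.getD a 0))).map
      (fun z => |z.1 - z.2|)) = List.zipWith (fun r a => |r - I.servers.getD a 0|)
      (I.requests.map (position I.servers)) σ := by
    rw [List.zip_eq_zipWith, List.map_zipWith, List.zipWith_map_right]
  rw [e1, ← e2]
  exact h1

section

variable {servers : List ℝ} {k : ℕ} {P : ℕ → ℕ}

theorem length_class_eq {H : List (ℝ × Label)} {j : ℕ}
    (h : (positions servers (H.filter (fun x => requestClass servers k x = j))).Perm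
      (((List.range servers.length).filter (fun t => serverClass servers k P t = j)).map
        (fun t => (P t, rankLabel servers k P t)))) :
    (H.filter (fun x => requestClass servers k x = j)).length =
      ((List.range servers.length).filter (fun t => serverClass servers k P t = j)).length := by
  have := h.length_eq
  simpa [positions] using this

/-- The input on which the subroutine is run in the block `j`. -/
def blockInput (hs : GoodServers servers k) {H : List (ℝ × Label)}
    (hH : ∀ x ∈ H, ∃ z : ℤ, x.1 = z) (h : (positions servers H).Perm (rankList servers k P))
    (j : ℕ) : Input where
  servers := serversAt servers
    ((List.range servers.length).filter (fun t => serverClass servers k P t = j))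
  requests := (H.filter (fun x => requestClass servers k x = j)).map Prod.fst
  sorted := (list_getD_le hs (List.pairwise_lt_range.filter _)
    (fun t ht => by simpa using List.mem_of_mem_filter ht)).sortedLE
  length_eq := by
    rw [List.length_map, length_class_eq (hs.class_perm hH h j), serversAt, List.length_map]

theorem blockInput_size (hs : GoodServers servers k) {H : List (ℝ × Label)}
    (hH : ∀ x ∈ H, ∃ z : ℤ, x.1 = z) (h : (positions servers H).Perm (rankList servers k P))
    (j : ℕ) : (blockInput hs hH h j).size =
      ((List.range servers.length).filter (fun t => serverClass servers k P t = j)).length := by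
  simp [blockInput, Input.size, serversAt]

/-- The monotone matching restricted to the class is a feasible matching of the block input, and its
cost is the right-hand side. -/
theorem GoodRanks.opt_blockInput_le (hP : GoodRanks servers k P) {H : List (ℝ × Label)}
    (hH : ∀ x ∈ H, ∃ z : ℤ, x.1 = z) (h : (positions servers H).Perm (rankList servers k P))
    (j : ℕ) : (blockInput hP.toGoodServers hH h j).opt ≤
      ((H.filter (fun x => requestClass servers k x = j)).map
        (fun x => |x.1 - position servers x.1|)).sum +
      (((List.range servers.length).filter (fun t => serverClass servers k P t = j)).map
        (fun t => |(P t : ℝ) - servers.getD t 0|)).sum := by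
  obtain ⟨σ, hσ, hc⟩ := hP.exists_matching_own
    (own := (List.range servers.length).filter (fun t => serverClass servers k P t = j))
    (fun t ht => by simpa using List.mem_of_mem_filter ht)
    (R := (H.filter (fun x => requestClass servers k x = j)).map Prod.fst)
    (fun r hr => by
      obtain ⟨x, hx, rfl⟩ := List.mem_map.1 hr
      exact hH x (List.mem_of_mem_filter hx))
    (by
      have := (hP.toGoodServers.class_perm hH h j).map Prod.fst
      unfold positions at this
      rw [List.map_map, List.map_map] at this
      rw [List.map_map]
      exact this)
  rw [List.map_map] at hc
  refine ((blockInput hP.toGoodServers hH h j).opt_le (σ := σ) ?_).trans hc.le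
  unfold Input.IsMatching
  rw [blockInput_size]
  exact hσ

end

/-! ### Assembling the bound on the expected cost. -/

/-- The words, and so the labels, the marked servers and the answers of LR, do not depend on `ω`.
Only the runs of the subroutine on the fixed block inputs are random, and linearity of expectation
adds up their bounds. -/
theorem divide_competitive_of_input {Ω : Type*} [MeasurableSpace Ω] {μ : Measure Ω}
    [IsProbabilityMeasure μ] {A : Ω → OnlineAlgorithm} {c : ℕ → ℝ} {α : ℝ} {k : ℕ}
    (hc : Monotone c) (hA : IsCompetitive μ A c α) {I : Input} (hs : GoodServers I.servers k)
    (hr : ∀ r ∈ I.requests, ∃ z : ℤ, r = z) :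
    ∃ tape : ℕ → Bool, (∀ ω, I.IsMatching ((divide k (A ω)).answers I tape)) ∧
      Integrable (fun ω => I.cost ((divide k (A ω)).answers I tape)) μ ∧
      ∫ ω, I.cost ((divide k (A ω)).answers I tape) ∂μ ≤ c (I.size ⌈/⌉ k) * I.opt + k * α := by
  set s := I.servers with hsdef
  set P := sortedPosition I with hPdef
  have hP : GoodRanks s k P := ⟨hs, sortedPosition_mono I⟩
  obtain ⟨W, ⟨l, hl⟩, hW⟩ := hP.exists_words (sortedPosition_le I)
  set H := labelsFrom k s W [] I.requests with hHdef
  have hHfst : H.map Prod.fst = I.requests := map_fst_labelsFrom k s W I.requests []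
  have hH : ∀ x ∈ H, ∃ z : ℤ, x.1 = z := fun x hx =>
    hr x.1 (by rw [← hHfst]; exact List.mem_map_of_mem hx)
  have hposfst : (positions s H).map Prod.fst = I.requests.map (positionNat s) := by
    rw [← hHfst]
    unfold positions
    rw [List.map_map, List.map_map]
    rfl
  have hrank : (I.requests.map (positionNat s)).Perm ((rankList s k P).map Prod.fst) := by
    rw [map_fst_rankList]
    exact (map_sortedPosition_perm I).symm
  obtain ⟨h1, h2, -⟩ := hP.labelsFrom_inOrder hW I.requests hr [] (by simp)
    (by intro p; simp [positions]) (by simpa [positions] using hrank)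
  rw [List.nil_append] at h1
  have hperm : (positions s H).Perm (rankList s k P) := h1.perm (by rw [hposfst]; exact hrank)
  set own : ℕ → List ℕ := fun j =>
    (List.range s.length).filter (fun t => serverClass s k P t = j) with hown
  set J : ℕ → Input := blockInput hs hH hperm with hJ
  set part : ℕ → List (ℝ × Label) := fun j =>
    H.filter (fun x => requestClass s k x = j) with hpart
  set tape : ℕ → Bool := fun i => l.getD i false with htape
  have hrun : (readWords k s).run tape = (W, l.length) := hl tape (fun i _ => rfl)
  have hans : ∀ ω, (divide k (A ω)).answers I tape =
      divideAnswers k s W (A ω) [] [] I.requests := by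
    intro ω
    unfold AdviceAlgorithm.answers
    rw [play_divide, ← hsdef, hrun]
  set Z : Ω → List ((ℝ × Label) × ℕ) := fun ω => divideTriples k s W (A ω) [] [] I.requests with hZ
  have hHlen : H.length = I.requests.length := by rw [← hHfst, List.length_map]
  have hclass : ∀ ω, ∀ z ∈ Z ω, requestClass s k z.1 < k + 1 := by
    intro ω z _
    unfold requestClass
    have := blockOf_le s k z.1.1 hs.k_pos
    split <;> omega
  -- the answers of LR
  set lrA := lrAnswers (serversAt s (own 0)) [] ((part 0).map (fun x => (x.1, decide (x.2 = .right))))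
    with hlrA
  obtain ⟨hlr1, hlr2⟩ := hP.lrAnswers_le hH hperm h2 (M := part 0) rfl (own := own 0) rfl
  rw [← hlrA] at hlr1 hlr2
  -- the answers of the subroutine
  have hsub : ∀ ω j, ((A ω).answers (J j)).Perm (List.range (own j).length) := by
    intro ω j
    have := (hA (J j)).1 ω
    unfold Input.IsMatching at this
    rwa [blockInput_size] at this
  have hZ0 : ∀ ω, (Z ω).filter (fun z => requestClass s k z.1 = 0) =
      (part 0).zip (lrA.map (fun a => (own 0).getD a 0)) := by
    intro ω
    have := divideTriples_filter_marked k s W (A ω) I.requests [] []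
    rw [hP.markedList_eq hW] at this
    exact this
  have hZj : ∀ ω j, (Z ω).filter (fun z => requestClass s k z.1 = j + 1) =
      (part (j + 1)).zip (((A ω).answers (J (j + 1))).map (fun a => (own (j + 1)).getD a 0)) := by
    intro ω j
    have := divideTriples_filter_own k s W (A ω) (j + 1) (Nat.succ_pos j) I.requests [] []
    rw [hP.ownList_eq hW (Nat.succ_pos j)] at this
    exact this
  have hpartlen : ∀ j, (part j).length = (own j).length :=
    fun j => length_class_eq (hs.class_perm hH hperm j)
  have hmap : ∀ (j : ℕ) (ans : List ℕ), ans.Perm (List.range (own j).length) →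
      (((part j).zip (ans.map (fun a => (own j).getD a 0))).map Prod.snd).Perm (own j) := by
    intro j ans h
    rw [List.map_snd_zip (by rw [List.length_map, h.length_eq, List.length_range, hpartlen])]
    have := h.map (fun a => (own j).getD a 0)
    rwa [map_getD_range] at this
  have hZsnd : ∀ ω j, (((Z ω).filter (fun z => requestClass s k z.1 = j)).map Prod.snd).Perm
      (own j) := by
    intro ω j
    obtain _ | j := j
    · rw [hZ0]
      exact hmap 0 _ hlr1
    · rw [hZj]
      exact hmap (j + 1) _ (hsub ω (j + 1))
  have hmatch : ∀ ω, I.IsMatching (divideAnswers k s W (A ω) [] [] I.requests) := by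
    intro ω
    unfold Input.IsMatching
    have e : divideAnswers k s W (A ω) [] [] I.requests = (Z ω).map Prod.snd := by
      rw [hZ]
      simp only [divideTriples]
      rw [List.map_snd_zip (by rw [length_divideAnswers, ← hHdef, hHlen])]
    -- Both the answers and `List.range` are written as sums of singletons and split by class; in
    -- each class the answers are a permutation of its servers.
    rw [e, ← Multiset.coe_eq_coe, ← sum_map_singleton_list,
      sum_map_eq_sum_filter (fun z => requestClass s k z.1) _ (k + 1) _ (hclass ω)]
    have e2 := sum_map_eq_sum_filter (serverClass s k P) (fun t => ({t} : Multiset ℕ)) (k + 1)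
      (List.range s.length) (fun t _ => hP.serverClass_le t)
    rw [sum_map_singleton_list, List.map_id'] at e2
    have e3 : (List.range I.size : Multiset ℕ) = List.range s.length := rfl
    rw [e3, e2]
    apply Finset.sum_congr rfl
    intro j _
    rw [sum_map_singleton_list, sum_map_singleton_list, List.map_id', Multiset.coe_eq_coe]
    exact hZsnd ω j
  -- the cost
  set lrCost := (List.zipWith (fun r a => |r - (serversAt s (own 0)).getD a 0|)
    ((part 0).map Prod.fst) lrA).sum with hlrCost
  have hcost : ∀ ω, I.cost (divideAnswers k s W (A ω) [] [] I.requests) =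
      ∑ j ∈ Finset.range k, (J (j + 1)).cost ((A ω).answers (J (j + 1))) + lrCost := by
    intro ω
    have e : I.cost (divideAnswers k s W (A ω) [] [] I.requests) =
        ((Z ω).map (fun z => |z.1.1 - s.getD z.2 0|)).sum := by
      unfold Input.cost
      rw [hZ]
      simp only [divideTriples]
      rw [← hHdef, List.zip_eq_zipWith, List.map_zipWith]
      conv_lhs => rw [← hHfst, List.zipWith_map_left]
      rw [hHfst]
    rw [e, sum_map_eq_sum_filter (fun z => requestClass s k z.1) _ (k + 1) _ (hclass ω),
      Finset.sum_range_succ']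
    congr 1
    · apply Finset.sum_congr rfl
      intro j _
      rw [hZj, sum_zip_serversAt s (own (j + 1)) _ _ (fun a ha => by
        simpa using (hsub ω (j + 1)).mem_iff.1 ha)]
      rfl
    · rw [hZ0, sum_zip_serversAt s (own 0) _ _ (fun a ha => by
        simpa using hlr1.mem_iff.1 ha)]
  refine ⟨tape, fun ω => by rw [hans]; exact hmatch ω, ?_, ?_⟩
  · simp only [hans, hcost]
    exact (integrable_finsetSum _ (fun j _ => (hA (J (j + 1))).2.1)).add (integrable_const _)
  · simp only [hans, hcost]
    rw [integral_add (integrable_finsetSum _ (fun j _ => (hA (J (j + 1))).2.1))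
      (integrable_const _), integral_finsetSum _ (fun j _ => (hA (J (j + 1))).2.1)]
    have hCpos : 0 < I.size ⌈/⌉ k := by
      have h3 : 1 ≤ s.length / k := (Nat.one_le_div_iff hs.k_pos).2 hs.k_le
      have h4 := ceilDiv_eq s.length k hs.k_pos
      have h5 : I.size ⌈/⌉ k = s.length ⌈/⌉ k := rfl
      omega
    set C := c (I.size ⌈/⌉ k) with hC
    have hC1 : 1 ≤ C := hA.one_le hCpos
    set dev : ℕ → ℝ := fun j => ((part j).map (fun x => |x.1 - position s x.1|)).sum with hdev
    set mat : ℕ → ℝ := fun j => ((own j).map (fun t => |(P t : ℝ) - s.getD t 0|)).sum with hmat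
    have hblock : ∀ j ∈ Finset.range k, ∫ ω, (J (j + 1)).cost ((A ω).answers (J (j + 1))) ∂μ ≤
        C * (dev (j + 1) + mat (j + 1)) + α := by
      intro j _
      refine (hA (J (j + 1))).2.2.trans ?_
      have h3 : c (J (j + 1)).size ≤ C := hc (by
        rw [hJ, blockInput_size]
        exact hP.length_class_le (Nat.succ_pos j))
      have h4 : (J (j + 1)).opt ≤ dev (j + 1) + mat (j + 1) :=
        hP.opt_blockInput_le hH hperm (j + 1)
      have h5 := mul_le_mul_of_nonneg_right h3 (J (j + 1)).opt_nonneg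
      have h6 := mul_le_mul_of_nonneg_left h4 (zero_le_one.trans hC1)
      linarith
    -- LR costs at most its share of the optimum, with no additive term; the factor `C ≥ 1` only
    -- brings it to the form of the other classes.
    have hlrC : lrCost ≤ C * (dev 0 + mat 0) := by
      have h0 : 0 ≤ lrCost := (J 0).cost_nonneg lrA
      have h3 : lrCost ≤ dev 0 + mat 0 := hlr2
      nlinarith
    have hopt := monotone_cost_le_opt hs hr
    have e1 : (I.requests.map (fun r => |r - position I.servers r|)).sum =
        ∑ j ∈ Finset.range (k + 1), dev j := by
      have := sum_map_eq_sum_filter (requestClass s k)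
        (fun x => |x.1 - position s x.1|) (k + 1) H (fun x _ => by
          unfold requestClass
          have := blockOf_le s k x.1 hs.k_pos
          split <;> omega)
      rw [← this, ← hHfst, List.map_map]
      rfl
    have e2 : ((List.range I.servers.length).map
        (fun t => |(sortedPosition I t : ℝ) - I.servers.getD t 0|)).sum =
        ∑ j ∈ Finset.range (k + 1), mat j :=
      sum_map_eq_sum_filter (serverClass s k P) (fun t => |(P t : ℝ) - s.getD t 0|) (k + 1)
        (List.range s.length) (fun t _ => hP.serverClass_le t)
    rw [e1, e2, Finset.sum_range_succ', Finset.sum_range_succ'] at hopt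
    have h7 := Finset.sum_le_sum hblock
    rw [Finset.sum_add_distrib, ← Finset.mul_sum, Finset.sum_add_distrib, Finset.sum_const,
      Finset.card_range, nsmul_eq_mul] at h7
    have h8 := mul_le_mul_of_nonneg_left hopt (zero_le_one.trans hC1)
    rw [integral_const, probReal_univ, one_smul]
    linarith

/-! ### The amount of advice -/

theorem width_le (m : ℕ) (hm : 0 < m) : (width m : ℝ) ≤ Real.log m / Real.log 2 + 1 := by
  unfold width
  have h2 : 0 < Real.log 2 := Real.log_pos one_lt_two
  have h1 : ((2 ^ Nat.log 2 m : ℕ) : ℝ) ≤ m := Nat.cast_le.2 (Nat.pow_log_le_self 2 hm.ne')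
  push_cast at h1
  have h3 := Real.log_le_log (by positivity) h1
  rw [Real.log_pow] at h3
  have h4 := (le_div_iff₀ h2).2 h3
  push_cast
  linarith

theorem bitsRead_divide_le_log (b : ℝ) {k N : ℕ} (hk : 0 < k) {I : Input}
    (hI : IsDivideInput k N I) (hN : (N : ℝ) = (I.size : ℝ) ^ b) (A : OnlineAlgorithm)
    (tape : ℕ → Bool) : ((divide k A).bitsRead I tape : ℝ) ≤
      ((2 * |b| + 10) / Real.log 2) * (k * Real.log I.size) := by
  obtain ⟨hs, hr⟩ := hI.goodServers hk
  have hb := bitsRead_divide_le k A I tape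
  have h2 : 0 < Real.log 2 := Real.log_pos one_lt_two
  have hsize : I.servers.length = I.size := rfl
  rw [hr, hsize] at hb
  have hks : k ≤ I.size := hI.2.1
  rcases Nat.eq_or_lt_of_le (Nat.one_le_iff_ne_zero.2 hk.ne') with h1 | h1
  -- For `k = 1` nothing is read. This case is separate because `n` may then be `1`, with `log n =
  -- 0`.
  · rw [← h1] at hb
    have h0 : (divide k A).bitsRead I tape = 0 := by rw [← h1]; simpa using hb
    rw [h0]
    have := Real.log_natCast_nonneg I.size
    push_cast
    positivity
  · have hL : Real.log 2 ≤ Real.log I.size :=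
      Real.log_le_log two_pos (by exact_mod_cast (by omega : 2 ≤ I.size))
    have hlogN : Real.log N ≤ |b| * Real.log I.size := by
      rw [hN, Real.log_rpow (by exact_mod_cast (by omega : 0 < I.size))]
      exact mul_le_mul_of_nonneg_right (le_abs_self b) (h2.le.trans hL)
    have hwN := width_le N hI.1
    have hwn := width_le I.size (by omega)
    set x := Real.log I.size / Real.log 2 with hx
    have hx1 : 1 ≤ x := (one_le_div h2).2 hL
    have hxN : Real.log N / Real.log 2 ≤ |b| * x := by
      rw [hx, ← mul_div_assoc]
      exact div_le_div_of_nonneg_right hlogN h2.le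
    have hb' : ((divide k A).bitsRead I tape : ℝ) ≤
        2 * (k - 1 : ℕ) * width N + 4 * (k - 1 : ℕ) * width I.size := by exact_mod_cast hb
    have hk1 : ((k - 1 : ℕ) : ℝ) ≤ k := Nat.cast_le.2 (Nat.sub_le _ _)
    have hk0 : (0 : ℝ) ≤ ((k - 1 : ℕ) : ℝ) := Nat.cast_nonneg _
    have e : ((2 * |b| + 10) / Real.log 2) * (k * Real.log I.size) = k * ((2 * |b| + 10) * x) := by
      rw [hx]; ring
    rw [e]
    -- Here `x ≥ 1` because `n ≥ k ≥ 2`. So `2 (|b| x + 1) + 4 (x + 1)` is at most `(2 |b| + 10) x`,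
    -- which explains the constant.
    have hw : 2 * (width N : ℝ) + 4 * width I.size ≤ (2 * |b| + 10) * x := by linarith
    have h3 := mul_le_mul_of_nonneg_left hw hk0
    have h4 : 0 ≤ (2 * |b| + 10) * x :=
      mul_nonneg (by have := abs_nonneg b; linarith) (by linarith)
    have h5 := mul_le_mul_of_nonneg_right hk1 h4
    linarith

end LineMatching

end

open LineMatching in
theorem mainTheorem5 (b : ℝ) :
    ∃ C : ℝ, ∀ (Ω : Type*) [MeasurableSpace Ω] (μ : MeasureTheory.Measure Ω)
      [MeasureTheory.IsProbabilityMeasure μ] (A : Ω → OnlineAlgorithm) (c : ℕ → ℝ) (α : ℝ)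
      (k : ℕ), Monotone c → IsCompetitive μ A c α → 0 < k →
      IsCompetitiveWithAdvice μ (fun ω => divide k (A ω))
        {I | ∃ N : ℕ, IsDivideInput k N I ∧ (N : ℝ) = (I.size : ℝ) ^ b}
        (fun n => c (n ⌈/⌉ k)) (k * α) ∧
      ∀ (N : ℕ) (I : Input), IsDivideInput k N I → (N : ℝ) = (I.size : ℝ) ^ b →
        ∀ (ω : Ω) (tape : ℕ → Bool),
          ((divide k (A ω)).bitsRead I tape : ℝ) ≤ C * (k * Real.log I.size) := by
  refine ⟨(2 * |b| + 10) / Real.log 2, ?_⟩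
  intro Ω _ μ _ A c α k hc hA hk
  refine ⟨?_, fun N I hI hN ω tape => bitsRead_divide_le_log b hk hI hN (A ω) tape⟩
  rintro I ⟨N, hI, -⟩
  exact divide_competitive_of_input hc hA (hI.goodServers hk).1 hI.2.2.2.2
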